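/- **Diagrams.** Diagrams of the qutrit ZX-calculus are the morphisms, read from top to bottom, of the free strict symmetric monoidal category (PROP) on one wire generated by green nodes $Z^{m}_{n}(\alpha/\beta)$ and red nodes $X^{m}_{n}(\alpha/\beta)$ ($m$ inputs, $n$ outputs, angles $\alpha,\beta$ modulo $2\pi$) and the boxes $H,H^\dagger$ (one input, one output). In the rules below phases that are not written are $0/0$, and in phases $1,2$ abbreviate $\frac{2\pi}{3},\frac{4\pi}{3}$. With $\omega=e^{2\pi i/3}$ and $|\omega^j\rangle=\sum_x\omega^{jx}|x\rangle$, the standard interpretation $[\![\cdot]\!]$ is $Z^m_n(\alpha/\beta)\mapsto |0^n\rangle\langle 0^m|+e^{i\alpha}|1^n\rangle\langle 1^m|+e^{i\beta}|2^n\rangle\langle 2^m|$; the same with $|\omega^j\rangle$ in place of $|j\rangle$ for $X^m_n(\alpha/\beta)$; $H\mapsto\sum_j|\omega^j\rangle\langle j|$; $H^\dagger\mapsto\sum_j|\omega^{-j}\rangle\langle j|$. **Rules.** Composites are written in the order of application, $f;g$ meaning first $f$ then $g$, and $\sigma$ is the swap of two wires. Non-zero scalars are ignored, that is, a diagram $s$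 without inputs and outputs and with $[\![s]\!]\neq 0$ equals the empty diagram. The rules are: (S1) two green nodes joined by one or more wires fuse, their phases being added; (S2) $Z^1_1=\mathrm{id}$; (S3) $Z^0_2;\sigma=Z^0_2$; (B1) $X^0_1;Z^1_2=X^0_1\otimes X^0_1$; (B2) $X^2_1;Z^1_2=(Z^1_2\otimes Z^1_2);(\mathrm{id}\otimes\sigma\otimes\mathrm{id});(X^2_1\otimes X^2_1)$; (K1) $P;Z^1_2=Z^1_2;(P\otimes P)$ for $P=X^1_1(1/2)$ and $P=X^1_1(2/1)$; (K2) $Z^1_1(\alpha/\beta);X^1_1(1/2)=X^1_1(1/2);Z^1_1((\beta-\alpha)/(-\alpha))$ and $Z^1_1(\alpha/\beta);X^1_1(2/1)=X^1_1(2/1);Z^1_1((-\beta)/(\alpha-\beta))$; (H1) $H;H^\dagger=\mathrm{id}=H^\dagger;H$; (H2) $X^m_n(\alpha/\beta)=(H^\dagger)^{\otimes m};Z^m_n(\alpha/\beta);H^{\otimes n}$; (H2$'$) $X^m_n(\alpha/\beta)=H^{\otimes m};Z^m_n(\beta/\alpha);(H^\dagger)^{\otimes n}$; (P1) $(\mathrm{id}\otimes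 X^0_2);(Z^2_0\otimes\mathrm{id})=H;H=H^\dagger;H^\dagger$. For a set $E$ of additional equations between diagrams, an equation is *derivable from $E$* if it follows from these rules and $E$ by equational reasoning inside diagrams. **Graph states.** A 3-multigraph $G=(V,\Gamma)$ is a finite loopless undirected multigraph, with $V=\{1,\dots,n\}$, whose edge multiplicities $\Gamma(v,w)$ are at most $2$. Its graph state $|G\rangle=\prod_{v<w}C_{vw}^{\Gamma(v,w)}|+\rangle^{\otimes n}$ is represented by the diagram with one green node with an output for every vertex and, for every single (double) edge, an $H$ (an $H^\dagger$) joining the green nodes of its two ends; that is, $|+\rangle$ is $Z^0_1$, and $C$ and $C^2$ are $(Z^1_2\otimes\mathrm{id});(\mathrm{id}\otimes h\otimes\mathrm{id});(\mathrm{id}\otimes Z^2_1)$ with $h=H$ and $h=H^\dagger$. For $u\in V$ and $\lambda\in\{1,2\}$, $G*^\lambda u=(V,\Gamma')$ has $\Gamma'(v,w)=\Gamma(v,w)+\lambda\,\Gamma(v,u)\,\Gamma(u,w)\bmod 3$ for $v\ne w$. **Theorem.** For every set $E$ of additional equations between diagrams, the following are equivalent. 1. (Local complementation property.) For every 3-multigraph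 $G$, every vertex $u$ and every $\lambda\in\{1,2\}$ there is a local unitary $U$, consisting of a red phase gate on the wire of $u$ and a green phase gate on every other wire, with all angles in $\{0,\frac{2\pi}{3},\frac{4\pi}{3}\}$, such that $|G*^\lambda u\rangle=U|G\rangle$ is derivable from $E$. 2. (Euler decomposition.) $H=Z^1_1\!\left(\tfrac{4\pi}{3}/\tfrac{4\pi}{3}\right);X^1_1\!\left(\tfrac{4\pi}{3}/\tfrac{4\pi}{3}\right);Z^1_1\!\left(\tfrac{4\pi}{3}/\tfrac{4\pi}{3}\right)$ is derivable from $E$. -/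

import Mathlib

namespace QutritZX

/-- The two colours of spiders: green (Z) and red (X). -/
inductive Colour
  | green
  | red

/-- Diagrams of the qutrit ZX-calculus with `m` inputs (top) and `n` outputs (bottom),
as terms of a PROP. `spider c m n α β` is the `c`-coloured node with `m` inputs, `n` outputs and
phase `α/β` (angles modulo `2π`); `had` and `hadInv` are the boxes `H` and `H†`; `wire σ` consists
of bare wires only, the `i`-th input being joined to the `σ i`-th output (this covers identities,
swaps and the empty diagram). -/
inductive Diagram : ℕ → ℕ → Type
  | spider (c : Colour) (m n : ℕ) (α β : Real.Angle) : Diagram m n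
  | had : Diagram 1 1
  | hadInv : Diagram 1 1
  | wire {m n : ℕ} (σ : Fin m ≃ Fin n) : Diagram m n
  | comp {m n k : ℕ} (f : Diagram m n) (g : Diagram n k) : Diagram m k
  | tensor {m n m' n' : ℕ} (f : Diagram m n) (g : Diagram m' n') : Diagram (m + m') (n + n')

/-- `f ⨾ g`: first `f` (on top), then `g` (below). -/
infixl:65 " ⨾ " => Diagram.comp

/-- `f ⊠ g`: `f` to the left of `g`. -/
infixl:70 " ⊠ " => Diagram.tensor

namespace Diagram

/-- The identity on `n` wires; `idn 0` is the empty diagram. -/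
def idn (n : ℕ) : Diagram n n := wire (Equiv.refl (Fin n))

/-- The green node. -/
def Z (m n : ℕ) (α β : Real.Angle) : Diagram m n := spider Colour.green m n α β

/-- The red node. -/
def X (m n : ℕ) (α β : Real.Angle) : Diagram m n := spider Colour.red m n α β

/-- Crossing of a block of `m` wires with a block of `n` wires. -/
def swap (m n : ℕ) : Diagram (m + n) (n + m) := wire finAddFlip

/-- `f 0 ⊠ f 1 ⊠ ⋯ ⊠ f (n - 1)` for one-wire diagrams `f i`. -/
def tensorAll : (n : ℕ) → (Fin n → Diagram 1 1) → Diagram n n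
  | 0, _ => idn 0
  | n + 1, f => tensorAll n (fun i => f i.castSucc) ⊠ f (Fin.last n)

/-- The dualizer: a red cup followed by a green cap. -/
noncomputable def dualizer : Diagram 1 1 := (idn 1 ⊠ X 0 2 0 0) ⨾ (Z 2 0 0 0 ⊠ idn 1)

end Diagram

open Diagram

section Interpretation

/-- `ω = e^{2πi/3}`. -/
noncomputable def omega : ℂ := Complex.exp (2 * Real.pi * Complex.I / 3)

/-- The phases `1, e^{iα}, e^{iβ}`. -/
noncomputable def phase (α β : Real.Angle) (j : ZMod 3) : ℂ :=
  if j = 0 then 1 else if j = 1 then (α.toCircle : ℂ) else (β.toCircle : ℂ)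

/-- The standard interpretation: a diagram with `m` inputs and `n` outputs is a linear map from
`m` qutrits to `n` qutrits, given by its matrix (rows: outputs, columns: inputs) in the
computational basis. Green nodes are `∑ⱼ phaseⱼ |j…j⟩⟨j…j|`, red nodes are
`∑ⱼ phaseⱼ |ωʲ…ωʲ⟩⟨ωʲ…ωʲ|` with `|ωʲ⟩ = ∑ₓ ω^{jx}|x⟩`. -/
noncomputable def interp : {m n : ℕ} → Diagram m n →
    Matrix (Fin n → ZMod 3) (Fin m → ZMod 3) ℂ
  | _, _, .spider Colour.green _ _ α β => fun y x =>
      ∑ j : ZMod 3, phase α β j * (if (∀ i, y i = j) ∧ (∀ i, x i = j) then 1 else 0)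
  | _, _, .spider Colour.red _ _ α β => fun y x =>
      ∑ j : ZMod 3, phase α β j *
        ((∏ i, omega ^ (j * y i).val) * ∏ i, omega ^ (-(j * x i)).val)
  | _, _, .had => fun y x => omega ^ (y 0 * x 0).val
  | _, _, .hadInv => fun y x => omega ^ (-(y 0 * x 0)).val
  | _, _, .wire σ => fun y x => if ∀ i, y (σ i) = x i then 1 else 0
  | _, _, .comp f g => interp g * interp f
  | _, _, @Diagram.tensor m n m' n' f g => fun y x =>
      interp f (fun i => y (Fin.castAdd n' i)) (fun i => x (Fin.castAdd m' i)) *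
        interp g (fun i => y (Fin.natAdd n i)) (fun i => x (Fin.natAdd m i))

end Interpretation

/-- The angle `2πk/3`, for `k` modulo `3`. -/
noncomputable def third (k : ZMod 3) : Real.Angle :=
  ((2 * Real.pi / 3 * (k.val : ℝ) : ℝ) : Real.Angle)

/-- A family of additional equations between diagrams. -/
abbrev Equations := ∀ m n : ℕ, Diagram m n → Diagram m n → Prop

/-- `Derivable E f g`: the equation `f = g` can be derived in the qutrit ZX-calculus from the
additional equations `E`. The constructors are: equational reasoning inside diagrams; the laws of
a strict symmetric monoidal category (`wire` of a canonical bijection `finCongr` identifies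
`Fin m` with `Fin n` for equal `m` and `n`); the convention that non-zero scalars are ignored;
the rules of the calculus; the equations in `E`. -/
inductive Derivable (E : Equations) : {m n : ℕ} → Diagram m n → Diagram m n → Prop
  -- equational reasoning
  | refl {m n : ℕ} (f : Diagram m n) : Derivable E f f
  | symm {m n : ℕ} {f g : Diagram m n} : Derivable E f g → Derivable E g f
  | trans {m n : ℕ} {f g h : Diagram m n} :
      Derivable E f g → Derivable E g h → Derivable E f h
  | comp_congr {m n k : ℕ} {f f' : Diagram m n} {g g' : Diagram n k} :
      Derivable E f f' → Derivable E g g' → Derivable E (f ⨾ g) (f' ⨾ g')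
  | tensor_congr {m n m' n' : ℕ} {f f' : Diagram m n} {g g' : Diagram m' n'} :
      Derivable E f f' → Derivable E g g' → Derivable E (f ⊠ g) (f' ⊠ g')
  -- symmetric monoidal structure
  | comp_assoc {m n k l : ℕ} (f : Diagram m n) (g : Diagram n k) (h : Diagram k l) :
      Derivable E ((f ⨾ g) ⨾ h) (f ⨾ (g ⨾ h))
  | id_comp {m n : ℕ} (f : Diagram m n) : Derivable E (idn m ⨾ f) f
  | comp_id {m n : ℕ} (f : Diagram m n) : Derivable E (f ⨾ idn n) f
  | interchange {m n k m' n' k' : ℕ} (f : Diagram m n) (g : Diagram n k)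
      (f' : Diagram m' n') (g' : Diagram n' k') :
      Derivable E ((f ⨾ g) ⊠ (f' ⨾ g')) ((f ⊠ f') ⨾ (g ⊠ g'))
  | wire_comp {m n k : ℕ} (σ : Fin m ≃ Fin n) (τ : Fin n ≃ Fin k) :
      Derivable E (wire σ ⨾ wire τ) (wire (σ.trans τ))
  | wire_tensor {m n m' n' : ℕ} (σ : Fin m ≃ Fin n) (τ : Fin m' ≃ Fin n') :
      Derivable E (wire σ ⊠ wire τ)
        (wire (finSumFinEquiv.symm.trans ((Equiv.sumCongr σ τ).trans finSumFinEquiv)))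
  | tensor_assoc {m n m' n' m'' n'' : ℕ} (f : Diagram m n) (g : Diagram m' n')
      (h : Diagram m'' n'') :
      Derivable E (((f ⊠ g) ⊠ h) ⨾ wire (finCongr (Nat.add_assoc n n' n'')))
        (wire (finCongr (Nat.add_assoc m m' m'')) ⨾ (f ⊠ (g ⊠ h)))
  | tensor_empty {m n : ℕ} (f : Diagram m n) : Derivable E (f ⊠ idn 0) f
  | empty_tensor {m n : ℕ} (f : Diagram m n) :
      Derivable E ((idn 0 ⊠ f) ⨾ wire (finCongr (Nat.zero_add n)))
        (wire (finCongr (Nat.zero_add m)) ⨾ f)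
  | swap_natural {m n m' n' : ℕ} (f : Diagram m n) (g : Diagram m' n') :
      Derivable E ((f ⊠ g) ⨾ swap n n') (swap m m' ⨾ (g ⊠ f))
  -- non-zero scalars are ignored
  | scalar (s : Diagram 0 0) : interp s ≠ 0 → Derivable E s (idn 0)
  -- (S1): green nodes joined by at least one wire fuse
  | S1 (m n a j b : ℕ) (hj : 0 < j) (α β η θ : Real.Angle) :
      Derivable E
        ((Z m (a + j) α β ⊠ idn b) ⨾ wire (finCongr (Nat.add_assoc a j b)) ⨾
          (idn a ⊠ Z (j + b) n η θ))
        (Z (m + b) (a + n) (α + η) (β + θ))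
  | S1' (m n a j b : ℕ) (hj : 0 < j) (α β η θ : Real.Angle) :
      Derivable E
        ((idn b ⊠ Z m (j + a) α β) ⨾ wire (finCongr (Nat.add_assoc b j a).symm) ⨾
          (Z (b + j) n η θ ⊠ idn a))
        (Z (b + m) (n + a) (α + η) (β + θ))
  -- (S2): a green node with one input, one output and phase 0 is a wire
  | S2 : Derivable E (Z 1 1 0 0) (idn 1)
  -- (S3): the green cup is symmetric
  | S3 : Derivable E (Z 0 2 0 0 ⨾ swap 1 1) (Z 0 2 0 0)
  -- (B1): green copies the red point
  | B1 : Derivable E (X 0 1 0 0 ⨾ Z 1 2 0 0) (X 0 1 0 0 ⊠ X 0 1 0 0)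
  -- (B2): bialgebra rule
  | B2 : Derivable E (X 2 1 0 0 ⨾ Z 1 2 0 0)
      ((Z 1 2 0 0 ⊠ Z 1 2 0 0) ⨾ (idn 1 ⊠ (swap 1 1 ⊠ idn 1) :) ⨾
        (X 2 1 0 0 ⊠ X 2 1 0 0 :))
  -- (K1): green copies the red `1/2` and `2/1` gates
  | K1 : Derivable E (X 1 1 (third 1) (third 2) ⨾ Z 1 2 0 0)
      (Z 1 2 0 0 ⨾ (X 1 1 (third 1) (third 2) ⊠ X 1 1 (third 1) (third 2)))
  | K1' : Derivable E (X 1 1 (third 2) (third 1) ⨾ Z 1 2 0 0)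
      (Z 1 2 0 0 ⨾ (X 1 1 (third 2) (third 1) ⊠ X 1 1 (third 2) (third 1)))
  -- (K2): a green phase gate passes through the red `1/2` and `2/1` gates
  | K2 (α β : Real.Angle) : Derivable E (Z 1 1 α β ⨾ X 1 1 (third 1) (third 2))
      (X 1 1 (third 1) (third 2) ⨾ Z 1 1 (β - α) (-α))
  | K2' (α β : Real.Angle) : Derivable E (Z 1 1 α β ⨾ X 1 1 (third 2) (third 1))
      (X 1 1 (third 2) (third 1) ⨾ Z 1 1 (-β) (α - β))
  -- (H1): `H` and `H†` are mutually inverse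
  | H1 : Derivable E (had ⨾ hadInv) (idn 1)
  | H1' : Derivable E (hadInv ⨾ had) (idn 1)
  -- (H2), (H2'): colour change
  | H2 (m n : ℕ) (α β : Real.Angle) : Derivable E (X m n α β)
      (tensorAll m (fun _ => hadInv) ⨾ Z m n α β ⨾ tensorAll n (fun _ => had))
  | H2' (m n : ℕ) (α β : Real.Angle) : Derivable E (X m n α β)
      (tensorAll m (fun _ => had) ⨾ Z m n β α ⨾ tensorAll n (fun _ => hadInv))
  -- (P1): the dualizer is the square of `H` and of `H†`
  | P1 : Derivable E dualizer (had ⨾ had)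
  | P1' : Derivable E dualizer (hadInv ⨾ hadInv)
  -- the additional equations
  | extra {m n : ℕ} {f g : Diagram m n} : E m n f g → Derivable E f g

/-- A 3-multigraph on `n` vertices: a loopless undirected multigraph with edge multiplicities
`0`, `1` or `2`, given by its adjacency matrix (multiplicities are read modulo `3`). -/
@[ext]
structure Multigraph (n : ℕ) where
  adj : Matrix (Fin n) (Fin n) (ZMod 3)
  symm : ∀ v w, adj v w = adj w v
  loopless : ∀ v, adj v v = 0

/-- The `l`-local complementation at the vertex `u`. -/
def Multigraph.localComp {n : ℕ} (G : Multigraph n) (l : ZMod 3) (u : Fin n) : Multigraph n where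
  adj v w := if v = w then 0 else G.adj v w + l * (G.adj v u * G.adj u w)
  symm v w := by
    by_cases h : v = w
    · simp [h]
    · rw [if_neg h, if_neg (Ne.symm h), G.symm v w, G.symm v u, G.symm u w,
        mul_comm (G.adj u v)]
  loopless v := by simp

/-- The two-wire diagram in which a green node on the left wire and a green node on the right wire
are joined through the one-wire diagram `h`. -/
noncomputable def link (h : Diagram 1 1) : Diagram 2 2 :=
  (Z 1 2 0 0 ⊠ idn 1) ⨾ (idn 1 ⊠ (h ⊠ idn 1) :) ⨾ (idn 1 ⊠ Z 2 1 0 0 :)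

/-- The diagram of `C ^ k`, where `C` is the controlled-`Z` gate: no edge for `k = 0`, an `H`-edge
for `k = 1`, an `H†`-edge for `k = 2`. -/
noncomputable def edge (k : ZMod 3) : Diagram 2 2 :=
  if k = 0 then idn 2 else if k = 1 then link had else link hadInv

/-- The permutation of `k + 2` wires which moves wire `i` to the last position but one and
wire `j ≠ i` to the last position. -/
def toEnd {k : ℕ} (i j : Fin (k + 2)) : Fin (k + 2) ≃ Fin (k + 2) :=
  (Equiv.swap i (Fin.natAdd k 0)).trans
    (Equiv.swap (Equiv.swap i (Fin.natAdd k 0) j) (Fin.natAdd k 1))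

/-- The two-wire diagram `g` applied to the wires `i` and `j` (in this order) among `n` wires;
used for `i ≠ j` only, so that `n ≥ 2`. -/
def onWires : (n : ℕ) → Diagram 2 2 → Fin n → Fin n → Diagram n n
  | 0, _, _, _ => idn 0
  | 1, _, _, _ => idn 1
  | k + 2, g, i, j => wire (toEnd i j) ⨾ (idn k ⊠ g) ⨾ wire (toEnd i j).symm

/-- `n` green nodes with one output each: the diagram of `|+⟩ ⊗ ⋯ ⊗ |+⟩`. -/
noncomputable def plusState : (n : ℕ) → Diagram 0 n
  | 0 => idn 0
  | n + 1 => plusState n ⊠ Z 0 1 0 0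

/-- All pairs `i < j` in `Fin n`, in lexicographic order. -/
def pairs (n : ℕ) : List (Fin n × Fin n) :=
  ((List.finRange n).product (List.finRange n)).filter (fun p => p.1 < p.2)

/-- The diagram of the graph state `|G⟩ = ∏ C_{ij}^{Γ i j} |+⟩^{⊗ n}`: for each vertex a green node
with one output, for each single edge an `H` and for each double edge an `H†` joining the green
nodes of its two ends. -/
noncomputable def graphState {n : ℕ} (G : Multigraph n) : Diagram 0 n :=
  (pairs n).foldl (fun d p => d ⨾ onWires n (edge (G.adj p.1 p.2)) p.1 p.2) (plusState n)

/-- The local unitary which has a red phase gate on the wire of `u` and green phase gates on the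
other wires, with phase `(2π/3)·a v / (2π/3)·b v` on the wire of `v`. -/
noncomputable def localRotation {n : ℕ} (u : Fin n) (a b : Fin n → ZMod 3) : Diagram n n :=
  tensorAll n fun v =>
    if v = u then X 1 1 (third (a v)) (third (b v)) else Z 1 1 (third (a v)) (third (b v))

/-- The local complementation property: for every 3-multigraph `G`, every vertex `u` and every
`l ∈ {1, 2}`, some local rotation `U` satisfies `|G *ˡ u⟩ = U |G⟩`, derivably. -/
def LocalComplementationProperty (E : Equations) : Prop :=
  ∀ (n : ℕ) (G : Multigraph n) (u : Fin n) (l : ZMod 3), l ≠ 0 →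
    ∃ a b : Fin n → ZMod 3,
      Derivable E (graphState (G.localComp l u)) (graphState G ⨾ localRotation u a b)

/-- The Euler decomposition of `H` into green, red and green `4π/3` rotations, derivably. -/
def EulerDecomposition (E : Equations) : Prop :=
  Derivable E had
    (Z 1 1 (third 2) (third 2) ⨾ X 1 1 (third 2) (third 2) ⨾ Z 1 1 (third 2) (third 2))

end QutritZX

namespace QutritZX
open Diagram

variable {E : Equations}

/-! ### The category of diagrams modulo derivable equality -/

/-! Under the standard interpretation the green phase 1/1 is the quadratic function x ↦ ω^{x²} on
ℤ/3, the phase 1/2 is the character x ↦ ω^x, an `H`-link is ω^{xy}, and the red multiplication is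
addition. Both properties express the polarisation xy = x² + y² − (x+y)² modulo 3: the Euler
decomposition says it for one wire, local complementation says it around a vertex. Everything has to
be derived diagrammatically, because the interpretation enters the rules only through the scalars
that may be dropped and `E` is arbitrary.

Before either direction, the rules alone must yield a commutative Hopf structure. The antipode is H²
(`hopf_right`, `hopf_left`). Since the two colour-change rules make H² multiplicative, and an
antipode is anti-multiplicative, uniqueness of convolution inverses gives commutativity
(`red_comm`), hence symmetric links that commute with each other.

From Euler to local complementation: `euler_adder` is polarisation as an equation of diagrams. It
says that conjugating a phase by the adder gives two phases and an inverse controlled-Z gate. Cubing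
it gives `cz_pow_three`; conjugating it by H gives `cz_xx`: a red 1/1 phase at u that passes an edge
uv leaves a green phase on v and an adder from v to u. Pulled up through the other edges uw, the
adder produces edges vw and is then absorbed by the plus state (`Gates.star_mul_X`). A red phase at
u thus adds −Γ(u,v)Γ(u,w) to every other edge vw, up to green phases on the neighbours; its (−λ)-th
power, with those phases undone, is `Gates.edges_localComp`.

From local complementation to Euler: the path on three vertices becomes a triangle. Closing the
centre with a red counit and bending one wire turns the equation into H(y,x) = φ₀(x)φ₂(x+y)φ₁(y)
with unknown phases (`had_eq_of_state`). Evaluating on two columns and one row gives three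
relations, valid only up to phases that are derivably trivial. By `triv_third` either all multiples
of 2π/3 are trivial, and then H is derivably the identity (`had_eq_id`), or none but 0/0 is. In the
second case the relations hold in ℤ/3 and leave three solutions, which differ by characters;
characters distribute over addition and can be removed (`had_normal_01`, `had_normal_10`). The
remaining normal form gives the Euler decomposition (`had_eq_euler`).

Equational derivations are encoded as lists of rewriting steps on words of layers, executed by `run`
and proved sound in `run_valid`. -/

/-- Derivable equality as a setoid. -/
def derivSetoid (E : Equations) (m n : ℕ) : Setoid (Diagram m n) :=
  ⟨Derivable E, Derivable.refl, Derivable.symm, Derivable.trans⟩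

/-- Diagrams up to equations derivable from `E`. -/
def Q (E : Equations) (m n : ℕ) : Type := Quotient (derivSetoid E m n)

/-- The class of a diagram. -/
def mk (E : Equations) {m n : ℕ} (f : Diagram m n) : Q E m n := Quotient.mk (derivSetoid E m n) f

theorem mk_eq {m n : ℕ} {f g : Diagram m n} : mk E f = mk E g ↔ Derivable E f g :=
  ⟨fun h => Quotient.exact (s := derivSetoid E m n) h,
    fun h => Quotient.sound (s := derivSetoid E m n) h⟩

theorem Q.ind {m n : ℕ} {p : Q E m n → Prop} (h : ∀ f, p (mk E f)) (q : Q E m n) : p q :=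
  Quotient.ind h q

/-- Sequential composition, in diagram order. -/
def Q.comp {m n k : ℕ} (f : Q E m n) (g : Q E n k) : Q E m k :=
  Quotient.map₂ (sa := derivSetoid E m n) (sb := derivSetoid E n k) (sc := derivSetoid E m k)
    Diagram.comp (fun _ _ h _ _ h' => Derivable.comp_congr h h') f g

/-- Parallel composition. -/
def Q.tensor {m n m' n' : ℕ} (f : Q E m n) (g : Q E m' n') : Q E (m + m') (n + n') :=
  Quotient.map₂ (sa := derivSetoid E m n) (sb := derivSetoid E m' n')
    (sc := derivSetoid E (m + m') (n + n'))
    Diagram.tensor (fun _ _ h _ _ h' => Derivable.tensor_congr h h') f g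

infixr:62 " ≫ " => Q.comp
infixr:72 " ⊗ " => Q.tensor

theorem mk_comp {m n k : ℕ} (f : Diagram m n) (g : Diagram n k) :
    mk E (f ⨾ g) = mk E f ≫ mk E g := rfl

namespace Q

/-- The class of a bijection of wires. -/
def wire {m n : ℕ} (σ : Fin m ≃ Fin n) : Q E m n := mk E (Diagram.wire σ)

/-- The identity on `n` wires. -/
def one (n : ℕ) : Q E n n := mk E (idn n)

theorem wire_refl (n : ℕ) : (wire (Equiv.refl (Fin n)) : Q E n n) = one n := rfl

theorem assoc {m n k l : ℕ} (f : Q E m n) (g : Q E n k) (h : Q E k l) :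
    (f ≫ g) ≫ h = f ≫ g ≫ h := by
  induction f using Q.ind; induction g using Q.ind; induction h using Q.ind
  exact mk_eq.2 (.comp_assoc _ _ _)

theorem one_comp {m n : ℕ} (f : Q E m n) : one m ≫ f = f := by
  induction f using Q.ind; exact mk_eq.2 (.id_comp _)

theorem comp_one {m n : ℕ} (f : Q E m n) : f ≫ one n = f := by
  induction f using Q.ind; exact mk_eq.2 (.comp_id _)

theorem interchange {m n k m' n' k' : ℕ} (f : Q E m n) (g : Q E n k) (f' : Q E m' n')
    (g' : Q E n' k') : (f ⊗ f') ≫ (g ⊗ g') = (f ≫ g) ⊗ (f' ≫ g') := by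
  induction f using Q.ind; induction g using Q.ind
  induction f' using Q.ind; induction g' using Q.ind
  exact mk_eq.2 (.symm (.interchange _ _ _ _))

theorem wire_comp {m n k : ℕ} (σ : Fin m ≃ Fin n) (τ : Fin n ≃ Fin k) :
    (wire σ ≫ wire τ : Q E m k) = wire (σ.trans τ) := mk_eq.2 (.wire_comp _ _)

theorem wire_tensor {m n m' n' : ℕ} (σ : Fin m ≃ Fin n) (τ : Fin m' ≃ Fin n') :
    (wire σ ⊗ wire τ : Q E (m + m') (n + n')) =
      wire (finSumFinEquiv.symm.trans ((Equiv.sumCongr σ τ).trans finSumFinEquiv)) :=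
  mk_eq.2 (.wire_tensor _ _)

theorem one_tensor_one (m n : ℕ) : (one m ⊗ one n : Q E _ _) = one (m + n) := by
  rw [← wire_refl, ← wire_refl, wire_tensor, ← wire_refl]
  congr 1
  ext i
  simp

theorem swap_natural {m n m' n' : ℕ} (f : Q E m n) (g : Q E m' n') :
    (f ⊗ g) ≫ wire finAddFlip = wire finAddFlip ≫ (g ⊗ f) := by
  induction f using Q.ind; induction g using Q.ind
  exact mk_eq.2 (.swap_natural _ _)

theorem tensor_one_zero {m n : ℕ} (f : Q E m n) : f ⊗ one 0 = f := by
  induction f using Q.ind; exact mk_eq.2 (.tensor_empty _)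

/-- Once the arities are identified, `finCongr` is the identity wire. This turns the strictness
axioms into heterogeneous equalities, which compose without carrying coercion wires along. -/
theorem heq_of_wire {m n m' n' : ℕ} {f : Q E m n} {g : Q E m' n'} (hm : m = m') (hn : n = n')
    (h : f ≫ wire (finCongr hn) = wire (finCongr hm) ≫ g) : HEq f g := by
  subst hm hn
  have h' : f ≫ one n = one m ≫ g := h
  rw [comp_one, one_comp] at h'
  exact heq_of_eq h'

theorem tensor_assoc {m n m' n' m'' n'' : ℕ} (f : Q E m n) (g : Q E m' n') (h : Q E m'' n'') :
    HEq ((f ⊗ g) ⊗ h) (f ⊗ g ⊗ h) := by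
  refine heq_of_wire (Nat.add_assoc _ _ _) (Nat.add_assoc _ _ _) ?_
  induction f using Q.ind; induction g using Q.ind; induction h using Q.ind
  exact mk_eq.2 (.tensor_assoc _ _ _)

theorem one_zero_tensor {m n : ℕ} (f : Q E m n) : HEq (one 0 ⊗ f) f := by
  refine heq_of_wire (Nat.zero_add _) (Nat.zero_add _) ?_
  induction f using Q.ind
  exact mk_eq.2 (.empty_tensor _)

theorem tensor_heq {m n k l m' n' k' l' : ℕ} {f : Q E m n} {g : Q E k l} {f' : Q E m' n'}
    {g' : Q E k' l'} (hm : m = m') (hn : n = n') (hk : k = k') (hl : l = l') (hf : HEq f f')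
    (hg : HEq g g') : HEq (f ⊗ g) (f' ⊗ g') := by
  subst hm hn hk hl; rw [eq_of_heq hf, eq_of_heq hg]

theorem exists_heq {m n m' n' : ℕ} (f : Q E m n) (hm : m = m') (hn : n = n') :
    ∃ f' : Q E m' n', HEq f' f := by
  subst hm hn; exact ⟨f, HEq.rfl⟩

end Q

open Q

/-! ### Layers -/

/-- `g` with `a` idle wires on the left and `b` idle wires on the right. -/
def lay (a : ℕ) {m n : ℕ} (g : Q E m n) (b : ℕ) : Q E (a + (m + b)) (a + (n + b)) :=
  one a ⊗ g ⊗ one b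

theorem lay_one (a m b : ℕ) : (lay a (one m) b : Q E _ _) = one (a + (m + b)) := by
  simp [lay, one_tensor_one]

theorem lay_comp (a b : ℕ) {m n k : ℕ} (f : Q E m n) (g : Q E n k) :
    lay a (f ≫ g) b = lay a f b ≫ lay a g b := by
  simp [lay, interchange, comp_one]

theorem lay_lay (a a' b' b : ℕ) {m n : ℕ} (g : Q E m n) :
    HEq (lay a (lay a' g b') b) (lay (a + a') g (b' + b)) := by
  unfold lay
  rw [← one_tensor_one a a', ← one_tensor_one b' b]
  refine HEq.trans ?_ (tensor_assoc _ _ _).symm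
  refine tensor_heq rfl rfl (by omega) (by omega) HEq.rfl ?_
  refine (tensor_assoc _ _ _).trans ?_
  refine tensor_heq rfl rfl (by omega) (by omega) HEq.rfl ?_
  exact tensor_assoc _ _ _

theorem lay_heq {a a' b b' m n m' n' : ℕ} {g : Q E m n} {g' : Q E m' n'} (ha : a = a')
    (hb : b = b') (hm : m = m') (hn : n = n') (h : HEq g g') : HEq (lay a g b) (lay a' g' b') := by
  subst ha hb hm hn; rw [eq_of_heq h]

theorem lay_shift_heq (a k c b : ℕ) {m' n' : ℕ} (g : Q E m' n') :
    HEq (lay (a + k + c) g b) (one a ⊗ one k ⊗ lay c g b) := by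
  unfold lay
  rw [← one_tensor_one, ← one_tensor_one]
  refine (tensor_assoc _ _ _).trans ?_
  refine (tensor_assoc _ _ _).trans ?_
  rfl

/-- The interchange law for two boxes separated by `c` idle wires. The widths `w₀`, …, `w₃` are free
variables with equations, so that callers may use any arithmetic form of them. -/
theorem lay_comm_heq (a c b : ℕ) {m n m' n' w₀ w₁ w₂ w₃ : ℕ} (f : Q E m n) (g : Q E m' n')
    (h₀ : w₀ = a + (m + (c + (m' + b)))) (h₁ : w₁ = a + (n + (c + (m' + b))))
    (h₂ : w₂ = a + (n + (c + (n' + b)))) (h₃ : w₃ = a + (m + (c + (n' + b))))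
    {p : Q E w₀ w₁} {q : Q E w₁ w₂} {p' : Q E w₀ w₃} {q' : Q E w₃ w₂}
    (hp : HEq p (lay a f (c + (m' + b)))) (hq : HEq q (lay (a + n + c) g b))
    (hp' : HEq p' (lay (a + m + c) g b)) (hq' : HEq q' (lay a f (c + (n' + b)))) :
    p ≫ q = p' ≫ q' := by
  subst h₀ h₁ h₂ h₃
  have e1 := eq_of_heq (hq.trans (lay_shift_heq a n c b g))
  have e2 := eq_of_heq (hp'.trans (lay_shift_heq a m c b g))
  rw [eq_of_heq hp, e1, e2, eq_of_heq hq']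
  simp only [lay, interchange, one_comp, comp_one]

/-! ### Words of layers -/

/-- The kinds of boxes which occur in words. The phases of spiders are multiples of `2π/3`. -/
inductive Kind
  | green (a b : ℕ)
  | red (a b : ℕ)
  | had
  | inv
  | swap
  | aux (i : ℕ)
  deriving DecidableEq

/-- A box with `m` inputs and `n` outputs, with `a` idle wires on its left. -/
structure Layer where
  kind : Kind
  m : ℕ
  n : ℕ
  a : ℕ
  deriving DecidableEq

/-- A word is a sequence of layers, from top to bottom. -/
abbrev Word := List Layer

/-- Put a word `a` wires further to the right. -/
def shift (a : ℕ) (W : Word) : Word := W.map fun l => { l with a := a + l.a }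

/-- The number of wires after a word, if the word fits on `w` wires. -/
def out : ℕ → Word → Option ℕ
  | w, [] => some w
  | w, l :: W => if l.a + l.m ≤ w then out (l.a + (l.n + (w - (l.a + l.m)))) W else none

/-- An interpretation of boxes. -/
abbrev Env (E : Equations) := Kind → ∀ m n : ℕ, Q E m n

/-- `Den ρ W q`: the word `W` denotes `q`. -/
inductive Den (ρ : Env E) : {w w' : ℕ} → Word → Q E w w' → Prop
  | nil (w : ℕ) : Den ρ [] (one w)
  | cons {w w₁ w' : ℕ} (l : Layer) (b : ℕ) (W : Word) (p : Q E w w₁) (q : Q E w₁ w')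
      (h : w = l.a + (l.m + b)) (h₁ : w₁ = l.a + (l.n + b))
      (hp : HEq p (lay l.a (ρ l.kind l.m l.n) b)) (hq : Den ρ W q) : Den ρ (l :: W) (p ≫ q)

variable {ρ : Env E}

theorem Den.out_eq {w w' : ℕ} {W : Word} {q : Q E w w'} (h : Den ρ W q) : out w W = some w' := by
  induction h with
  | nil w => rfl
  | cons l b W p q h h₁ hp hq ih =>
    subst h h₁
    rw [out, if_pos (by omega), ← ih]
    congr 3
    omega

theorem Den.exists {w w' : ℕ} {W : Word} (h : out w W = some w') : ∃ q : Q E w w', Den ρ W q := by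
  induction W generalizing w with
  | nil => simp only [out, Option.some.injEq] at h; subst h; exact ⟨_, .nil w⟩
  | cons l W ih =>
    rw [out] at h
    split_ifs at h with hw
    obtain ⟨q, hq⟩ := ih h
    obtain ⟨p, hp⟩ := exists_heq (lay l.a (ρ l.kind l.m l.n) (w - (l.a + l.m)))
      (m' := w) (by omega) rfl
    exact ⟨_, .cons l _ W p q (by omega) rfl hp hq⟩

/-- The total width determines the number of idle wires to the right of each layer, so nothing in
the reading of a word is ambiguous. -/
theorem Den.unique {w w' : ℕ} {W : Word} {q q' : Q E w w'} (h : Den ρ W q) (h' : Den ρ W q') :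
    q = q' := by
  induction h with
  | nil w => cases h'; rfl
  | cons l b W p q h h₁ hp hq ih =>
    cases h' with
    | cons _ b' _ p' q' h' h₁' hp' hq' =>
      obtain rfl : b = b' := by omega
      subst h₁ h₁'
      rw [eq_of_heq (hp.trans hp'.symm), ih hq']

theorem Den.append {w w' w'' : ℕ} {W W' : Word} {q : Q E w w'} {q' : Q E w' w''}
    (h : Den ρ W q) (h' : Den ρ W' q') : Den ρ (W ++ W') (q ≫ q') := by
  induction h with
  | nil w => rwa [one_comp]
  | cons l b W p q h h₁ hp hq ih => rw [assoc]; exact .cons l b _ p _ h h₁ hp (ih h')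

theorem Den.of_append {w w'' : ℕ} {W W' : Word} {q : Q E w w''} (h : Den ρ (W ++ W') q) :
    ∃ (w' : ℕ) (r : Q E w w') (s : Q E w' w''), Den ρ W r ∧ Den ρ W' s ∧ q = r ≫ s := by
  induction W generalizing w with
  | nil => exact ⟨w, one w, q, .nil w, h, (one_comp q).symm⟩
  | cons l W ih =>
    cases h with
    | cons _ b _ p q hw h₁ hp hq =>
      obtain ⟨w', r, s, hr, hs, rfl⟩ := ih hq
      exact ⟨w', p ≫ r, s, .cons l b W p r hw h₁ hp hr, hs, (assoc _ _ _).symm⟩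

theorem Den.lay {w w' : ℕ} {W : Word} {q : Q E w w'} (h : Den ρ W q) (a b : ℕ) :
    Den ρ (shift a W) (lay a q b) := by
  induction h with
  | nil w => rw [lay_one]; exact .nil _
  | cons l b' W p q h h₁ hp hq ih =>
    subst h h₁
    rw [lay_comp]
    refine .cons { l with a := a + l.a } (b' + b) _ _ _ (by simp only; omega)
      (by simp only; omega) ?_ ih
    rw [eq_of_heq hp]
    exact lay_lay _ _ _ _ _

theorem Den.cast {w w' v v' : ℕ} {W : Word} {q : Q E w w'} {r : Q E v v'} (h : Den ρ W q)
    (hw : w = v) (hw' : w' = v') (hq : HEq q r) : Den ρ W r := by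
  subst hw hw'; rwa [← eq_of_heq hq]

/-- Two adjacent layers, the second to the right of the first, commute. -/
theorem Den.comm {w w' : ℕ} {l l' : Layer} {W : Word} {q : Q E w w'}
    (h : Den ρ (l :: l' :: W) q) (hl : l.a + l.n ≤ l'.a) :
    Den ρ ({ l' with a := l'.a - l.n + l.m } :: l :: W) q := by
  cases h with
  | cons _ b _ p q h h₁ hp hq =>
  cases hq with
  | cons _ b' _ p' q h' h₁' hp' hq =>
  obtain ⟨c, hc⟩ : ∃ c, l'.a = l.a + l.n + c := ⟨l'.a - (l.a + l.n), by omega⟩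
  obtain rfl : b = c + (l'.m + b') := by omega
  obtain ⟨r, hr⟩ := exists_heq (QutritZX.lay (l.a + l.m + c) (ρ l'.kind l'.m l'.n) b')
    (m' := _) (n' := l.a + (l.m + (c + (l'.n + b')))) (h.trans (by omega)).symm (by omega)
  obtain ⟨r', hr'⟩ := exists_heq (QutritZX.lay l.a (ρ l.kind l.m l.n) (c + (l'.n + b')))
    (m' := l.a + (l.m + (c + (l'.n + b')))) rfl (h₁'.trans (by omega)).symm
  have e : p ≫ p' = r ≫ r' := by
    refine lay_comm_heq l.a c b' _ _ h h₁ (by omega) rfl hp ?_ hr hr'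
    exact hp'.trans (lay_heq hc rfl rfl rfl HEq.rfl)
  rw [← assoc, e, assoc]
  refine .cons { l' with a := l'.a - l.n + l.m } b' _ r _ (by simp only; omega)
    (by simp only; omega) ?_ ?_
  · exact hr.trans (lay_heq (by simp only; omega) rfl rfl rfl HEq.rfl)
  · exact .cons l (c + (l'.n + b')) _ r' _ rfl (by omega) hr' hq

/-- The mirror image of `Den.comm`, with the second layer to the left of the first. -/
theorem Den.comm' {w w' : ℕ} {l l' : Layer} {W : Word} {q : Q E w w'}
    (h : Den ρ (l :: l' :: W) q) (hl : l'.a + l'.m ≤ l.a) :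
    Den ρ (l' :: { l with a := l.a - l'.m + l'.n } :: W) q := by
  cases h with
  | cons _ b _ p q h h₁ hp hq =>
  cases hq with
  | cons _ b' _ p' q h' h₁' hp' hq =>
  obtain ⟨c, hc⟩ : ∃ c, l.a = l'.a + l'.m + c := ⟨l.a - (l'.a + l'.m), by omega⟩
  obtain rfl : b' = c + (l.n + b) := by omega
  obtain ⟨r, hr⟩ := exists_heq (QutritZX.lay l'.a (ρ l'.kind l'.m l'.n) (c + (l.m + b)))
    (m' := _) (n' := l'.a + (l'.n + (c + (l.m + b)))) (h.trans (by omega)).symm (by omega)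
  obtain ⟨r', hr'⟩ := exists_heq (QutritZX.lay (l'.a + l'.n + c) (ρ l.kind l.m l.n) b)
    (m' := l'.a + (l'.n + (c + (l.m + b)))) (by omega) (h₁'.trans (by omega)).symm
  have e : r ≫ r' = p ≫ p' := by
    refine lay_comm_heq l'.a c b _ _ (h.trans (by omega)) rfl (by omega) (by omega) hr hr' ?_ hp'
    exact hp.trans (lay_heq hc rfl rfl rfl HEq.rfl)
  rw [← assoc, ← e, assoc]
  refine .cons l' (c + (l.m + b)) _ r _ (by omega) rfl hr ?_
  refine .cons { l with a := l.a - l'.m + l'.n } b _ r' _ (by simp only; omega)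
    (by simp only; omega) ?_ hq
  exact hr'.trans (lay_heq (by simp only; omega) rfl rfl rfl HEq.rfl)

/-- The words `W` and `W'`, from `w` to `w'` wires, denote the same. -/
def Valid (ρ : Env E) (w w' : ℕ) (W W' : Word) : Prop := ∃ q : Q E w w', Den ρ W q ∧ Den ρ W' q

theorem Valid.symm {w w' : ℕ} {W W' : Word} (h : Valid ρ w w' W W') : Valid ρ w w' W' W :=
  let ⟨q, h₁, h₂⟩ := h; ⟨q, h₂, h₁⟩

theorem Valid.trans {w w' : ℕ} {W W' W'' : Word} (h : Valid ρ w w' W W')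
    (h' : Valid ρ w w' W' W'') : Valid ρ w w' W W'' := by
  obtain ⟨q, h₁, h₂⟩ := h
  obtain ⟨q', h₃, h₄⟩ := h'
  exact ⟨q, h₁, h₂.unique h₃ ▸ h₄⟩

theorem Valid.eq {w w' : ℕ} {W W' : Word} (h : Valid ρ w w' W W') {q q' : Q E w w'}
    (hq : Den ρ W q) (hq' : Den ρ W' q') : q = q' := by
  obtain ⟨r, h₁, h₂⟩ := h
  rw [hq.unique h₁, hq'.unique h₂]

/-- A step of a derivation: exchanging the layers `k` and `k + 1` (`right`, `left`: the second one
is to the right or to the left of the first one), or an application of a valid equation at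
position `pos`, with `off` idle wires on the left. -/
inductive Step (ρ : Env E)
  | right (k : ℕ)
  | left (k : ℕ)
  | rule {w w' : ℕ} {l r : Word} (h : Valid ρ w w' l r) (pos off : ℕ)

/-- Exchange the first two layers of a word. -/
def commRight : Word → Option Word
  | l :: l' :: W =>
    if l.a + l.n ≤ l'.a then some ({ l' with a := l'.a - l.n + l.m } :: l :: W) else none
  | _ => none

/-- Exchange the first two layers of a word. -/
def commLeft : Word → Option Word
  | l :: l' :: W =>
    if l'.a + l'.m ≤ l.a then some (l' :: { l with a := l.a - l'.m + l'.n } :: W) else none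
  | _ => none

/-- Apply a step to a word on `v` wires. -/
def Step.apply (v : ℕ) : Step ρ → Word → Option Word
  | .right k, W => (commRight (W.drop k)).map (W.take k ++ ·)
  | .left k, W => (commLeft (W.drop k)).map (W.take k ++ ·)
  | @Step.rule _ _ w _ l r _ pos off, W =>
    match out v (W.take pos) with
    | none => none
    | some u =>
      if off + w ≤ u ∧ (W.drop pos).take l.length = shift off l then
        some (W.take pos ++ (shift off r ++ (W.drop pos).drop l.length))
      else none

/-- Apply a list of steps. -/
def run (v : ℕ) : List (Step ρ) → Word → Option Word
  | [], W => some W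
  | s :: S, W => (s.apply v W).bind (run v S)

theorem commRight_den {w w' : ℕ} {W W' : Word} {q : Q E w w'} (h : commRight W = some W')
    (hq : Den ρ W q) : Den ρ W' q := by
  match W with
  | [] => simp [commRight] at h
  | [_] => simp [commRight] at h
  | l :: l' :: W =>
    rw [commRight] at h
    split_ifs at h with hl
    cases h
    exact hq.comm hl

theorem commLeft_den {w w' : ℕ} {W W' : Word} {q : Q E w w'} (h : commLeft W = some W')
    (hq : Den ρ W q) : Den ρ W' q := by
  match W with
  | [] => simp [commLeft] at h
  | [_] => simp [commLeft] at h
  | l :: l' :: W =>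
    rw [commLeft] at h
    split_ifs at h with hl
    cases h
    exact hq.comm' hl

theorem Den.of_take_drop {w w' : ℕ} {W U : Word} {k : ℕ} {q : Q E w w'} (hq : Den ρ W q)
    (h : ∀ {v : ℕ} {r : Q E v w'}, out w (W.take k) = some v → Den ρ (W.drop k) r → Den ρ U r) :
    Den ρ (W.take k ++ U) q := by
  rw [← List.take_append_drop k W] at hq
  obtain ⟨v, r, s, hr, hs, rfl⟩ := hq.of_append
  exact hr.append (h hr.out_eq hs)

theorem Step.apply_den {w w' : ℕ} {W W' : Word} {q : Q E w w'} {s : Step ρ}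
    (h : s.apply w W = some W') (hq : Den ρ W q) : Den ρ W' q := by
  cases s with
  | right k =>
    rw [Step.apply, Option.map_eq_some_iff] at h
    obtain ⟨U, hU, rfl⟩ := h
    exact hq.of_take_drop fun _ => commRight_den hU
  | left k =>
    rw [Step.apply, Option.map_eq_some_iff] at h
    obtain ⟨U, hU, rfl⟩ := h
    exact hq.of_take_drop fun _ => commLeft_den hU
  | @rule u u' l r hv pos off =>
    rw [Step.apply] at h
    cases ho : out w (W.take pos) with
    | none => rw [ho] at h; cases h
    | some v =>
      simp only [ho] at h
      split_ifs at h with hc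
      obtain ⟨hle, ht⟩ := hc
      cases h
      refine hq.of_take_drop fun {v'} t hv' ht' => ?_
      obtain rfl : v = v' := by simpa [ho] using hv'
      obtain ⟨x, hl, hr⟩ := hv
      rw [← List.take_append_drop l.length (W.drop pos), ht] at ht'
      obtain ⟨z, y, y', hy, hy', rfl⟩ := ht'.of_append
      refine Den.append ?_ hy'
      obtain ⟨b, rfl⟩ : ∃ b, v = off + (u + b) := ⟨v - (off + u), by omega⟩
      have h1 := hl.lay off b
      have h2 := hr.lay off b
      obtain rfl : z = off + (u' + b) := by
        have := hy.out_eq.symm.trans h1.out_eq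
        simpa using this
      rwa [hy.unique h1]

theorem run_den {w w' : ℕ} {W W' : Word} {q : Q E w w'} {S : List (Step ρ)}
    (h : run w S W = some W') (hq : Den ρ W q) : Den ρ W' q := by
  induction S generalizing W with
  | nil => cases h; exact hq
  | cons s S ih =>
    rw [run, Option.bind_eq_some_iff] at h
    obtain ⟨U, hU, h⟩ := h
    exact ih h (s.apply_den hU hq)

/-- Soundness of the rewriting machine. Both hypotheses are closed computations, so a derivation
reduces to its list of steps and two proofs by `rfl`. -/
theorem run_valid {w w' : ℕ} {W W' : Word} (S : List (Step ρ)) (h : out w W = some w')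
    (h' : run w S W = some W') : Valid ρ w w' W W' :=
  let ⟨q, hq⟩ := Den.exists h; ⟨q, hq, run_den h' hq⟩

/-! ### Words of diagrams -/

theorem Den.box (k : Kind) (m n : ℕ) : Den ρ [⟨k, m, n, 0⟩] (ρ k m n) := by
  have h := Den.cons (ρ := ρ) ⟨k, m, n, 0⟩ 0 [] (QutritZX.lay 0 (ρ k m n) 0) (one _) rfl rfl
    HEq.rfl (.nil _)
  rw [comp_one] at h
  refine h.cast (by simp) (by simp) ?_
  unfold QutritZX.lay
  rw [tensor_one_zero]
  exact one_zero_tensor _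

/-- By interchange, a parallel composite may be read with the left factor on top; the right factor
then starts to the right of the `n` outputs of the left one. -/
theorem Den.tensor {m n m' n' : ℕ} {W W' : Word} {f : Q E m n} {g : Q E m' n'} (h : Den ρ W f)
    (h' : Den ρ W' g) : Den ρ (W ++ shift n W') (f ⊗ g) := by
  have e : f ⊗ g = (f ⊗ one m') ≫ (one n ⊗ g) := by rw [interchange, comp_one, one_comp]
  rw [e]
  refine Den.append ?_ ?_
  · have := h.lay 0 m'
    have hs : shift 0 W = W := by simp [shift]
    rw [hs] at this
    exact this.cast (by omega) (by omega) (one_zero_tensor _)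
  · have := h'.lay n 0
    unfold QutritZX.lay at this
    rwa [tensor_one_zero] at this

end QutritZX

namespace QutritZX
open Diagram Q

variable {E : Equations}

/-! ### The boxes of the calculus -/

theorem third_zero : third 0 = 0 := by simp [third]

/-- Reducing `k` modulo 3 changes the angle by a multiple of 2π. This lets words store phases as
natural numbers. -/
theorem third_natCast (k : ℕ) :
    third (k : ZMod 3) = ((2 * Real.pi / 3 * (k : ℝ) : ℝ) : Real.Angle) := by
  rw [third, ZMod.val_natCast, Real.Angle.angle_eq_iff_two_pi_dvd_sub]
  refine ⟨-((k / 3 : ℕ) : ℤ), ?_⟩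
  have h : ((k % 3 : ℕ) : ℝ) + 3 * ((k / 3 : ℕ) : ℝ) = (k : ℝ) := by
    exact_mod_cast Nat.mod_add_div k 3
  rw [← h, Int.cast_neg, Int.cast_natCast]
  ring

theorem third_add (a b : ZMod 3) : third (a + b) = third a + third b := by
  rw [← ZMod.natCast_zmod_val a, ← ZMod.natCast_zmod_val b, ← Nat.cast_add, third_natCast,
    third_natCast, third_natCast, ← Real.Angle.coe_add]
  congr 1
  push_cast
  ring

theorem third_neg (a : ZMod 3) : third (-a) = -third a := by
  rw [eq_neg_iff_add_eq_zero, ← third_add, neg_add_cancel, third_zero]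

/-- The interpretation of boxes, with free boxes `aux`. -/
noncomputable def env (aux : ℕ → ∀ m n : ℕ, Q E m n) : Env E
  | .green a b, m, n => mk E (Z m n (third a) (third b))
  | .red a b, m, n => mk E (X m n (third a) (third b))
  | .had, 1, 1 => mk E had
  | .inv, 1, 1 => mk E hadInv
  | .swap, 2, 2 => mk E (swap 1 1)
  | .aux i, m, n => aux i m n
  -- A junk value for `H`, `H†` and the swap with arities that they do not have.
  | _, m, n => mk E (Z m n 0 0)

namespace Layer

/-- A green node without phase. -/
abbrev G (m n a : ℕ) : Layer := ⟨.green 0 0, m, n, a⟩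
/-- A green node with phase `(2π/3)·p / (2π/3)·q`. -/
abbrev Gp (p q m n a : ℕ) : Layer := ⟨.green p q, m, n, a⟩
/-- A red node without phase. -/
abbrev R (m n a : ℕ) : Layer := ⟨.red 0 0, m, n, a⟩
/-- A red node with phase `(2π/3)·p / (2π/3)·q`. -/
abbrev Rp (p q m n a : ℕ) : Layer := ⟨.red p q, m, n, a⟩
/-- The box `H`. -/
abbrev H (a : ℕ) : Layer := ⟨.had, 1, 1, a⟩
/-- The box `H†`. -/
abbrev K (a : ℕ) : Layer := ⟨.inv, 1, 1, a⟩
/-- The swap. -/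
abbrev S (a : ℕ) : Layer := ⟨.swap, 2, 2, a⟩
/-- A free box. -/
abbrev A (i m n a : ℕ) : Layer := ⟨.aux i, m, n, a⟩

end Layer

open Layer

variable {aux : ℕ → ∀ m n : ℕ, Q E m n}

theorem den_green (p q m n : ℕ) : Den (env aux) [Gp p q m n 0] (mk E (Z m n (third p) (third q))) :=
  Den.box (ρ := env aux) (.green p q) m n

theorem den_G (m n : ℕ) : Den (env aux) [G m n 0] (mk E (Z m n 0 0)) := by
  simpa [third_zero] using den_green (aux := aux) 0 0 m n

theorem den_red (p q m n : ℕ) : Den (env aux) [Rp p q m n 0] (mk E (X m n (third p) (third q))) :=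
  Den.box (ρ := env aux) (.red p q) m n

theorem den_R (m n : ℕ) : Den (env aux) [R m n 0] (mk E (X m n 0 0)) := by
  simpa [third_zero] using den_red (aux := aux) 0 0 m n

theorem den_H : Den (env aux) [H 0] (mk E had) := Den.box (ρ := env aux) .had 1 1

theorem den_K : Den (env aux) [K 0] (mk E hadInv) := Den.box (ρ := env aux) .inv 1 1

theorem den_S : Den (env aux) [S 0] (mk E (swap 1 1)) := Den.box (ρ := env aux) .swap 2 2

theorem den_A (i m n : ℕ) : Den (env aux) [A i m n 0] (aux i m n) :=
  Den.box (ρ := env aux) (.aux i) m n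

theorem den_idn (n : ℕ) : Den (env aux) [] (mk E (idn n)) := Den.nil n

theorem Den.comp_finCongr {ρ : Env E} {w n n' : ℕ} {W : Word} {q : Q E w n} (h : Den ρ W q)
    (e : n = n') : Den ρ W (q ≫ wire (finCongr e)) := by
  subst e
  have : q ≫ wire (finCongr rfl) = q := comp_one q
  rwa [this]

theorem valid_of {w w' : ℕ} {W W' : Word} {f g : Diagram w w'} (h : Derivable E f g)
    (hf : Den (env aux) W (mk E f)) (hg : Den (env aux) W' (mk E g)) :
    Valid (env aux) w w' W W' := ⟨mk E f, hf, by rwa [mk_eq.2 h]⟩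

/-! ### The rules as equations between words -/

/-- Fusion of green nodes along the right outputs of the first one. -/
theorem fuse (m n a j b p q p' q' : ℕ) (p'' q'' : ℕ) (hj : 0 < j) (hp : (p + p') % 3 = p'' % 3)
    (hq : (q + q') % 3 = q'' % 3) :
    Valid (env aux) (m + b) (a + n) [Gp p q m (a + j) 0, Gp p' q' (j + b) n a]
      [Gp p'' q'' (m + b) (a + n) 0] := by
  have ep : (p'' : ZMod 3) = p + p' := by
    rw [← Nat.cast_add, ZMod.natCast_eq_natCast_iff']; exact hp.symm
  have eq : (q'' : ZMod 3) = q + q' := by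
    rw [← Nat.cast_add, ZMod.natCast_eq_natCast_iff']; exact hq.symm
  refine valid_of (.S1 m n a j b hj (third p) (third q) (third p') (third q')) ?_ ?_
  · have h1 := ((den_green (aux := aux) p q m (a + j)).tensor (den_idn b)).comp_finCongr
      (Nat.add_assoc a j b)
    exact h1.append ((den_idn a).tensor (den_green p' q' (j + b) n))
  · rw [← third_add, ← third_add, ← ep, ← eq]
    exact den_green _ _ _ _

/-- Fusion of green nodes along the left outputs of the first one. -/
theorem fuse' (m n a j b p q p' q' : ℕ) (p'' q'' : ℕ) (hj : 0 < j) (hp : (p + p') % 3 = p'' % 3)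
    (hq : (q + q') % 3 = q'' % 3) :
    Valid (env aux) (b + m) (n + a) [Gp p q m (j + a) b, Gp p' q' (b + j) n 0]
      [Gp p'' q'' (b + m) (n + a) 0] := by
  have ep : (p'' : ZMod 3) = p + p' := by
    rw [← Nat.cast_add, ZMod.natCast_eq_natCast_iff']; exact hp.symm
  have eq : (q'' : ZMod 3) = q + q' := by
    rw [← Nat.cast_add, ZMod.natCast_eq_natCast_iff']; exact hq.symm
  refine valid_of (.S1' m n a j b hj (third p) (third q) (third p') (third q')) ?_ ?_
  · have h1 := ((den_idn b).tensor (den_green (aux := aux) p q m (j + a))).comp_finCongr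
      (Nat.add_assoc b j a).symm
    exact h1.append ((den_green p' q' (b + j) n).tensor (den_idn a))
  · rw [← third_add, ← third_add, ← ep, ← eq]
    exact den_green _ _ _ _

theorem fuse₀ (m n a j b : ℕ) (hj : 0 < j := by decide) :
    Valid (env aux) (m + b) (a + n) [G m (a + j) 0, G (j + b) n a] [G (m + b) (a + n) 0] :=
  fuse m n a j b 0 0 0 0 0 0 hj rfl rfl

theorem fuse₀' (m n a j b : ℕ) (hj : 0 < j := by decide) :
    Valid (env aux) (b + m) (n + a) [G m (j + a) b, G (b + j) n 0] [G (b + m) (n + a) 0] :=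
  fuse' m n a j b 0 0 0 0 0 0 hj rfl rfl

theorem green_id : Valid (env aux) 1 1 [G 1 1 0] [] := valid_of .S2 (den_G 1 1) (den_idn 1)

theorem cup_swap : Valid (env aux) 0 2 [G 0 2 0, S 0] [G 0 2 0] :=
  valid_of .S3 ((den_G 0 2).append den_S) (den_G 0 2)

theorem red_copy : Valid (env aux) 0 2 [R 0 1 0, G 1 2 0] [R 0 1 0, R 0 1 1] :=
  valid_of .B1 ((den_R 0 1).append (den_G 1 2)) ((den_R 0 1).tensor (den_R 0 1))

theorem bialg : Valid (env aux) 2 2 [R 2 1 0, G 1 2 0]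
    [G 1 2 0, G 1 2 2, S 1, R 2 1 0, R 2 1 1] :=
  valid_of .B2 ((den_R 2 1).append (den_G 1 2))
    ((((den_G 1 2).tensor (den_G 1 2)).append ((den_idn 1).tensor (den_S.tensor (den_idn 1)))).append
      ((den_R 2 1).tensor (den_R 2 1)))

theorem HK : Valid (env aux) 1 1 [H 0, K 0] [] := valid_of .H1 (den_H.append den_K) (den_idn 1)

theorem KH : Valid (env aux) 1 1 [K 0, H 0] [] := valid_of .H1' (den_K.append den_H) (den_idn 1)

/-- One layer of boxes of kind `k` on each of `n` wires. -/
def row (k : Kind) : ℕ → Word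
  | 0 => []
  | n + 1 => row k n ++ [⟨k, 1, 1, n⟩]

theorem den_row (k : Kind) (f : Diagram 1 1) (h : Den (env aux) [⟨k, 1, 1, 0⟩] (mk E f)) :
    ∀ n, Den (env aux) (row k n) (mk E (tensorAll n fun _ => f))
  | 0 => den_idn 0
  | n + 1 => (den_row k f h n).tensor h

theorem red_eq (m n p q : ℕ) : Valid (env aux) m n [Rp p q m n 0]
    ((row .inv m ++ [Gp p q m n 0]) ++ row .had n) :=
  valid_of (.H2 m n (third p) (third q)) (den_red p q m n)
    (((den_row _ _ den_K m).append (den_green p q m n)).append (den_row _ _ den_H n))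

theorem red_eq' (m n p q : ℕ) : Valid (env aux) m n [Rp p q m n 0]
    ((row .had m ++ [Gp q p m n 0]) ++ row .inv n) :=
  valid_of (.H2' m n (third p) (third q)) (den_red p q m n)
    (((den_row _ _ den_H m).append (den_green q p m n)).append (den_row _ _ den_K n))

theorem den_dualizer : Den (env aux) [R 0 2 1, G 2 0 0] (mk E dualizer) :=
  ((den_idn 1).tensor (den_R 0 2)).append ((den_G 2 0).tensor (den_idn 1))

theorem dual_HH : Valid (env aux) 1 1 [R 0 2 1, G 2 0 0] [H 0, H 0] :=
  valid_of .P1 den_dualizer (den_H.append den_H)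

theorem dual_KK : Valid (env aux) 1 1 [R 0 2 1, G 2 0 0] [K 0, K 0] :=
  valid_of .P1' den_dualizer (den_K.append den_K)

/-! ### Swaps -/

/-- A block of `n ≤ 2` wires crosses one wire from left to right. -/
def crossR : ℕ → Word
  | 1 => [S 0]
  | 2 => [S 1, S 0]
  | _ => []

/-- A block of `n ≤ 2` wires crosses one wire from right to left. -/
def crossL : ℕ → Word
  | 1 => [S 0]
  | 2 => [S 0, S 1]
  | _ => []

theorem mk_idn (n : ℕ) : mk E (idn n) = Q.wire (Equiv.refl _) := rfl

theorem mk_swap (m n : ℕ) : mk E (swap m n) = Q.wire finAddFlip := rfl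

theorem den_crossR {n : ℕ} (hn : n ≤ 2) :
    Den (env aux) (crossR n) (wire finAddFlip : Q E (n + 1) (1 + n)) := by
  interval_cases n
  · have : (wire finAddFlip : Q E (0 + 1) (1 + 0)) = one 1 := by
      rw [← wire_refl]; exact congrArg Q.wire (by decide)
    rw [this]; exact .nil 1
  · exact den_S
  · have h := ((den_idn 1).tensor (den_S (aux := aux))).append (den_S.tensor (den_idn 1))
    refine Eq.mp (congrArg (Den (env aux) _) ?_) h
    rw [mk_idn, mk_swap, wire_tensor, wire_tensor]
    exact (wire_comp _ _).trans (congrArg Q.wire (by decide))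

theorem den_crossL {n : ℕ} (hn : n ≤ 2) :
    Den (env aux) (crossL n) (wire finAddFlip : Q E (1 + n) (n + 1)) := by
  interval_cases n
  · have : (wire finAddFlip : Q E (1 + 0) (0 + 1)) = one 1 := by
      rw [← wire_refl]; exact congrArg Q.wire (by decide)
    rw [this]; exact .nil 1
  · exact den_S
  · have h := ((den_S (aux := aux)).tensor (den_idn 1)).append ((den_idn 1).tensor den_S)
    refine Eq.mp (congrArg (Den (env aux) _) ?_) h
    rw [mk_idn, mk_swap, wire_tensor, wire_tensor]
    exact (wire_comp _ _).trans (congrArg Q.wire (by decide))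

/-- Naturality of the symmetry against one bare wire. The types of the two sides differ by
commutativity of addition, so a common representative is fixed first. -/
theorem cross_right (k : Kind) (m n : ℕ) (hm : m ≤ 2) (hn : n ≤ 2) :
    Valid (env aux) (m + 1) (n + 1) ([⟨k, m, n, 0⟩] ++ crossR n) (crossR m ++ [⟨k, m, n, 1⟩]) := by
  have hb := Den.box (ρ := env aux) k m n
  obtain ⟨q, hq⟩ : ∃ q : Q E (m + 1) (n + 1), HEq q
    ((env aux k m n ⊗ one 1) ≫ wire finAddFlip) := exists_heq _ rfl (Nat.add_comm _ _)
  refine ⟨q, ?_, ?_⟩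
  · exact ((hb.tensor (.nil 1)).append (den_crossR hn)).cast rfl (Nat.add_comm _ _) hq.symm
  · rw [swap_natural] at hq
    exact ((den_crossR hm).append ((Den.nil 1).tensor hb)).cast rfl (Nat.add_comm _ _) hq.symm

theorem cross_left (k : Kind) (m n : ℕ) (hm : m ≤ 2) (hn : n ≤ 2) :
    Valid (env aux) (m + 1) (n + 1) ([⟨k, m, n, 1⟩] ++ crossL n) (crossL m ++ [⟨k, m, n, 0⟩]) := by
  have hb := Den.box (ρ := env aux) k m n
  obtain ⟨q, hq⟩ : ∃ q : Q E (m + 1) (n + 1), HEq q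
    ((one 1 ⊗ env aux k m n) ≫ wire finAddFlip) := exists_heq _ (Nat.add_comm _ _) rfl
  refine ⟨q, ?_, ?_⟩
  · exact (((Den.nil 1).tensor hb).append (den_crossL hn)).cast (Nat.add_comm _ _) rfl hq.symm
  · rw [swap_natural] at hq
    exact ((den_crossL hm).append (hb.tensor (Den.nil 1))).cast (Nat.add_comm _ _) rfl hq.symm

theorem SS : Valid (env aux) 2 2 [S 0, S 0] [] := by
  refine ⟨one 2, ?_, .nil 2⟩
  have h := den_S.append (den_S (aux := aux))
  have e : mk E (swap 1 1) ≫ mk E (swap 1 1) = one 2 := by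
    change wire _ ≫ wire _ = _
    rw [wire_comp, ← wire_refl]
    exact congrArg Q.wire (by decide)
  rwa [e] at h

/-! ### Phases -/

/-- Both sides fuse to the same green node. The phase equations that follow come from fusion in the
same way. -/
theorem phase_copy_left (p q : ℕ) :
    Valid (env aux) 1 2 [Gp p q 1 1 0, G 1 2 0] [G 1 2 0, Gp p q 1 1 0] :=
  (fuse 1 2 0 1 0 p q 0 0 p q (by decide) rfl rfl).trans
    (fuse' 1 1 1 1 0 0 0 p q p q (by decide) (by simp) (by simp)).symm

theorem phase_copy_right (p q : ℕ) :
    Valid (env aux) 1 2 [Gp p q 1 1 0, G 1 2 0] [G 1 2 0, Gp p q 1 1 1] :=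
  (fuse 1 2 0 1 0 p q 0 0 p q (by decide) rfl rfl).trans
    (fuse 1 1 1 1 0 0 0 p q p q (by decide) (by simp) (by simp)).symm

theorem phase_mul_left (p q : ℕ) :
    Valid (env aux) 2 1 [Gp p q 1 1 0, G 2 1 0] [G 2 1 0, Gp p q 1 1 0] :=
  (fuse 1 1 0 1 1 p q 0 0 p q (by decide) rfl rfl).trans
    (fuse 2 1 0 1 0 0 0 p q p q (by decide) (by simp) (by simp)).symm

theorem phase_mul_right (p q : ℕ) :
    Valid (env aux) 2 1 [Gp p q 1 1 1, G 2 1 0] [G 2 1 0, Gp p q 1 1 0] :=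
  (fuse' 1 1 0 1 1 p q 0 0 p q (by decide) rfl rfl).trans
    (fuse 2 1 0 1 0 0 0 p q p q (by decide) (by simp) (by simp)).symm

theorem cap_phase (p q : ℕ) :
    Valid (env aux) 2 0 [Gp p q 1 1 0, G 2 0 0] [Gp p q 1 1 1, G 2 0 0] :=
  (fuse 1 0 0 1 1 p q 0 0 p q (by decide) rfl rfl).trans
    (fuse' 1 0 0 1 1 p q 0 0 p q (by decide) rfl rfl).symm

theorem cup_phase (p q : ℕ) :
    Valid (env aux) 0 2 [G 0 2 0, Gp p q 1 1 0] [G 0 2 0, Gp p q 1 1 1] :=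
  (fuse' 0 1 1 1 0 0 0 p q p q (by decide) (by simp) (by simp)).trans
    (fuse 0 1 1 1 0 0 0 p q p q (by decide) (by simp) (by simp)).symm

theorem phase_split (p q : ℕ) :
    Valid (env aux) 1 1 [Gp p q 1 1 0] [G 1 2 0, Gp p q 1 0 1] :=
  (fuse 1 0 1 1 0 0 0 p q p q (by decide) (by simp) (by simp)).symm

theorem phase_counit (p q : ℕ) :
    Valid (env aux) 1 0 [Gp p q 1 1 0, G 1 0 0] [Gp p q 1 0 0] :=
  fuse 1 0 0 1 0 p q 0 0 p q (by decide) rfl rfl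

theorem phase_inv (p q p' q' : ℕ) (hp : (p + p') % 3 = 0) (hq : (q + q') % 3 = 0) :
    Valid (env aux) 1 1 [Gp p q 1 1 0, Gp p' q' 1 1 0] [] :=
  (fuse 1 1 0 1 0 p q p' q' 0 0 (by decide) hp hq).trans green_id

/-! ### Scalars -/

theorem omega_cube : omega ^ 3 = 1 := by
  rw [omega, ← Complex.exp_nat_mul, ← Complex.exp_two_pi_mul_I]
  congr 1
  push_cast
  ring

theorem omega_ne_one : omega ≠ 1 := by
  intro h
  obtain ⟨n, hn⟩ := Complex.exp_eq_one_iff.1 h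
  have h0 : (2 * Real.pi * Complex.I : ℂ) ≠ 0 := Complex.two_pi_I_ne_zero
  have h1 : ((3 * n : ℤ) : ℂ) = ((1 : ℤ) : ℂ) := by
    apply mul_right_cancel₀ h0
    push_cast
    linear_combination -3 * hn
  have h2 : (3 * n : ℤ) = 1 := by exact_mod_cast h1
  omega

theorem omega_sum : 1 + omega + omega ^ 2 = 0 := by
  have h : (omega - 1) * (1 + omega + omega ^ 2) = 0 := by
    linear_combination omega_cube
  exact (mul_eq_zero.1 h).resolve_left (sub_ne_zero.2 omega_ne_one)

theorem sum_zmod_three {M : Type*} [AddCommMonoid M] (f : ZMod 3 → M) :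
    ∑ j, f j = f 0 + f 1 + f 2 := Fin.sum_univ_three f

theorem sum_one_wire (f : (Fin 1 → ZMod 3) → ℂ) :
    ∑ x, f x = f (fun _ => 0) + f (fun _ => 1) + f (fun _ => 2) := by
  rw [← (Equiv.funUnique (Fin 1) (ZMod 3)).symm.sum_comp, sum_zmod_three]
  rfl

/-- The red point is 3|0⟩, because the third roots of unity sum to zero. -/
theorem red_point_apply (y : Fin 1 → ZMod 3) (x : Fin 0 → ZMod 3) :
    interp (X 0 1 0 0) y x = if y 0 = 0 then 3 else 0 := by
  have key : ∀ z : ZMod 3, 1 + omega ^ z.val + omega ^ (2 * z).val = if z = 0 then 3 else 0 := by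
    intro z
    obtain rfl | rfl | rfl : z = 0 ∨ z = 1 ∨ z = 2 := by revert z; decide
    · rw [if_pos rfl, mul_zero, ZMod.val_zero]; norm_num
    · rw [if_neg (by decide)]
      change 1 + omega ^ 1 + omega ^ 2 = 0
      linear_combination omega_sum
    · rw [if_neg (by decide)]
      change 1 + omega ^ 2 + omega ^ 1 = 0
      linear_combination omega_sum
  rw [← key (y 0)]
  simp [interp, X, sum_zmod_three, phase]

/-- Only the amplitude at 0 survives, and there every green phase equals 1. The scalar may therefore
be dropped whatever the angles are. -/
theorem red_point_green_counit_ne_zero (α β : Real.Angle) :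
    interp (X 0 1 0 0 ⨾ Z 1 0 α β) ≠ 0 := by
  intro h
  have h0 := congrFun (congrFun h Fin.elim0) Fin.elim0
  rw [interp, Matrix.mul_apply, sum_one_wire, red_point_apply, red_point_apply,
    red_point_apply, if_pos rfl, if_neg (by decide), if_neg (by decide)] at h0
  simp [interp, Z, phase] at h0

theorem red_point_counit (p q : ℕ) :
    Valid (env aux) 0 0 [R 0 1 0, Gp p q 1 0 0] [] :=
  valid_of (.scalar _ (red_point_green_counit_ne_zero _ _)) ((den_R 0 1).append (den_green p q 1 0))
    (den_idn 0)

theorem euler_word (hE : EulerDecomposition E) :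
    Valid (env aux) 1 1 [H 0] [Gp 2 2 1 1 0, Rp 2 2 1 1 0, Gp 2 2 1 1 0] :=
  valid_of hE den_H (((den_green 2 2 1 1).append (den_red 2 2 1 1)).append (den_green 2 2 1 1))

end QutritZX

/-! ### Frobenius and Hopf laws, commutativity, links and adders, and polarisation from Euler -/

namespace QutritZX
open Diagram Q Layer

variable {E : Equations} {aux : ℕ → ∀ m n : ℕ, Q E m n}

theorem counit_right : Valid (env aux) 1 1 [G 1 2 0, G 1 0 1] [] :=
  run_valid [.rule (fuse₀ 1 0 1 1 0) 0 0, .rule green_id 0 0] rfl rfl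

theorem counit_left : Valid (env aux) 1 1 [G 1 2 0, G 1 0 0] [] :=
  run_valid [.rule (fuse₀' 1 0 1 1 0) 0 0, .rule green_id 0 0] rfl rfl

theorem unit_right : Valid (env aux) 1 1 [G 0 1 1, G 2 1 0] [] :=
  run_valid [.rule (fuse₀' 0 1 0 1 1) 0 0, .rule green_id 0 0] rfl rfl

theorem unit_left : Valid (env aux) 1 1 [G 0 1 0, G 2 1 0] [] :=
  run_valid [.rule (fuse₀ 0 1 0 1 1) 0 0, .rule green_id 0 0] rfl rfl

theorem coassoc : Valid (env aux) 1 3 [G 1 2 0, G 1 2 1] [G 1 2 0, G 1 2 0] :=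
  run_valid [.rule (fuse₀ 1 2 1 1 0) 0 0, .rule ((fuse₀' 1 2 1 1 0).symm) 0 0] rfl rfl

theorem green_assoc : Valid (env aux) 3 1 [G 2 1 1, G 2 1 0] [G 2 1 0, G 2 1 0] :=
  run_valid [.rule (fuse₀' 2 1 0 1 1) 0 0, .rule ((fuse₀ 2 1 0 1 1).symm) 0 0] rfl rfl

theorem frob_left : Valid (env aux) 2 2 [G 1 2 1, G 2 1 0] [G 2 1 0, G 1 2 0] :=
  run_valid [.rule (fuse₀' 1 1 1 1 1) 0 0, .rule ((fuse₀ 2 2 0 1 0).symm) 0 0] rfl rfl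

theorem snake_left : Valid (env aux) 1 1 [G 0 2 1, G 2 0 0] [] :=
  run_valid [.rule (fuse₀' 0 0 1 1 1) 0 0, .rule green_id 0 0] rfl rfl

theorem snake_right : Valid (env aux) 1 1 [G 0 2 0, G 2 0 1] [] :=
  run_valid [.rule (fuse₀ 0 0 1 1 1) 0 0, .rule green_id 0 0] rfl rfl

theorem bend_cup_left : Valid (env aux) 1 2 [G 0 2 1, G 2 1 0] [G 1 2 0] :=
  run_valid [.rule (fuse₀' 0 1 1 1 1) 0 0] rfl rfl

theorem bend_cup_right : Valid (env aux) 1 2 [G 0 2 0, G 2 1 1] [G 1 2 0] :=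
  run_valid [.rule (fuse₀ 0 1 1 1 1) 0 0] rfl rfl

theorem bend_cap_left : Valid (env aux) 2 1 [G 1 2 1, G 2 0 0] [G 2 1 0] :=
  run_valid [.rule (fuse₀' 1 0 1 1 1) 0 0] rfl rfl

theorem mul_counit : Valid (env aux) 2 0 [G 2 1 0, G 1 0 0] [G 2 0 0] :=
  run_valid [.rule (fuse₀ 2 0 0 1 0) 0 0] rfl rfl

theorem unit_copy : Valid (env aux) 0 2 [G 0 1 0, G 1 2 0] [G 0 2 0] :=
  run_valid [.rule (fuse₀ 0 2 0 1 0) 0 0] rfl rfl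

theorem cap_unit_left : Valid (env aux) 1 0 [G 0 1 0, G 2 0 0] [G 1 0 0] :=
  run_valid [.rule (fuse₀ 0 0 0 1 1) 0 0] rfl rfl

theorem cap_unit_right : Valid (env aux) 1 0 [G 0 1 1, G 2 0 0] [G 1 0 0] :=
  run_valid [.rule (fuse₀' 0 0 0 1 1) 0 0] rfl rfl

theorem cup_counit_left : Valid (env aux) 0 1 [G 0 2 0, G 1 0 0] [G 0 1 0] :=
  run_valid [.rule (fuse₀' 0 0 1 1 0) 0 0] rfl rfl

theorem cup_counit_right : Valid (env aux) 0 1 [G 0 2 0, G 1 0 1] [G 0 1 0] :=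
  run_valid [.rule (fuse₀ 0 0 1 1 0) 0 0] rfl rfl

theorem cup_assoc : Valid (env aux) 0 3 [G 0 2 0, G 1 2 0] [G 0 2 0, G 1 2 1] :=
  run_valid [.rule (fuse₀' 0 2 1 1 0) 0 0, .rule ((fuse₀ 0 2 1 1 0).symm) 0 0] rfl rfl

/-- H is its own transpose: a second H, inserted together with its inverse, turns the green cup into
a red one. The bent red cup is the dualizer H², and the inserted inverse removes one factor. -/
theorem bend_H : Valid (env aux) 1 1 [G 0 2 1, H 1, G 2 0 0] [H 0] :=
  run_valid [.rule HK.symm 1 2, .left 2, .left 1, .rule ((red_eq 0 2 0 0).symm) 0 1, .left 1,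
    .rule dual_HH 0 0, .rule HK 1 0] rfl rfl

theorem cup_H : Valid (env aux) 0 2 [G 0 2 0, H 1] [G 0 2 0, H 0] :=
  run_valid [.rule bend_H.symm 1 1, .right 0, .right 1, .rule snake_right 2 0] rfl rfl

theorem cap_H : Valid (env aux) 2 0 [H 1, G 2 0 0] [H 0, G 2 0 0] :=
  run_valid [.rule snake_right.symm 0 1, .left 1, .rule cup_H.symm 0 1, .left 2, .left 1, .rule
    snake_left 0 0] rfl rfl

theorem cap_K : Valid (env aux) 2 0 [K 1, G 2 0 0] [K 0, G 2 0 0] :=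
  run_valid [.rule KH.symm 0 0, .right 1, .rule cap_H.symm 2 0, .rule KH 1 1] rfl rfl

theorem HH_KK : Valid (env aux) 1 1 [H 0, H 0] [K 0, K 0] :=
  run_valid [.rule dual_HH.symm 0 0, .rule dual_KK 0 0] rfl rfl

theorem HHH : Valid (env aux) 1 1 [H 0, H 0, H 0] [K 0] :=
  run_valid [.rule HH_KK 0 0, .rule KH 1 0] rfl rfl

theorem cap_swap : Valid (env aux) 2 0 [S 0, G 2 0 0] [G 2 0 0] :=
  run_valid [.rule snake_right.symm 1 0, .rule (cross_left (.green 0 0) 2 0 (by decide) (by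
    decide)) 2 0, .left 0, .left 1, .right 4, .rule ((cross_right (.green 0 0) 2 0 (by decide) (by
    decide)).symm) 2 1, .rule cup_swap 0 0, .rule snake_right 0 0] rfl rfl

/-- The two colour-change rules write one red node with H and H† interchanged. Comparing them shows
that H² is compatible with copying, and likewise with the red multiplication below. -/
theorem dual_copy : Valid (env aux) 1 2 [H 0, H 0, G 1 2 0] [G 1 2 0, H 0, H 0, H 1, H 1] :=
  run_valid [.rule KH.symm 3 0, .rule KH.symm 3 1, .left 4, .left 3, .rule ((red_eq' 1 2 0
    0).symm) 1 0, .rule (red_eq 1 2 0 0) 1 0, .rule HK 0 0, .left 3, .left 2] rfl rfl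

theorem red_mul_dual : Valid (env aux) 2 1 [R 2 1 0, H 0, H 0] [H 0, H 0, H 1, H 1, R 2 1 0] :=
  run_valid [.rule (red_eq' 2 1 0 0) 0 0, .rule KH 3 0, .rule HK.symm 1 0, .rule HK.symm 4 1,
    .right 2, .right 3, .rule ((red_eq 2 1 0 0).symm) 4 0] rfl rfl

theorem red_unit_left : Valid (env aux) 1 1 [R 0 1 0, R 2 1 0] [] :=
  run_valid [.rule (red_eq 0 1 0 0) 0 0, .rule (red_eq 2 1 0 0) 2 0, .rule HK 1 0, .right 0, .rule
    unit_left 1 0, .rule KH 0 0] rfl rfl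

theorem red_unit_right : Valid (env aux) 1 1 [R 0 1 1, R 2 1 0] [] :=
  run_valid [.rule (red_eq 0 1 0 0) 0 1, .rule (red_eq 2 1 0 0) 2 0, .left 1, .rule HK 2 1, .left
    0, .rule unit_right 1 0, .rule KH 0 0] rfl rfl

theorem red_assoc : Valid (env aux) 3 1 [R 2 1 1, R 2 1 0] [R 2 1 0, R 2 1 0] :=
  run_valid [.rule (red_eq 2 1 0 0) 0 1, .rule (red_eq 2 1 0 0) 4 0, .left 3, .rule HK 4 1, .left
    2, .rule green_assoc 3 0, .rule HK.symm 4 0, .right 0, .left 1, .rule ((red_eq 2 1 0 0).symm)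
    1 0, .left 0, .left 1, .rule ((red_eq 2 1 0 0).symm) 1 0] rfl rfl

theorem red_point_H : Valid (env aux) 0 1 [R 0 1 0, H 0] [G 0 1 0] :=
  run_valid [.rule (red_eq' 0 1 0 0) 0 0, .rule KH 1 0] rfl rfl

theorem red_counit_H : Valid (env aux) 1 0 [H 0, R 1 0 0] [G 1 0 0] :=
  run_valid [.rule (red_eq 1 0 0 0) 1 0, .rule HK 0 0] rfl rfl

theorem red_counit_K : Valid (env aux) 1 0 [K 0, R 1 0 0] [G 1 0 0] :=
  run_valid [.rule (red_eq' 1 0 0 0) 1 0, .rule KH 0 0] rfl rfl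

theorem red_point_HH : Valid (env aux) 0 1 [R 0 1 0, H 0, H 0] [R 0 1 0] :=
  run_valid [.rule red_point_H 0 0, .rule ((red_eq 0 1 0 0).symm) 0 0] rfl rfl

theorem red_point_cap_right : Valid (env aux) 1 0 [R 0 1 1, G 2 0 0] [R 1 0 0] :=
  run_valid [.rule (red_eq 0 1 0 0) 0 1, .rule cap_H 1 0, .left 0, .rule cap_unit_right 1 0, .rule
    ((red_eq' 1 0 0 0).symm) 0 0] rfl rfl

theorem red_counit_cup_right : Valid (env aux) 0 1 [G 0 2 0, R 1 0 1] [R 0 1 0] :=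
  run_valid [.rule (red_eq' 1 0 0 0) 1 1, .rule cup_H 0 0, .right 1, .rule cup_counit_right 0 0,
    .rule ((red_eq 0 1 0 0).symm) 0 0] rfl rfl

theorem cap_assoc : Valid (env aux) 3 0 [G 2 1 0, G 2 0 0] [G 2 1 1, G 2 0 0] :=
  run_valid [.rule (fuse₀ 2 0 0 1 1) 0 0, .rule ((fuse₀' 2 0 0 1 1).symm) 0 0] rfl rfl

theorem cap_mul : Valid (env aux) 3 0 [G 2 1 0, G 2 0 0] [G 1 2 2, G 2 0 1, G 2 0 0] :=
  run_valid [.rule cap_assoc 0 0, .rule bend_cap_left.symm 0 1] rfl rfl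

theorem red_counit_mul : Valid (env aux) 2 0 [G 2 1 0, R 1 0 0] [R 1 0 0, R 1 0 0] :=
  run_valid [.rule red_point_cap_right.symm 1 0, .right 0, .rule cap_mul 1 0, .rule red_copy 0 2,
    .right 0, .rule red_point_cap_right 1 1, .left 0, .rule red_point_cap_right 1 0, .left 0] rfl
    rfl

theorem red_mul_counit : Valid (env aux) 2 0 [R 2 1 0, G 1 0 0] [G 1 0 0, G 1 0 0] :=
  run_valid [.rule (red_eq 2 1 0 0) 0 0, .rule ((red_eq' 1 0 0 0).symm) 3 0, .rule red_counit_mul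
    2 0, .right 0, .rule red_counit_K 1 0, .left 0, .rule red_counit_K 1 0] rfl rfl

theorem red_point_mul_right : Valid (env aux) 1 1 [R 0 1 1, G 2 1 0] [R 1 0 0, R 0 1 0] :=
  run_valid [.rule bend_cap_left.symm 1 0, .rule red_copy 0 1, .right 0, .rule red_point_cap_right
    1 0, .left 0] rfl rfl

theorem green_point_mul_right : Valid (env aux) 1 1 [G 0 1 1, R 2 1 0] [G 1 0 0, G 0 1 0] :=
  run_valid [.rule (red_eq 2 1 0 0) 1 0, .left 0, .rule ((red_eq' 0 1 0 0).symm) 1 1, .rule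
    red_point_mul_right 1 0, .rule red_counit_K 0 0, .rule red_point_H 1 0] rfl rfl

theorem red_mul_red_counit : Valid (env aux) 2 0 [R 2 1 0, R 1 0 0] [H 0, H 0, G 2 0 0] :=
  run_valid [.rule (red_eq 2 1 0 0) 0 0, .rule red_counit_H 3 0, .rule mul_counit 2 0, .rule cap_K
    1 0, .rule HH_KK.symm 0 0] rfl rfl

theorem cup_cross : Valid (env aux) 1 3 [G 0 2 1, S 0] [G 0 2 0, S 1] :=
  run_valid [.rule SS.symm 2 1, .rule (cross_left (.green 0 0) 0 2 (by decide) (by decide)) 0 0]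
    rfl rfl

/-- The Hopf law with antipode H². By `red_mul_red_counit` the antipode is the red multiplication
closed by a red counit and bent by a cup; this exposes the right-hand side of the bialgebra rule,
and the square collapses. -/
theorem hopf_right : Valid (env aux) 1 1 [G 1 2 0, H 1, H 1, R 2 1 0] [G 1 0 0, R 0 1 0] :=
  run_valid [.rule snake_right.symm 3 1, .rule cap_swap.symm 4 2, .left 2, .rule (cross_left .had
    1 1 (by decide) (by decide)) 3 2, .left 1, .rule (cross_left .had 1 1 (by decide) (by decide))
    2 2, .rule cup_cross.symm 1 1, .rule red_mul_red_counit.symm 3 2, .rule unit_copy.symm 1 2,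
    .right 0, .left 5, .left 4, .rule bialg.symm 1 0, .rule green_point_mul_right 0 0, .rule
    unit_copy 1 0, .rule red_counit_cup_right 1 0] rfl rfl

theorem hopf_left : Valid (env aux) 1 1 [G 1 2 0, H 0, H 0, R 2 1 0] [G 1 0 0, R 0 1 0] :=
  run_valid [.rule HK.symm 4 0, .rule HK.symm 5 0, .rule HH_KK.symm 6 0, .rule red_mul_dual 3 0,
    .rule HH_KK 3 0, .rule HK 2 0, .rule HK 1 0, .rule hopf_right 0 0, .rule red_point_HH 1 0] rfl
    rfl

/-- In the convolution monoid of maps from two wires to one, this is (x+y) + (−x−y) = 0. Because H²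
is multiplicative, the second factor is the antipode after the multiplication, so the bialgebra rule
and the Hopf law apply. -/
theorem conv_dual_mul : Valid (env aux) 2 1 [G 1 2 0, G 1 2 2, S 1, R 2 1 0, H 1, H 1, H 2, H 2, R
    2 1 1, R 2 1 0] [G 1 0 0, G 1 0 0, R 0 1 0] :=
  run_valid [.rule red_mul_dual.symm 4 1, .rule bialg.symm 0 0, .rule hopf_right 1 0, .rule
    red_mul_counit 0 0] rfl rfl

/-- Here (−x) + (−y) + y + x = 0 cancels from the inside outwards, using associativity only. The
inverse of the multiplication is thus also an inverse of the opposite multiplication. -/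
theorem conv_dual_mul_op : Valid (env aux) 2 1 [G 1 2 0, G 1 2 2, S 1, H 0, H 0, H 1, H 1, R 2 1
    0, S 1, R 2 1 1, R 2 1 0] [G 1 0 0, G 1 0 0, R 0 1 0] :=
  run_valid [.right 7, .right 8, .rule red_assoc.symm 9 0, .rule red_assoc 8 1, .right 6, .right
    5, .right 4, .right 3, .rule (cross_left (.green 0 0) 1 2 (by decide) (by decide)) 1 1, .left
    2, .left 3, .rule hopf_left 4 1, .rule red_unit_left 5 1, .left 1, .left 2, .rule ((cross_left
    (.green 0 0) 1 0 (by decide) (by decide)).symm) 3 1, .left 3, .rule hopf_left 0 0, .right 1]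
    rfl rfl

theorem conv_cancel_left : Valid (env aux) 2 1 [G 1 2 0, G 1 2 2, S 1, G 1 2 0, G 1 2 2, S 1, R 2
    1 0, H 1, H 1, H 2, H 2, R 2 1 1, R 2 1 0, S 1, R 2 1 1, R 2 1 0] [S 0, R 2 1 0] :=
  run_valid [.rule conv_dual_mul 3 0, .right 5, .right 6, .rule red_unit_left 7 0, .right 0, .left
    2, .rule counit_left 1 0, .rule ((cross_left (.green 0 0) 1 0 (by decide) (by decide)).symm) 1
    0, .rule counit_left 0 1] rfl rfl

theorem conv_cancel_right : Valid (env aux) 2 1 [G 1 2 0, G 1 2 2, S 1, R 2 1 0, G 1 2 1, G 1 2 3,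
    S 2, H 1, H 1, H 2, H 2, R 2 1 1, S 2, R 2 1 2, R 2 1 1, R 2 1 0] [R 2 1 0] :=
  run_valid [.rule conv_dual_mul_op 4 1, .rule red_unit_right 6 0, .right 4, .right 3, .right 2,
    .rule counit_right 1 2, .right 2, .rule ((cross_right (.green 0 0) 1 0 (by decide) (by
    decide)).symm) 1 1, .rule counit_right 0 0] rfl rfl

theorem copy_copy_left : Valid (env aux) 2 6 [G 1 2 0, G 1 2 2, S 1, G 1 2 0, G 1 2 2, S 1] [G 1 2
    0, G 1 2 2, S 1, G 1 2 2, G 1 2 4, S 3] :=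
  run_valid [.left 2, .rule ((cross_left (.green 0 0) 1 2 (by decide) (by decide)).symm) 3 2,
    .right 0, .rule coassoc.symm 1 0, .left 0, .left 1, .rule coassoc.symm 2 3, .right 1, .right
    2, .left 5, .rule (cross_right (.green 0 0) 1 2 (by decide) (by decide)) 3 1, .left 2, .left
    3] rfl rfl

theorem mul_tail : Valid (env aux) 4 1 [R 2 1 0, S 1, R 2 1 1, R 2 1 0] [S 2, R 2 1 2, R 2 1 1, R
    2 1 0] :=
  run_valid [.right 0, .right 1, .rule red_assoc.symm 2 0] rfl rfl

theorem mul_copies : Valid (env aux) 4 5 [G 1 2 2, G 1 2 4, S 3, R 2 1 0] [R 2 1 0, G 1 2 1, G 1 2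
    3, S 2] :=
  run_valid [.left 2, .left 1, .left 0] rfl rfl

theorem conv_reassoc : Valid (env aux) 2 1 [G 1 2 0, G 1 2 2, S 1, G 1 2 0, G 1 2 2, S 1, R 2 1 0,
    H 1, H 1, H 2, H 2, R 2 1 1, R 2 1 0, S 1, R 2 1 1, R 2 1 0] [G 1 2 0, G 1 2 2, S 1, R 2 1 0,
    G 1 2 1, G 1 2 3, S 2, H 1, H 1, H 2, H 2, R 2 1 1, S 2, R 2 1 2, R 2 1 1, R 2 1 0] :=
  run_valid [.rule copy_copy_left 0 0, .rule mul_copies 3 0, .rule mul_tail 12 0] rfl rfl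

/-- The multiplication and its opposite are a left and a right convolution inverse of the same map,
so they agree. Commutativity is not among the rules: fusion does not permute legs and (S3) concerns
the cup only. -/
theorem red_comm : Valid (env aux) 2 1 [S 0, R 2 1 0] [R 2 1 0] :=
  run_valid [.rule conv_cancel_left.symm 0 0, .rule conv_reassoc 0 0, .rule conv_cancel_right 0 0]
    rfl rfl

theorem green_comm : Valid (env aux) 2 1 [S 0, G 2 1 0] [G 2 1 0] :=
  run_valid [.rule HK.symm 1 0, .rule HK.symm 1 1, .rule HK.symm 6 0, .left 2, .left 3, .rule
    ((red_eq 2 1 0 0).symm) 3 0, .rule ((cross_right .had 1 1 (by decide) (by decide)).symm) 0 0,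
    .rule ((cross_left .had 1 1 (by decide) (by decide)).symm) 1 0, .rule red_comm 2 0, .rule
    (red_eq 2 1 0 0) 2 0, .rule HK 5 0, .right 0, .rule HK 1 0, .rule HK 0 1] rfl rfl

theorem copy_bend : Valid (env aux) 1 2 [G 1 2 0] [G 0 2 1, G 0 2 2, G 2 1 1, G 2 0 0] :=
  run_valid [.rule snake_left.symm 0 0, .right 1, .rule cup_assoc.symm 0 1, .rule
    bend_cup_left.symm 1 1] rfl rfl

theorem cups_swap : Valid (env aux) 0 4 [G 0 2 0, G 0 2 1, S 2] [G 0 2 0, G 0 2 1, S 0] :=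
  run_valid [.rule cup_cross.symm 1 1, .right 0, .rule cup_cross.symm 1 0] rfl rfl

theorem green_cocomm : Valid (env aux) 1 2 [G 1 2 0, S 0] [G 1 2 0] :=
  run_valid [.rule copy_bend 0 0, .right 3, .right 2, .rule cups_swap 0 1, .rule green_comm 2 1,
    .rule copy_bend.symm 0 0] rfl rfl

/-- The phase is split into a copy and a phased counit; the red point is copied, and one copy closes
to a non-zero scalar. -/
theorem red_point_phase_11 : Valid (env aux) 0 1 [R 0 1 0, Gp 1 1 1 1 0] [R 0 1 0] :=
  run_valid [.rule (phase_split 1 1) 1 0, .rule red_copy 0 0, .rule (red_point_counit 1 1) 1 1]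
    rfl rfl

theorem red_point_phase_22 : Valid (env aux) 0 1 [R 0 1 0, Gp 2 2 1 1 0] [R 0 1 0] :=
  run_valid [.rule (phase_split 2 2) 1 0, .rule red_copy 0 0, .rule (red_point_counit 2 2) 1 1]
    rfl rfl

theorem phase_red_counit_22 : Valid (env aux) 1 0 [Gp 2 2 1 1 0, R 1 0 0] [R 1 0 0] :=
  run_valid [.rule red_point_cap_right.symm 1 0, .right 0, .rule (cap_phase 2 2) 1 0, .rule
    red_point_phase_22 0 1, .rule red_point_cap_right 0 0] rfl rfl

theorem red_point_phase_12 : Valid (env aux) 0 1 [R 0 1 0, Gp 1 2 1 1 0] [R 0 1 0] :=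
  run_valid [.rule (phase_split 1 2) 1 0, .rule red_copy 0 0, .rule (red_point_counit 1 2) 1 1]
    rfl rfl

theorem phase_red_counit_12 : Valid (env aux) 1 0 [Gp 1 2 1 1 0, R 1 0 0] [R 1 0 0] :=
  run_valid [.rule red_point_cap_right.symm 1 0, .right 0, .rule (cap_phase 1 2) 1 0, .rule
    red_point_phase_12 0 1, .rule red_point_cap_right 0 0] rfl rfl

/-- The phase 1/1 is invariant under the exchange of its two angles, so both colour changes involve
the same green gate. -/
theorem dual_phase : Valid (env aux) 1 1 [H 0, H 0, Gp 1 1 1 1 0] [Gp 1 1 1 1 0, H 0, H 0] :=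
  run_valid [.rule KH.symm 3 0, .rule ((red_eq' 1 1 1 1).symm) 1 0, .rule (red_eq 1 1 1 1) 1 0,
    .rule HK 0 0] rfl rfl

theorem link_flip : Valid (env aux) 2 2 [G 1 2 1, H 1, G 2 1 0] [G 1 2 0, H 1, G 2 1 1] :=
  run_valid [.rule bend_cup_right.symm 0 1, .left 1, .rule cup_H.symm 0 1, .left 2, .left 1, .rule
    bend_cup_left 0 0] rfl rfl

theorem link_symm : Valid (env aux) 2 2 [S 0, G 1 2 0, H 1, G 2 1 1, S 0] [G 1 2 0, H 1, G 2 1 1]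
    :=
  run_valid [.rule ((cross_left (.green 0 0) 1 2 (by decide) (by decide)).symm) 0 0, .rule
    green_comm.symm 4 1, .rule (cross_right .had 1 1 (by decide) (by decide)) 3 1, .rule SS 2 1,
    .rule (cross_left (.green 0 0) 2 1 (by decide) (by decide)) 3 0, .right 1, .rule SS 2 0, .rule
    (cross_left .had 1 1 (by decide) (by decide)) 1 1, .rule green_cocomm 0 1, .rule link_flip 0
    0] rfl rfl

theorem link_comm : Valid (env aux) 3 3 [G 1 2 0, H 1, G 2 1 1, G 1 2 1, H 2, G 2 1 2] [G 1 2 1, H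
    2, G 2 1 2, G 1 2 0, H 1, G 2 1 1] :=
  run_valid [.rule frob_left.symm 2 1, .right 1, .right 0, .right 3, .right 2, .right 1, .right 4,
    .right 3, .right 2] rfl rfl

/-- Writing H† as H³ makes the two legs H and H·H², so after a colour change this is the Hopf law.
-/
theorem conv_H_K : Valid (env aux) 1 1 [G 1 2 0, H 0, K 1, G 2 1 0] [G 1 0 0, G 0 1 0] :=
  run_valid [.rule HHH.symm 2 1, .rule KH.symm 6 0, .right 1, .right 2, .rule ((red_eq' 2 1 0
    0).symm) 3 0, .rule hopf_right 0 0, .rule red_point_H 1 0] rfl rfl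

theorem conv_K_H : Valid (env aux) 1 1 [G 1 2 0, K 0, H 1, G 2 1 0] [G 1 0 0, G 0 1 0] :=
  run_valid [.rule HHH.symm 1 0, .rule KH.symm 6 0, .rule ((red_eq' 2 1 0 0).symm) 3 0, .rule
    hopf_left 0 0, .rule red_point_H 1 0] rfl rfl

/-- Two links between the same wires merge, by coassociativity and associativity, into the
convolution of their boxes. -/
theorem link_H_K : Valid (env aux) 2 2 [G 1 2 0, H 1, G 2 1 1, G 1 2 0, K 1, G 2 1 1] [] :=
  run_valid [.left 2, .left 1, .rule coassoc.symm 0 0, .left 3, .rule green_assoc 4 1, .left 2,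
    .rule conv_K_H 1 1, .rule counit_right 0 0, .rule unit_left 0 1] rfl rfl

theorem link_K_H : Valid (env aux) 2 2 [G 1 2 0, K 1, G 2 1 1, G 1 2 0, H 1, G 2 1 1] [] :=
  run_valid [.left 2, .left 1, .rule coassoc.symm 0 0, .left 3, .rule green_assoc 4 1, .left 2,
    .rule conv_H_K 1 1, .rule counit_right 0 0, .rule unit_left 0 1] rfl rfl

theorem link_phase_left : Valid (env aux) 2 2 [Gp 1 1 1 1 0, G 1 2 0, H 1, G 2 1 1] [G 1 2 0, H 1,
    G 2 1 1, Gp 1 1 1 1 0] :=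
  run_valid [.rule (phase_copy_left 1 1) 0 0, .right 1, .right 2] rfl rfl

theorem link_phase_right : Valid (env aux) 2 2 [Gp 1 1 1 1 1, G 1 2 0, H 1, G 2 1 1] [G 1 2 0, H
    1, G 2 1 1, Gp 1 1 1 1 1] :=
  run_valid [.left 0, .left 1, .rule (phase_mul_right 1 1) 2 1] rfl rfl

theorem dual_link : Valid (env aux) 2 2 [H 0, H 0, G 1 2 0, H 1, G 2 1 1, H 0, H 0] [G 1 2 0, K 1,
    G 2 1 1] :=
  run_valid [.rule dual_copy 0 0, .rule HH_KK 7 0, .right 2, .right 3, .right 4, .right 5, .rule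
    HK 6 0, .right 1, .right 2, .right 3, .right 4, .rule HK 5 0, .rule HHH 1 1] rfl rfl

theorem link_conj_had : Valid (env aux) 2 2 [H 1, G 1 2 0, H 1, G 2 1 1, K 1] [G 1 2 0, R 2 1 1]
    :=
  run_valid [.left 0, .left 1, .rule ((red_eq' 2 1 0 0).symm) 1 1] rfl rfl

theorem adder_plus : Valid (env aux) 0 2 [G 0 1 0, G 0 1 1, G 1 2 0, R 2 1 1] [G 0 1 0, G 0 1 1]
    :=
  run_valid [.left 1, .rule green_point_mul_right 2 1, .rule counit_right 1 0] rfl rfl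

theorem red_phase_plus : Valid (env aux) 0 1 [G 0 1 0, Rp 1 1 1 1 0] [G 0 1 0] :=
  run_valid [.rule (red_eq 1 1 1 1) 1 0, .rule ((red_eq' 0 1 0 0).symm) 0 0, .rule
    red_point_phase_11 0 0, .rule red_point_H 0 0] rfl rfl

theorem red_mul_H : Valid (env aux) 2 1 [R 2 1 0, H 0] [H 0, H 1, G 2 1 0] :=
  run_valid [.rule (red_eq' 2 1 0 0) 0 0, .rule KH 3 0] rfl rfl

/-- The bilinearity ω^{(x+y)z} = ω^{xz}ω^{yz}: the bialgebra rule splits the copy of the sum, and H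
turns the red multiplication into a green one. -/
theorem adder_link : Valid (env aux) 3 3 [G 1 2 0, R 2 1 1, G 1 2 1, H 2, G 2 1 2] [G 1 2 1, H 2,
    G 2 1 2, S 0, G 1 2 1, H 2, G 2 1 2, S 0, G 1 2 0, R 2 1 1] :=
  run_valid [.rule bialg 1 1, .rule red_mul_H 5 2, .rule green_assoc.symm 7 2, .rule coassoc 0 0,
    .right 1, .right 2, .rule SS.symm 3 0, .right 0, .rule (cross_right (.green 0 0) 1 2 (by
    decide) (by decide)) 1 0, .right 5, .right 4, .right 3, .right 6, .right 5, .right 4, .right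
    3, .right 2, .right 1, .right 7, .right 6, .right 5, .right 4, .right 3, .right 2, .right 8,
    .right 7, .right 6] rfl rfl

/-- The red counit absorbs the green phase 2/2, so the missing outer factors of the Euler
decomposition can be supplied. Only the phase 1/1 that compensates for the first of them is left. -/
theorem euler_counit (hE : EulerDecomposition E) : Valid (env aux) 1 0 [Rp 2 2 1 0 0] [Gp 1 1 1 0
    0] :=
  run_valid [.rule (red_eq' 1 0 2 2) 0 0, .rule ((phase_counit 2 2).symm) 1 0, .rule
    red_counit_K.symm 2 0, .rule ((red_eq' 1 1 2 2).symm) 0 0, .rule ((phase_inv 1 1 2 2 rfl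
    rfl).symm) 0 0, .rule phase_red_counit_22.symm 3 0, .rule ((euler_word hE).symm) 1 0, .rule
    red_counit_H 1 0, .rule (phase_counit 1 1) 0 0] rfl rfl

theorem red_phase_euler (hE : EulerDecomposition E) : Valid (env aux) 1 1 [Rp 2 2 1 1 0] [Gp 1 1 1
    1 0, H 0, Gp 1 1 1 1 0] :=
  run_valid [.rule ((phase_inv 1 1 2 2 rfl rfl).symm) 0 0, .rule ((phase_inv 2 2 1 1 rfl
    rfl).symm) 3 0, .rule ((euler_word hE).symm) 1 0] rfl rfl

/-- The red form of the counit fuses through the red multiplication into a single red phase on one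
wire below which stands a cap. The Euler decomposition of that phase displays the two squares and
the mixed term. -/
theorem euler_mul_counit (hE : EulerDecomposition E) : Valid (env aux) 2 0 [R 2 1 0, Gp 1 1 1 0 0]
    [Gp 1 1 1 1 0, Gp 1 1 1 1 1, K 0, G 2 0 0] :=
  run_valid [.rule ((euler_counit hE).symm) 1 0, .rule (red_eq 2 1 0 0) 0 0, .rule (red_eq 1 0 2
    2) 4 0, .rule HK 3 0, .rule ((phase_counit 2 2).symm) 3 0, .rule ((phase_mul_left 2 2).symm) 2
    0, .rule mul_counit 3 0, .left 1, .rule cap_K 2 0, .rule HK.symm 2 0, .rule ((red_eq 1 1 2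
    2).symm) 0 0, .rule (red_phase_euler hE) 0 0, .rule HH_KK.symm 3 0, .rule dual_phase.symm 2 0,
    .rule HHH 1 0, .rule (cap_phase 1 1) 2 0, .right 1] rfl rfl

theorem link_K_cap : Valid (env aux) 2 2 [G 1 2 0, K 1, G 2 1 1] [G 1 2 0, G 1 2 2, S 1, K 2, G 2
    0 2] :=
  run_valid [.rule bend_cap_left.symm 2 1, .rule green_cocomm.symm 2 2, .rule (cross_right (.green
    0 0) 2 0 (by decide) (by decide)) 4 1, .rule SS 3 2, .right 1, .rule (cross_right .inv 1 1 (by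
    decide) (by decide)) 2 1] rfl rfl

/-- Polarisation ω^{(x+y)²} = ω^{x²}ω^{y²}ω^{2xy}, with the `H†`-link as ω^{2xy}. Splitting the
phase into a copy and a counit and applying the bialgebra rule reduces it to `euler_mul_counit`. -/
theorem euler_mul_phase (hE : EulerDecomposition E) : Valid (env aux) 2 1 [R 2 1 0, Gp 1 1 1 1 0]
    [Gp 1 1 1 1 0, Gp 1 1 1 1 1, G 1 2 0, K 1, G 2 1 1, R 2 1 0] :=
  run_valid [.rule (phase_split 1 1) 1 0, .rule bialg 0 0, .rule (euler_mul_counit hE) 4 1, .right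
    3, .rule ((cross_right (.green 1 1) 1 1 (by decide) (by decide)).symm) 2 1, .right 0, .rule
    ((phase_copy_right 1 1).symm) 1 0, .left 0, .left 1, .right 4, .right 3, .rule
    ((phase_copy_right 1 1).symm) 2 2, .right 1, .right 5, .right 6, .rule link_K_cap.symm 2 0]
    rfl rfl

theorem euler_adder (hE : EulerDecomposition E) : Valid (env aux) 2 2 [G 1 2 0, R 2 1 1, Gp 1 1 1
    1 1] [Gp 1 1 1 1 0, Gp 1 1 1 1 1, G 1 2 0, K 1, G 2 1 1, G 1 2 0, R 2 1 1] :=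
  run_valid [.rule (euler_mul_phase hE) 1 1, .rule ((phase_copy_right 1 1).symm) 0 0, .right 1,
    .rule coassoc 2 0, .right 3, .right 4] rfl rfl

end QutritZX

namespace QutritZX
open Diagram Q

variable {E : Equations}

/-! ### Gates on some of the wires -/

/-- The endomorphisms of `n` wires, multiplied in diagram order. -/
instance (n : ℕ) : Monoid (Q E n n) where
  mul f g := f ≫ g
  one := Q.one n
  mul_assoc := Q.assoc
  one_mul := one_comp
  mul_one := comp_one

theorem mul_def {n : ℕ} (f g : Q E n n) : f * g = f ≫ g := rfl

theorem one_def (n : ℕ) : (1 : Q E n n) = Q.one n := rfl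

theorem comp_mul {m n : ℕ} (p : Q E m n) (f g : Q E n n) : p ≫ (f * g) = (p ≫ f) ≫ g :=
  (Q.assoc _ _ _).symm

theorem wire_comp_symm {m n : ℕ} (σ : Fin m ≃ Fin n) :
    (Q.wire σ ≫ Q.wire σ.symm : Q E m m) = Q.one m := by
  rw [Q.wire_comp, Equiv.self_trans_symm, wire_refl]

theorem wire_symm_comp {m n : ℕ} (σ : Fin m ≃ Fin n) :
    (Q.wire σ.symm ≫ Q.wire σ : Q E n n) = Q.one n := by
  rw [Q.wire_comp, Equiv.symm_trans_self, wire_refl]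

/-- The last `k` values are already taken, so injectivity forces the first block to be mapped to
itself. -/
theorem exists_sumCongr {r k : ℕ} (ρ : Fin (r + k) ≃ Fin (r + k))
    (h : ∀ i, ρ (Fin.natAdd r i) = Fin.natAdd r i) :
    ∃ ρ₀ : Fin r ≃ Fin r, ρ = finSumFinEquiv.symm.trans
      ((Equiv.sumCongr ρ₀ (Equiv.refl (Fin k))).trans finSumFinEquiv) := by
  have hf : ∀ i : Fin r, ∃ j : Fin r, ρ (Fin.castAdd k i) = Fin.castAdd k j := by
    intro i
    rcases hx : finSumFinEquiv.symm (ρ (Fin.castAdd k i)) with j | j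
    · exact ⟨j, by rw [Equiv.symm_apply_eq] at hx; simpa using hx⟩
    · rw [Equiv.symm_apply_eq, finSumFinEquiv_apply_right, ← h j] at hx
      have := congrArg Fin.val (ρ.injective hx)
      simp at this
      omega
  choose f hf using hf
  have inj : Function.Injective f := by
    intro i j hij
    have : ρ (Fin.castAdd k i) = ρ (Fin.castAdd k j) := by rw [hf, hf, hij]
    exact Fin.castAdd_injective r k (ρ.injective this)
  refine ⟨Equiv.ofBijective f (Finite.injective_iff_bijective.1 inj), ?_⟩
  ext i
  refine Fin.addCases (fun i => ?_) (fun i => ?_) i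
  · simp [hf]
  · simp [h]

theorem exists_wire_tensor {r k : ℕ} (ρ : Fin (r + k) ≃ Fin (r + k))
    (h : ∀ i, ρ (Fin.natAdd r i) = Fin.natAdd r i) :
    ∃ ρ₀ : Fin r ≃ Fin r, (Q.wire ρ : Q E (r + k) (r + k)) = Q.wire ρ₀ ⊗ Q.one k := by
  obtain ⟨ρ₀, h⟩ := exists_sumCongr ρ h
  exact ⟨ρ₀, by rw [← wire_refl, Q.wire_tensor, h]⟩

/-- `g` on the last `k` wires, conjugated by a bijection of wires. -/
def place {n r k : ℕ} (σ : Fin n ≃ Fin (r + k)) (g : Q E k k) : Q E n n :=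
  Q.wire σ ≫ (Q.one r ⊗ g) ≫ Q.wire σ.symm

/-- Two such bijections differ by a permutation of the idle wires, which slides past the gate. Hence
only the positions of the active wires matter. -/
theorem place_congr {n r k : ℕ} {σ σ' : Fin n ≃ Fin (r + k)}
    (h : ∀ i, σ.symm (Fin.natAdd r i) = σ'.symm (Fin.natAdd r i)) (g : Q E k k) :
    place σ g = place σ' g := by
  obtain ⟨ρ₀, hρ⟩ := exists_wire_tensor (E := E) (σ.symm.trans σ') fun i => by simp [h]
  have e : (Q.wire σ ≫ Q.wire (σ.symm.trans σ') : Q E n (r + k)) = Q.wire σ' := by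
    rw [Q.wire_comp, ← Equiv.trans_assoc, Equiv.self_trans_symm, Equiv.refl_trans]
  have e' : (Q.wire (σ.symm.trans σ') ≫ Q.wire σ'.symm : Q E (r + k) n) = Q.wire σ.symm := by
    rw [Q.wire_comp, Equiv.trans_assoc, Equiv.self_trans_symm, Equiv.trans_refl]
  have c : (Q.one r ⊗ g) ≫ Q.wire (σ.symm.trans σ') =
      Q.wire (σ.symm.trans σ') ≫ (Q.one r ⊗ g) := by
    rw [hρ, interchange, interchange, one_comp, comp_one, one_comp, comp_one]
  rw [place, place, ← e', ← Q.assoc (Q.one r ⊗ g), c, Q.assoc, ← Q.assoc, e]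

theorem exists_equiv {n k : ℕ} (e : Fin k ↪ Fin n) :
    ∃ σ : Fin n ≃ Fin (n - k + k), ∀ i, σ (e i) = Fin.natAdd (n - k) i := by
  have hk : k ≤ n := by simpa using Fintype.card_le_of_embedding e
  let e' : Fin k → Fin (n - k + k) := fun i => Fin.cast (by omega) (e i)
  have he' : Function.Injective e' := fun i j h => e.injective (Fin.cast_injective _ h)
  have hf : Function.Injective (Fin.natAdd (n - k) : Fin k → Fin (n - k + k)) :=
    Fin.natAdd_injective _ _
  let τ := (Equiv.ofInjective e' he').symm.trans (Equiv.ofInjective _ hf)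
  refine ⟨(finCongr (by omega : n = n - k + k)).trans τ.extendSubtype, fun i => ?_⟩
  have hi : e' i ∈ Set.range e' := ⟨i, rfl⟩
  change τ.extendSubtype (e' i) = _
  rw [Equiv.extendSubtype_apply_of_mem _ _ hi]
  have : (⟨e' i, hi⟩ : Set.range e') = Equiv.ofInjective e' he' i := rfl
  rw [this]
  simp [τ]

/-- `g` on the wires `e 0, …, e (k - 1)`. -/
noncomputable def on {n k : ℕ} (e : Fin k ↪ Fin n) : Q E k k →* Q E n n where
  toFun g := place (exists_equiv e).choose g
  map_one' := by
    rw [place, one_def, one_tensor_one, one_comp, wire_comp_symm]; rfl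
  map_mul' f g := by
    have h : (Q.one (n - k) ⊗ (f ≫ g) : Q E _ _) = (Q.one _ ⊗ f) ≫ (Q.one _ ⊗ g) := by
      rw [interchange, one_comp]
    simp only [place, mul_def, h, Q.assoc]
    rw [← Q.assoc (Q.wire _) (Q.wire _), wire_symm_comp, one_comp]

theorem on_congr {n k : ℕ} {e e' : Fin k ↪ Fin n} (h : ∀ i, e i = e' i) (g : Q E k k) :
    on e g = on e' g := by
  rw [show e = e' from Function.Embedding.ext h]

/-- This makes the choice in `on` harmless: any bijection that sends the active wires to the end
computes it. -/
theorem on_eq_place {n r k : ℕ} (e : Fin k ↪ Fin n) (σ : Fin n ≃ Fin (r + k))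
    (h : ∀ i, σ (e i) = Fin.natAdd r i) (g : Q E k k) : on e g = place σ g := by
  have hn : n = r + k := by simpa using Fintype.card_congr σ
  obtain rfl : r = n - k := by omega
  refine place_congr (fun i => ?_) g
  rw [← h, Equiv.symm_apply_apply, h, ← (exists_equiv e).choose_spec i, Equiv.symm_apply_apply]

theorem conj_wire_heq {n a b : ℕ} (h : a = b) (τ : Fin n ≃ Fin a) {p : Q E a a} {q : Q E b b}
    (hpq : HEq p q) : Q.wire τ ≫ p ≫ Q.wire τ.symm =
      Q.wire (τ.trans (finCongr h)) ≫ q ≫ Q.wire (τ.trans (finCongr h)).symm := by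
  subst h
  cases hpq
  rfl

theorem place_one_tensor {n r s k : ℕ} (σ : Fin n ≃ Fin (r + (s + k))) (g : Q E k k) :
    place σ (Q.one s ⊗ g) = place (σ.trans (finCongr (Nat.add_assoc r s k).symm)) g := by
  have h : HEq (Q.one r ⊗ (Q.one s ⊗ g)) (Q.one (r + s) ⊗ g) := by
    rw [← one_tensor_one]; exact (tensor_assoc _ _ _).symm
  exact conj_wire_heq (Nat.add_assoc r s k).symm σ h

theorem place_place {n r k s l : ℕ} (σ : Fin n ≃ Fin (r + k)) (τ : Fin k ≃ Fin (s + l))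
    (g : Q E l l) : place σ (place τ g) = place (σ.trans ((finSumFinEquiv.symm.trans
      ((Equiv.sumCongr (Equiv.refl (Fin r)) τ).trans finSumFinEquiv)))) (Q.one s ⊗ g) := by
  have h : (Q.one r ⊗ (Q.wire τ ≫ (Q.one s ⊗ g) ≫ Q.wire τ.symm) : Q E _ _) =
      (Q.one r ⊗ Q.wire τ) ≫ (Q.one r ⊗ (Q.one s ⊗ g)) ≫ (Q.one r ⊗ Q.wire τ.symm) := by
    rw [interchange, interchange, one_comp, one_comp]
  rw [place, place, h, place, ← wire_refl, Q.wire_tensor, Q.wire_tensor]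
  simp only [Q.assoc]
  rw [Q.wire_comp, ← Q.assoc, Q.wire_comp]
  rfl

/-- Functoriality of placement. It transports identities proved on two or three wires to arbitrary
wires of a larger diagram. -/
theorem on_on {n k l : ℕ} (e : Fin k ↪ Fin n) (e' : Fin l ↪ Fin k) (g : Q E l l) :
    on e (on e' g) = on (e'.trans e) g := by
  obtain ⟨σ, hσ⟩ := exists_equiv e
  obtain ⟨τ, hτ⟩ := exists_equiv e'
  rw [on_eq_place e σ hσ, on_eq_place e' τ hτ, place_place, place_one_tensor]
  refine (on_eq_place _ _ (fun i => ?_) g).symm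
  simp only [Function.Embedding.trans_apply, Equiv.trans_apply, hσ]
  rw [finSumFinEquiv_symm_apply_natAdd]
  simp only [Equiv.sumCongr_apply, Sum.map_inr, hτ, finSumFinEquiv_apply_right]
  ext
  simp [Nat.add_assoc]

theorem on_castAdd {k l : ℕ} (g : Q E k k) : on (Fin.castAddEmb l) g = g ⊗ Q.one l := by
  rw [on_eq_place (r := l) (Fin.castAddEmb l) finAddFlip (fun i => by simp) g, place, ← Q.assoc,
    ← swap_natural, Q.assoc, wire_comp_symm, comp_one]

theorem on_natAdd {k l : ℕ} (g : Q E l l) : on (Fin.natAddEmb k) g = Q.one k ⊗ g := by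
  rw [on_eq_place (r := k) (Fin.natAddEmb k) (Equiv.refl _) (fun i => by simp) g, place,
    Equiv.refl_symm, wire_refl, one_comp, comp_one]

/-- Disjoint embeddings are the two blocks of one embedding, so the claim is the interchange law. -/
theorem on_commute {n k l : ℕ} {e : Fin k ↪ Fin n} {e' : Fin l ↪ Fin n}
    (h : ∀ i j, e i ≠ e' j) (f : Q E k k) (g : Q E l l) : Commute (on e f) (on e' g) := by
  let e'' : Fin (k + l) ↪ Fin n := ⟨Fin.append e e', Fin.append_injective_iff.2
    ⟨e.injective, e'.injective, h⟩⟩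
  have h₁ : on e f = on e'' (f ⊗ Q.one l) := by
    rw [← on_castAdd, on_on]; exact on_congr (fun i => by simp [e'']) f
  have h₂ : on e' g = on e'' (Q.one k ⊗ g) := by
    rw [← on_natAdd, on_on]; exact on_congr (fun i => by simp [e'']) g
  rw [h₁, h₂, Commute, SemiconjBy, ← map_mul, ← map_mul, mul_def, mul_def, interchange,
    interchange, one_comp, comp_one, one_comp, comp_one]

/-- The embedding of one wire. -/
def emb₁ {n : ℕ} (i : Fin n) : Fin 1 ↪ Fin n := ⟨fun _ => i, fun _ _ _ => Subsingleton.elim _ _⟩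

/-- The embedding of two wires. -/
def emb₂ {n : ℕ} (i j : Fin n) (h : i ≠ j) : Fin 2 ↪ Fin n :=
  ⟨![i, j], by
    intro a b
    fin_cases a <;> fin_cases b <;> simp [h, h.symm]⟩

/-- The embedding of three wires. -/
def emb₃ {n : ℕ} (i j k : Fin n) (hij : i ≠ j) (hik : i ≠ k) (hjk : j ≠ k) : Fin 3 ↪ Fin n :=
  ⟨![i, j, k], by
    intro a b
    fin_cases a <;> fin_cases b <;> simp [hij, hik, hjk, hij.symm, hik.symm, hjk.symm]⟩

/-- A one-wire gate on wire `i`. -/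
noncomputable def on₁ {n : ℕ} (i : Fin n) : Q E 1 1 →* Q E n n := on (emb₁ i)

/-- A two-wire gate on the wires `i ≠ j`, in this order. -/
noncomputable def on₂ {n : ℕ} (i j : Fin n) (h : i ≠ j) : Q E 2 2 →* Q E n n := on (emb₂ i j h)

theorem on_on₁ {n k : ℕ} (e : Fin k ↪ Fin n) (i : Fin k) (g : Q E 1 1) :
    on e (on₁ i g) = on₁ (e i) g := by
  rw [on₁, on_on]; rfl

theorem on_on₂ {n k : ℕ} (e : Fin k ↪ Fin n) (i j : Fin k) (h : i ≠ j) (g : Q E 2 2) :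
    on e (on₂ i j h g) = on₂ (e i) (e j) (e.injective.ne h) g := by
  rw [on₂, on_on, on₂]
  exact on_congr (fun a => by fin_cases a <;> rfl) g

theorem on_wire {n k : ℕ} (e : Fin k ↪ Fin n) (π : Fin k ≃ Fin k) (g : Q E k k) :
    on e (Q.wire π ≫ g ≫ Q.wire π.symm) = on (π.symm.toEmbedding.trans e) g := by
  have h : Q.wire π ≫ g ≫ Q.wire π.symm = on π.symm.toEmbedding g := by
    rw [on_eq_place (r := 0) π.symm.toEmbedding (π.trans (finCongr (Nat.zero_add k).symm))
      (fun i => by ext; simp) g, place]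
    exact conj_wire_heq (Nat.zero_add k).symm π (one_zero_tensor g).symm
  rw [h, on_on]

theorem on₁_commute {n : ℕ} {i j : Fin n} (h : i ≠ j) (f g : Q E 1 1) :
    Commute (on₁ i f) (on₁ j g) := on_commute (fun _ _ => h) f g

theorem on₁_on₂_commute {n : ℕ} {i j k : Fin n} (h : j ≠ k) (hj : i ≠ j) (hk : i ≠ k)
    (f : Q E 1 1) (g : Q E 2 2) : Commute (on₁ i f) (on₂ j k h g) :=
  on_commute (fun _ b => by fin_cases b; exacts [hj, hk]) f g

theorem on₂_on₂_commute {n : ℕ} {i j k l : Fin n} (h : i ≠ j) (h' : k ≠ l) (hik : i ≠ k)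
    (hil : i ≠ l) (hjk : j ≠ k) (hjl : j ≠ l) (f g : Q E 2 2) :
    Commute (on₂ i j h f) (on₂ k l h' g) :=
  on_commute (fun a b => by fin_cases a <;> fin_cases b; exacts [hik, hil, hjk, hjl]) f g

/-! ### Gates on two and three wires -/

theorem on₁_zero (g : Q E 1 1) : on₁ (0 : Fin 2) g = g ⊗ Q.one 1 := by
  rw [← on_castAdd, on₁]; exact on_congr (fun i => by fin_cases i; rfl) g

theorem on₁_one (g : Q E 1 1) : on₁ (1 : Fin 2) g = Q.one 1 ⊗ g := by
  rw [← on_natAdd, on₁]; exact on_congr (fun i => by fin_cases i; rfl) g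

theorem on_refl {k : ℕ} (g : Q E k k) : on (Function.Embedding.refl _) g = g := by
  have h := on_wire (Function.Embedding.refl (Fin k)) (Equiv.refl (Fin k)) g
  have h' := on_castAdd (l := 0) g
  rw [tensor_one_zero] at h'
  rw [← h']
  congr 1

theorem on₂_zero_one (g : Q E 2 2) : on₂ (0 : Fin 2) 1 (by decide) g = g := by
  refine Eq.trans ?_ (on_refl g)
  rw [on₂]; exact on_congr (fun i => by fin_cases i <;> rfl) g

theorem on₂_swap {n : ℕ} (i j : Fin n) (h : i ≠ j) (g : Q E 2 2) :
    on₂ j i h.symm g = on₂ i j h (mk E (swap 1 1) ≫ g ≫ mk E (swap 1 1)) := by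
  have hs : (finAddFlip : Fin (1 + 1) ≃ Fin (1 + 1)).symm = finAddFlip := by decide
  have := on_wire (emb₂ i j h) (finAddFlip : Fin (1 + 1) ≃ Fin (1 + 1)) g
  rw [hs] at this
  rw [on₂, on₂]
  exact Eq.trans (on_congr (fun a => by fin_cases a <;> rfl) g) this.symm

theorem on₂_zero_one_three (g : Q E 2 2) :
    on₂ (0 : Fin 3) 1 (by decide) g = g ⊗ Q.one 1 := by
  rw [← on_castAdd, on₂]; exact on_congr (fun i => by fin_cases i <;> rfl) g

theorem on₂_one_two_three (g : Q E 2 2) :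
    on₂ (1 : Fin 3) 2 (by decide) g = Q.one 1 ⊗ g := by
  rw [← on_natAdd, on₂]; exact on_congr (fun i => by fin_cases i <;> rfl) g

/-- Non-adjacent wires are reached by conjugating with a swap; this is the form in which the gate
can be written as a word. -/
theorem on₂_zero_two_three (g : Q E 2 2) : on₂ (0 : Fin 3) 2 (by decide) g =
    on₂ 0 1 (by decide) (mk E (swap 1 1)) * on₂ 1 2 (by decide) g *
      on₂ 0 1 (by decide) (mk E (swap 1 1)) := by
  have hw : on₂ (0 : Fin 3) 1 (by decide) (mk E (swap 1 1)) = Q.wire (Equiv.swap 0 1) := by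
    rw [on₂_zero_one_three, mk_swap, ← wire_refl, Q.wire_tensor]
    exact congrArg Q.wire (by decide)
  have := on_wire (Function.Embedding.refl (Fin 3)) (Equiv.swap 0 1) (on₂ 1 2 (by decide) g)
  rw [on_refl, on_on₂, Equiv.symm_swap] at this
  rw [hw, mul_def, mul_def, Q.assoc]
  exact this.symm

end QutritZX

namespace QutritZX
open Diagram Q

variable {E : Equations}

/-! ### Gates of the definitions as gates on wires -/

theorem mk_onWires {n : ℕ} {i j : Fin n} (h : i ≠ j) (g : Diagram 2 2) :
    mk E (onWires n g i j) = on₂ i j h (mk E g) := by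
  match n, i, j, h with
  | 0, i, _, _ => exact i.elim0
  | 1, i, j, h => exact absurd (Subsingleton.elim i j) h
  | k + 2, i, j, h =>
    refine Eq.trans (Q.assoc (Q.wire (toEnd i j)) (Q.one k ⊗ mk E g) (Q.wire (toEnd i j).symm))
      (on_eq_place (r := k) (emb₂ i j h) (toEnd i j) ?_ _).symm
    have hl : (Fin.natAdd k 0 : Fin (k + 2)) ≠ Fin.natAdd k 1 := by
      simp [Fin.ext_iff]
    have h0 : Equiv.swap i (Fin.natAdd k 0) j ≠ Fin.natAdd k 0 := by
      rw [Ne, Equiv.swap_apply_eq_iff, Equiv.swap_apply_right]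
      exact h.symm
    intro a
    fin_cases a
    · change Equiv.swap _ _ (Equiv.swap i _ i) = _
      rw [Equiv.swap_apply_left]
      exact Equiv.swap_apply_of_ne_of_ne h0.symm hl
    · exact Equiv.swap_apply_left _ _

theorem mk_tensorAll : ∀ (n : ℕ) (f : Fin n → Diagram 1 1),
    mk E (tensorAll n f) = ((List.finRange n).map fun v => on₁ v (mk E (f v))).prod
  | 0, _ => rfl
  | n + 1, f => by
    have h1 : mk E (tensorAll (n + 1) f) = (mk E (tensorAll n fun i => f i.castSucc) ⊗ Q.one 1) *
        (Q.one n ⊗ mk E (f (Fin.last n))) := by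
      rw [mul_def, interchange, comp_one, one_comp]; rfl
    rw [h1, ← on_castAdd, ← on_natAdd, mk_tensorAll n, List.finRange_succ_last, List.map_append,
      List.prod_append, map_list_prod, List.map_map, List.map_map]
    congr 1
    · congr 1
      exact List.map_congr_left fun v _ => on_on₁ _ _ _
    · simp only [List.map_cons, List.map_nil, List.prod_cons, List.prod_nil, mul_one]
      exact on_congr (fun i => by fin_cases i; rfl) _

/-! ### The state `|+⟩ ⊗ ⋯ ⊗ |+⟩` -/

theorem mk_plusState_add (r k : ℕ) :
    mk E (plusState (r + k)) = mk E (plusState r) ⊗ mk E (plusState k) := by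
  induction k with
  | zero => exact (tensor_one_zero _).symm
  | succ k ih =>
    change mk E (plusState (r + k)) ⊗ mk E (Z 0 1 0 0) = _
    rw [ih]
    exact eq_of_heq (Q.tensor_assoc (mk E (plusState r)) (mk E (plusState k)) (mk E (Z 0 1 0 0)))

theorem plusState_one : mk E (plusState 1) = mk E (Z 0 1 0 0) :=
  eq_of_heq (one_zero_tensor (mk E (Z 0 1 0 0)))

theorem plusState_two : mk E (plusState 2) = mk E (Z 0 1 0 0) ⊗ mk E (Z 0 1 0 0) := by
  rw [mk_plusState_add 1 1, plusState_one]

/-- Adjacent transpositions generate all permutations. Those that fix the last wire are handled by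
induction, and the last one by naturality of the swap on two green points. -/
theorem plusState_wire : ∀ (n : ℕ) (σ : Fin n ≃ Fin n),
    mk E (plusState n) ≫ Q.wire σ = mk E (plusState n)
  | 0, σ => by rw [Subsingleton.elim σ (Equiv.refl _), wire_refl, comp_one]
  | n + 1, σ => by
    have fix : ∀ σ : Fin (n + 1) ≃ Fin (n + 1), σ (Fin.last n) = Fin.last n →
        mk E (plusState (n + 1)) ≫ Q.wire σ = mk E (plusState (n + 1)) := by
      intro σ hσ
      obtain ⟨ρ, hρ⟩ := exists_wire_tensor (E := E) (r := n) (k := 1) σ fun i => by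
        rw [Subsingleton.elim i 0]; exact hσ
      rw [hρ, mk_plusState_add, interchange, plusState_wire n ρ, comp_one]
    have hmem : σ ∈ Submonoid.closure
        (Set.range fun i : Fin n => (Equiv.swap i.castSucc i.succ : Equiv.Perm (Fin (n + 1)))) := by
      rw [Equiv.Perm.mclosure_swap_castSucc_succ]; trivial
    induction hmem using Submonoid.closure_induction with
    | one => exact comp_one _
    | mul σ τ _ _ hσ hτ =>
      change _ ≫ Q.wire (τ.trans σ) = _
      rw [← Q.wire_comp, ← Q.assoc, hτ, hσ]
    | mem σ hσ =>
      obtain ⟨i, rfl⟩ := hσ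
      by_cases hi : i.succ = Fin.last n
      · match n, i, hi with
        | m + 1, i, hi =>
          obtain rfl : i = Fin.last m := Fin.succ_injective _ hi
          have hw : (Q.wire (Equiv.swap (Fin.last m).castSucc (Fin.last m).succ) :
              Q E (m + 1 + 1) (m + 1 + 1)) = Q.one m ⊗ Q.wire (finAddFlip (m := 1) (n := 1)) := by
            rw [← wire_refl, Q.wire_tensor]
            congr 1
            ext i
            refine Fin.addCases (m := m) (n := 2) (fun i => ?_) (fun i => ?_) i
            · rw [Equiv.swap_apply_of_ne_of_ne]
              · simp
              · simp [Fin.ext_iff, i.isLt.ne]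
              · simp [Fin.ext_iff]; omega
            · fin_cases i
              · change (Equiv.swap (Fin.last m).castSucc (Fin.last m).succ
                  (Fin.last m).castSucc).val = _
                rw [Equiv.swap_apply_left]
                simp
                rfl
              · change (Equiv.swap (Fin.last m).castSucc (Fin.last m).succ
                  (Fin.last m).succ).val = _
                rw [Equiv.swap_apply_right]
                simp
                rfl
          have hs : mk E (plusState 2) ≫ Q.wire (finAddFlip (m := 1) (n := 1)) =
              mk E (plusState 2) := by
            rw [plusState_two, swap_natural]
            have : (Q.wire finAddFlip : Q E (0 + 0) (0 + 0)) = Q.one 0 := by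
              rw [← wire_refl]; exact congrArg Q.wire (by decide)
            rw [this]
            exact one_comp _
          rw [hw]
          change mk E (plusState (m + 2)) ≫ _ = mk E (plusState (m + 2))
          rw [mk_plusState_add, interchange, hs, comp_one]
      · refine fix _ (Equiv.swap_apply_of_ne_of_ne ?_ (Ne.symm hi))
        exact (Fin.castSucc_lt_last i).ne'

theorem plusState_on {n k : ℕ} (e : Fin k ↪ Fin n) {g : Q E k k}
    (h : mk E (plusState k) ≫ g = mk E (plusState k)) :
    mk E (plusState n) ≫ on e g = mk E (plusState n) := by
  obtain ⟨σ, hσ⟩ := exists_equiv e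
  have hn : n = n - k + k := by simpa using Fintype.card_congr σ
  rw [on_eq_place e σ hσ, place]
  generalize n - k = r at *
  subst hn
  rw [← Q.assoc, ← Q.assoc, plusState_wire, mk_plusState_add, interchange, comp_one, h,
    ← mk_plusState_add, plusState_wire]

end QutritZX

namespace QutritZX
open Diagram Q Layer

variable {E : Equations}

/-! ### Controlled-Z gates, adders and phases -/

/-- The controlled-Z gate. -/
noncomputable def cz : Q E 2 2 := mk E (link had)

/-- The controlled adder: green on the first wire, red on the second wire. -/
noncomputable def adder : Q E 2 2 := mk E ((Z 1 2 0 0 ⊠ idn 1) ⨾ (idn 1 ⊠ X 2 1 0 0 :))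

/-- The green phase gate with phase `(2π/3) / (2π/3)`. -/
noncomputable def zz : Q E 1 1 := mk E (Z 1 1 (third 1) (third 1))

/-- The red phase gate with phase `(2π/3) / (2π/3)`. -/
noncomputable def xx : Q E 1 1 := mk E (X 1 1 (third 1) (third 1))

/-- The box `H`. -/
noncomputable def hh : Q E 1 1 := mk E had

/-- The box `H†`. -/
noncomputable def kk : Q E 1 1 := mk E hadInv

variable {aux : ℕ → ∀ m n : ℕ, Q E m n}

theorem den_link {h : Diagram 1 1} {k : Kind} (hk : Den (env aux) [⟨k, 1, 1, 0⟩] (mk E h)) :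
    Den (env aux) [G 1 2 0, ⟨k, 1, 1, 1⟩, G 2 1 1] (mk E (link h)) :=
  (((den_G 1 2).tensor (den_idn 1)).append ((den_idn 1).tensor (hk.tensor (den_idn 1)))).append
    ((den_idn 1).tensor (den_G 2 1))

theorem den_cz : Den (env aux) [G 1 2 0, H 1, G 2 1 1] (cz : Q E 2 2) := den_link den_H

theorem den_link_K : Den (env aux) [G 1 2 0, K 1, G 2 1 1] (mk E (link hadInv)) :=
  den_link den_K

theorem den_adder : Den (env aux) [G 1 2 0, R 2 1 1] (adder : Q E 2 2) :=
  ((den_G 1 2).tensor (den_idn 1)).append ((den_idn 1).tensor (den_R 2 1))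

theorem den_zz : Den (env aux) [Gp 1 1 1 1 0] (zz : Q E 1 1) := by
  have := den_green (aux := aux) 1 1 1 1; rwa [Nat.cast_one] at this

theorem den_xx : Den (env aux) [Rp 1 1 1 1 0] (xx : Q E 1 1) := by
  have := den_red (aux := aux) 1 1 1 1; rwa [Nat.cast_one] at this

theorem Den.mul {ρ : Env E} {n : ℕ} {W W' : Word} {f g : Q E n n} (h : Den ρ W f)
    (h' : Den ρ W' g) : Den ρ (W ++ W') (f * g) := h.append h'

theorem Den.on₁_zero {ρ : Env E} {W : Word} {g : Q E 1 1} (h : Den ρ W g) :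
    Den ρ W (on₁ (0 : Fin 2) g) := by
  rw [QutritZX.on₁_zero]
  simpa [shift] using h.tensor (.nil 1)

theorem Den.on₁_one {ρ : Env E} {W : Word} {g : Q E 1 1} (h : Den ρ W g) :
    Den ρ (shift 1 W) (on₁ (1 : Fin 2) g) := by
  rw [QutritZX.on₁_one]
  exact (Den.nil 1).tensor h

theorem Den.on₂_zero_one {ρ : Env E} {W : Word} {g : Q E 2 2} (h : Den ρ W g) :
    Den ρ W (on₂ (0 : Fin 3) 1 (by decide) g) := by
  rw [on₂_zero_one_three]
  simpa [shift] using h.tensor (.nil 1)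

theorem Den.on₂_one_two {ρ : Env E} {W : Word} {g : Q E 2 2} (h : Den ρ W g) :
    Den ρ (shift 1 W) (on₂ (1 : Fin 3) 2 (by decide) g) := by
  rw [on₂_one_two_three]
  exact (Den.nil 1).tensor h

theorem Den.on₂_zero_two {W : Word} {g : Q E 2 2} (h : Den (env aux) W g) :
    Den (env aux) ([S 0] ++ shift 1 W ++ [S 0]) (on₂ (0 : Fin 3) 2 (by decide) g) := by
  rw [on₂_zero_two_three]
  exact (den_S.on₂_zero_one.mul h.on₂_one_two).mul den_S.on₂_zero_one

/-- Trivial free boxes. -/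
noncomputable def noAux (E : Equations) : ℕ → ∀ m n : ℕ, Q E m n := fun _ m n => mk E (Z m n 0 0)

theorem hh_mul_kk : (hh * kk : Q E 1 1) = 1 := mk_eq.2 .H1

theorem kk_mul_hh : (kk * hh : Q E 1 1) = 1 := mk_eq.2 .H1'

theorem hh_pow_four : (hh : Q E 1 1) ^ 4 = 1 := by
  have h : (hh * hh : Q E 1 1) = kk * kk :=
    (HH_KK (aux := noAux E)).eq (den_H.append den_H) (den_K.append den_K)
  calc (hh : Q E 1 1) ^ 4 = hh * (hh * (hh * hh)) := by simp only [pow_succ, pow_zero, one_mul, mul_assoc]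
    _ = hh * (hh * kk) * kk := by rw [h]; simp only [mul_assoc]
    _ = 1 := by rw [hh_mul_kk, mul_one, hh_mul_kk]

theorem zz_sq : (zz : Q E 1 1) ^ 2 = mk E (Z 1 1 (third 2) (third 2)) := by
  rw [sq]
  exact (fuse (aux := noAux E) 1 1 0 1 0 1 1 1 1 2 2 (by decide) rfl rfl).eq (den_zz.mul den_zz)
    (by simpa using den_green 2 2 1 1)

theorem zz_pow_three : (zz : Q E 1 1) ^ 3 = 1 := by
  rw [pow_succ', zz_sq]
  exact (phase_inv (aux := noAux E) 1 1 2 2 rfl rfl).eq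
    (den_zz.mul (by simpa using den_green 2 2 1 1)) (.nil 1)

theorem mk_Z_third (k : ZMod 3) : mk E (Z 1 1 (third k) (third k)) = zz ^ k.val := by
  obtain rfl | rfl | rfl : k = 0 ∨ k = 1 ∨ k = 2 := by revert k; decide
  · rw [third_zero]; exact mk_eq.2 .S2
  · exact (pow_one _).symm
  · exact zz_sq.symm

theorem xx_eq : (xx : Q E 1 1) = kk * zz * hh :=
  (red_eq (aux := noAux E) 1 1 1 1).eq den_xx ((den_K.mul den_zz).mul den_H)

theorem mk_X_third (k : ZMod 3) : mk E (X 1 1 (third k) (third k)) = xx ^ k.val := by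
  have key : mk E (X 1 1 (third k) (third k)) = kk * zz ^ k.val * hh := by
    rw [← mk_Z_third, ← ZMod.natCast_zmod_val k]
    exact (red_eq (aux := noAux E) 1 1 k.val k.val).eq (den_red _ _ 1 1)
      ((den_K.mul (den_green _ _ 1 1)).mul den_H)
  rw [key, xx_eq]
  generalize k.val = m
  induction m with
  | zero => rw [pow_zero, pow_zero, mul_one, kk_mul_hh]
  | succ m ih =>
    rw [pow_succ _ m, pow_succ _ m, ← ih]
    calc kk * (zz ^ m * zz) * hh = kk * zz ^ m * 1 * zz * hh := by
          simp only [mul_one, mul_assoc]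
      _ = _ := by rw [← hh_mul_kk]; simp only [mul_assoc]

theorem hh_sq_zz : (hh * hh * zz : Q E 1 1) = zz * (hh * hh) :=
  (dual_phase (aux := noAux E)).eq ((den_H.mul den_H).mul den_zz) (den_zz.mul (den_H.mul den_H))

theorem cz_swap : (mk E (swap 1 1) ≫ cz ≫ mk E (swap 1 1) : Q E 2 2) = cz :=
  (link_symm (aux := noAux E)).eq (den_S.append (den_cz.append den_S)) den_cz

theorem cz_mul_link : (cz * mk E (link hadInv) : Q E 2 2) = 1 :=
  (link_H_K (aux := noAux E)).eq (den_cz.mul den_link_K) (.nil 2)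

theorem link_mul_cz : (mk E (link hadInv) * cz : Q E 2 2) = 1 :=
  (link_K_H (aux := noAux E)).eq (den_link_K.mul den_cz) (.nil 2)

theorem cz_zz_left : Commute (on₁ 0 zz) (cz : Q E 2 2) :=
  (link_phase_left (aux := noAux E)).eq (den_zz.on₁_zero.mul den_cz) (den_cz.mul den_zz.on₁_zero)

theorem cz_zz_right : Commute (on₁ 1 zz) (cz : Q E 2 2) :=
  (link_phase_right (aux := noAux E)).eq (den_zz.on₁_one.mul den_cz) (den_cz.mul den_zz.on₁_one)

theorem dual_link_eq :
    (on₁ 0 (hh * hh) * cz * on₁ 0 (hh * hh) : Q E 2 2) = mk E (link hadInv) :=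
  (dual_link (aux := noAux E)).eq
    (((den_H.mul den_H).on₁_zero.mul den_cz).mul (den_H.mul den_H).on₁_zero) den_link_K

/-- H² negates the basis labels, so conjugating by it on one wire inverts the controlled-Z gate. -/
theorem dual_cz_left : (on₁ 0 (hh * hh) * cz * on₁ 0 (hh * hh) * cz : Q E 2 2) = 1 := by
  rw [dual_link_eq, link_mul_cz]

theorem dual_cz_right : (on₁ 1 (hh * hh) * cz * on₁ 1 (hh * hh) * cz : Q E 2 2) = 1 := by
  have h := congrArg (on₂ (1 : Fin 2) 0 (by decide)) (dual_cz_left (E := E))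
  have hs : (on₂ (1 : Fin 2) 0 (by decide) cz : Q E 2 2) = cz := by
    rw [on₂_swap 0 1 (by decide), cz_swap, on₂_zero_one]
  have h₁ (g : Q E 1 1) : on₂ (1 : Fin 2) 0 (by decide) (on₁ (0 : Fin 2) g) = on₁ 1 g :=
    on_on₁ _ _ _
  rwa [map_mul, map_mul, map_mul, h₁, hs, map_one] at h

theorem adder_eq : (adder : Q E 2 2) = on₁ 1 hh * cz * on₁ 1 kk :=
  ((link_conj_had (aux := noAux E)).eq ((den_H.on₁_one.mul den_cz).mul den_K.on₁_one)
    den_adder).symm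

theorem plus_adder : mk E (plusState 2) ≫ adder = mk E (plusState 2) := by
  have h : Den (env (noAux E)) [G 0 1 0, G 0 1 1] (mk E (plusState 2)) := by
    rw [plusState_two]; exact (den_G 0 1).tensor (den_G 0 1)
  exact (QutritZX.adder_plus (aux := noAux E)).eq (h.append den_adder) h

theorem plus_xx : mk E (plusState 1) ≫ xx = mk E (plusState 1) := by
  rw [plusState_one]
  exact (red_phase_plus (aux := noAux E)).eq ((den_G 0 1).append den_xx) (den_G 0 1)

theorem adder_zz (hE : EulerDecomposition E) : (adder * on₁ 1 zz : Q E 2 2) =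
    on₁ 0 zz * on₁ 1 zz * mk E (link hadInv) * adder :=
  (euler_adder (aux := noAux E) hE).eq (den_adder.mul den_zz.on₁_one)
    (((den_zz.on₁_zero.mul den_zz.on₁_one).mul den_link_K).mul den_adder)

theorem cz_cz : Commute (on₂ 0 1 (by decide) cz) (on₂ 1 2 (by decide) cz : Q E 3 3) :=
  (link_comm (aux := noAux E)).eq (den_cz.on₂_zero_one.mul den_cz.on₂_one_two)
    (den_cz.on₂_one_two.mul den_cz.on₂_zero_one)

theorem adder_cz : (on₂ 0 1 (by decide) adder * on₂ 1 2 (by decide) cz : Q E 3 3) =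
    on₂ 1 2 (by decide) cz * on₂ 0 2 (by decide) cz * on₂ 0 1 (by decide) adder :=
  (adder_link (aux := noAux E)).eq (den_adder.on₂_zero_one.mul den_cz.on₂_one_two)
    ((den_cz.on₂_one_two.mul den_cz.on₂_zero_two).mul den_adder.on₂_zero_one)

/-! ### Consequences on two wires -/

/-- The hypothesis says that the conjugate of y by u is x·y·l⁻¹. Cubing this product of commuting
factors leaves only l⁻³. -/
theorem units_pow_three_eq_one {M : Type*} [Monoid M] {u l : Mˣ} {x y : M} (hx : x ^ 3 = 1)
    (hy : y ^ 3 = 1) (hxy : Commute x y) (hxl : Commute x l) (hyl : Commute y l)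
    (h : u * y = x * y * ↑l⁻¹ * u) : (l : M) ^ 3 = 1 := by
  have e : (u * y * ↑u⁻¹ : M) = x * y * ↑l⁻¹ := by rw [h, Units.mul_inv_cancel_right]
  have e3 := congrArg (· ^ 3) e
  have h1 : Commute (x * y) (↑l⁻¹ : M) := (hxl.mul_left hyl).units_inv_right
  simp only [Units.conj_pow, hx, hy, mul_one, Units.mul_inv, h1.mul_pow, hxy.mul_pow, one_mul]
    at e3
  have e4 : l⁻¹ ^ 3 = 1 := by ext; rw [Units.val_pow_eq_pow_val, ← e3, Units.val_one]
  rw [inv_pow, inv_eq_one] at e4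
  rw [← Units.val_pow_eq_pow_val, e4, Units.val_one]

/-- `H` as a unit. -/
noncomputable def hhUnit (E : Equations) : (Q E 1 1)ˣ := ⟨hh, kk, hh_mul_kk, kk_mul_hh⟩

/-- The controlled-Z gate as a unit. -/
noncomputable def czUnit (E : Equations) : (Q E 2 2)ˣ :=
  ⟨cz, mk E (link hadInv), cz_mul_link, link_mul_cz⟩

/-- The adder as a unit. -/
noncomputable def adderUnit (E : Equations) : (Q E 2 2)ˣ :=
  Units.map (on₁ 1) (hhUnit E) * czUnit E * (Units.map (on₁ 1) (hhUnit E))⁻¹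

theorem adderUnit_val : (adderUnit E : Q E 2 2) = adder := adder_eq.symm

theorem cz_pow_three (hE : EulerDecomposition E) : (cz : Q E 2 2) ^ 3 = 1 := by
  have hz (i : Fin 2) : (on₁ i zz : Q E 2 2) ^ 3 = 1 := by
    rw [← map_pow, zz_pow_three, map_one]
  refine units_pow_three_eq_one (l := czUnit E) (u := adderUnit E) (hz 0) (hz 1)
    (on₁_commute (by decide) _ _) cz_zz_left cz_zz_right ?_
  rw [adderUnit_val]
  exact adder_zz hE

theorem mk_link_hadInv (hE : EulerDecomposition E) : mk E (link hadInv) = cz ^ 2 := by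
  have h := cz_pow_three hE
  calc mk E (link hadInv) = mk E (link hadInv) * (cz * cz ^ 2) := by
        rw [← pow_succ', h, mul_one]
    _ = cz ^ 2 := by rw [← mul_assoc, link_mul_cz, one_mul]

theorem mk_edge (hE : EulerDecomposition E) (k : ZMod 3) : mk E (edge k) = cz ^ k.val := by
  obtain rfl | rfl | rfl : k = 0 ∨ k = 1 ∨ k = 2 := by revert k; decide
  · rfl
  · exact (pow_one _).symm
  · exact mk_link_hadInv hE

theorem adder_pow_three (hE : EulerDecomposition E) : (adder : Q E 2 2) ^ 3 = 1 := by
  have h : adderUnit E ^ 3 = 1 := by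
    rw [adderUnit, conj_pow, show czUnit E ^ 3 = 1 from Units.ext (cz_pow_three hE), mul_one,
      mul_inv_cancel]
  rw [← adderUnit_val, ← Units.val_pow_eq_pow_val, h, Units.val_one]

/-- Here l is the controlled-Z gate, q and p are the phases on target and control, and h is H on the
target, so that h·l·h⁻¹ is the adder. Conjugating polarisation by h turns q into a red phase; the
inverse gate that appears is removed with `hd`. -/
theorem conj_phase_swap {G : Type*} [Group G] {h l p q : G} (h4 : h ^ 4 = 1)
    (hd : h * h * l * (h * h) * l = 1) (hph : Commute p h) (hpq : Commute p q)
    (e : h * l * h⁻¹ * q = p * q * l⁻¹ * (h * l * h⁻¹)) :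
    l * (h⁻¹ * q * h) = h⁻¹ * q * h * p * (h * l * h⁻¹) * l := by
  have h3 : h * h * h = h⁻¹ := by rw [eq_inv_iff_mul_eq_one, ← h4]; simp only [pow_succ, pow_zero, one_mul]
  have hl : l⁻¹ = h * h * l * (h * h) := (eq_inv_of_mul_eq_one_left hd).symm
  calc l * (h⁻¹ * q * h) = h⁻¹ * (h * l * h⁻¹ * q) * h := by group
    _ = h⁻¹ * (p * q) * l⁻¹ * h * l := by rw [e]; group
    _ = h⁻¹ * q * p * h * h * l * (h * h * h) * l := by rw [hl, hpq.eq]; simp only [mul_assoc]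
    _ = h⁻¹ * q * (p * h) * h * l * h⁻¹ * l := by rw [h3]; simp only [mul_assoc]
    _ = _ := by rw [hph.eq]; simp only [mul_assoc]

/-- Conjugation by the involution d inverts the controlled-Z gate and the adder and fixes both
phases; it carries the identity for l to the one for l⁻¹. -/
theorem conj_phase_swap_inv {G : Type*} [Group G] {d l x p a : G} (h2 : d * d = 1)
    (hl : d * l * d * l = 1) (ha : d * a * d * a = 1) (hx : Commute d x) (hp : Commute d p)
    (e : l * x = x * p * a * l) : l⁻¹ * x = x * p * a⁻¹ * l⁻¹ := by
  have hd : d⁻¹ = d := inv_eq_of_mul_eq_one_left h2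
  rw [← eq_inv_of_mul_eq_one_left hl, ← eq_inv_of_mul_eq_one_left ha]
  calc d * l * d * x = d * (l * x) * d := by rw [mul_assoc _ d, hx.eq]; simp only [mul_assoc]
    _ = d * (x * p) * a * 1 * l * d := by rw [e]; simp only [mul_assoc, one_mul]
    _ = _ := by rw [(hx.mul_right hp).eq, ← h2]; simp only [mul_assoc]

/-- The green phase gate as a unit. -/
noncomputable def zzUnit (E : Equations) : (Q E 1 1)ˣ := Units.ofPowEqOne zz 3 zz_pow_three (by decide)

theorem cz_xx_units (hE : EulerDecomposition E) :
    let h := Units.map (on₁ (1 : Fin 2)) (hhUnit E)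
    let q := Units.map (on₁ (1 : Fin 2)) (zzUnit E)
    let p := Units.map (on₁ (0 : Fin 2)) (zzUnit E)
    let l := czUnit E
    l * (h⁻¹ * q * h) = h⁻¹ * q * h * p * (h * l * h⁻¹) * l ∧
      l⁻¹ * (h⁻¹ * q * h) = h⁻¹ * q * h * p * (h * l * h⁻¹)⁻¹ * l⁻¹ := by
  intro h q p l
  have hc (f g : (Q E 1 1)ˣ) : Commute (Units.map (on₁ (0 : Fin 2)) f)
      (Units.map (on₁ (1 : Fin 2)) g) := Units.ext (on₁_commute (by decide) _ _)
  have e := conj_phase_swap (h := h) (l := l) (p := p) (q := q) ?_ ?_ (hc _ _) (hc _ _) ?_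
  · refine ⟨e, conj_phase_swap_inv (d := Units.map (on₁ (0 : Fin 2)) (hhUnit E * hhUnit E))
      ?_ ?_ ?_ ?_ ?_ e⟩
    · ext
      change on₁ 0 (hh * hh) * on₁ 0 (hh * hh) = _
      rw [← map_mul, ← mul_assoc, Units.val_one, ← map_one (on₁ 0), ← hh_pow_four]
      simp only [pow_succ, pow_zero, one_mul]
    · ext
      exact dual_cz_left
    · have hd := hc (hhUnit E * hhUnit E) (hhUnit E)
      have e2 : (Units.map (on₁ (0 : Fin 2)) (hhUnit E * hhUnit E)) * l *
        (Units.map (on₁ (0 : Fin 2)) (hhUnit E * hhUnit E)) * l = 1 := Units.ext dual_cz_left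
      generalize Units.map (on₁ (0 : Fin 2)) (hhUnit E * hhUnit E) = d at *
      change Commute d h at hd
      calc _ = d * h * l * (h⁻¹ * d) * h * l * h⁻¹ := by simp only [mul_assoc]
        _ = h * (d * l * d * l) * h⁻¹ := by
          rw [hd.eq, ← hd.inv_right.eq]; simp only [mul_assoc, inv_mul_cancel_left]
        _ = 1 := by rw [e2]; group
    · exact (((hc _ _).inv_right).mul_right (hc _ _)).mul_right (hc _ _)
    · ext
      change on₁ 0 (hh * hh) * on₁ 0 zz = on₁ 0 zz * on₁ 0 (hh * hh)
      rw [← map_mul, ← map_mul, hh_sq_zz]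
  · ext
    change on₁ 1 hh ^ 4 = _
    rw [← map_pow, hh_pow_four, map_one, Units.val_one]
  · ext
    change on₁ 1 hh * on₁ 1 hh * cz * (on₁ 1 hh * on₁ 1 hh) * cz = 1
    rw [← map_mul, dual_cz_right]
  · ext
    have := adder_zz hE
    rw [← adderUnit_val] at this
    exact this

theorem xx_eq_conj : (on₁ 1 xx : Q E 2 2) =
    ((Units.map (on₁ (1 : Fin 2)) (hhUnit E))⁻¹ * Units.map (on₁ (1 : Fin 2)) (zzUnit E) *
      Units.map (on₁ (1 : Fin 2)) (hhUnit E) : (Q E 2 2)ˣ) := by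
  rw [xx_eq, map_mul, map_mul]; rfl

theorem cz_xx (hE : EulerDecomposition E) :
    (cz * on₁ 1 xx : Q E 2 2) = on₁ 1 xx * on₁ 0 zz * adder * cz := by
  rw [xx_eq_conj, ← adderUnit_val]
  exact congrArg Units.val (cz_xx_units hE).1

theorem units_inv_eq_sq {M : Type*} [Monoid M] {u : Mˣ} (h : (u : M) ^ 3 = 1) :
    ((u⁻¹ : Mˣ) : M) = (u : M) ^ 2 := by
  rw [Units.inv_eq_of_mul_eq_one_right]
  rw [← pow_succ', h]

theorem cz_sq_xx (hE : EulerDecomposition E) :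
    (cz ^ 2 * on₁ 1 xx : Q E 2 2) = on₁ 1 xx * on₁ 0 zz * adder ^ 2 * cz ^ 2 := by
  have h := congrArg Units.val (cz_xx_units hE).2
  simp only [Units.val_mul] at h
  have h1 : (adder : Q E 2 2) ^ 2 = ((adderUnit E)⁻¹ : (Q E 2 2)ˣ) := by
    rw [units_inv_eq_sq, adderUnit_val]
    rw [adderUnit_val, adder_pow_three hE]
  have h2 : (cz : Q E 2 2) ^ 2 = ((czUnit E)⁻¹ : (Q E 2 2)ˣ) := (mk_link_hadInv hE).symm
  rw [h1, h2, xx_eq_conj]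
  exact h

end QutritZX

namespace QutritZX
open Diagram Q

variable {E : Equations}

/-! ### Powers of elements of order three -/

theorem pow_val_add {S : Type*} [Monoid S] {x : S} (h : x ^ 3 = 1) (a b : ZMod 3) :
    x ^ (a + b).val = x ^ a.val * x ^ b.val := by
  rw [← pow_add, ZMod.val_add, ← pow_eq_pow_mod _ h]

theorem pow_val_mul {S : Type*} [Monoid S] {x : S} (h : x ^ 3 = 1) (a b : ZMod 3) :
    x ^ (a * b).val = (x ^ a.val) ^ b.val := by
  rw [← pow_mul, ZMod.val_mul, ← pow_eq_pow_mod _ h]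

/-- The elements whose image commutes with `x`. -/
def commutant {S M : Type*} [Monoid S] [Monoid M] (ι : S →* M) (x : M) : Submonoid S :=
  (Submonoid.centralizer {x}).comap ι

theorem mem_commutant {S M : Type*} [Monoid S] [Monoid M] {ι : S →* M} {x : M} {s : S} :
    s ∈ commutant ι x ↔ Commute x (ι s) := by
  simp [commutant, Submonoid.mem_centralizer_iff, Commute, SemiconjBy]

/-! ### Local complementation in terms of gates -/

/-- The gates around a vertex `u`: diagonal gates `C v w` and `Z v`, given as elements of a
commutative monoid, adders `A v` from `v` to `u`, and the red phase gate `X` at `u`. -/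
structure Gates {n : ℕ} (p : Q E 0 n) (u : Fin n) (S : Type*) [CommMonoid S] where
  ι : S →* Q E n n
  C : Fin n → Fin n → S
  Z : Fin n → S
  A : Fin n → Q E n n
  X : Q E n n
  C_symm : ∀ v w, C v w = C w v
  C_pow : ∀ v w, C v w ^ 3 = 1
  Z_pow : ∀ v, Z v ^ 3 = 1
  plus_A : ∀ v, v ≠ u → p ≫ A v = p
  plus_X : p ≫ X = p
  A_C : ∀ v w, v ≠ u → w ≠ u → Commute (A v) (ι (C v w))
  A_mul_C : ∀ v w, v ≠ u → w ≠ u → w ≠ v → A v * ι (C u w) = ι (C u w * C v w) * A v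
  A_comm_C : ∀ v w x, v ≠ u → w ≠ u → x ≠ u → Commute (A v) (ι (C w x))
  A_comm_Z : ∀ v w, v ≠ u → w ≠ u → Commute (A v) (ι (Z w))
  X_comm_C : ∀ w x, w ≠ u → x ≠ u → Commute X (ι (C w x))
  X_comm_Z : ∀ w, w ≠ u → Commute X (ι (Z w))
  C_X : ∀ v (γ : ZMod 3), v ≠ u → ι (C u v ^ γ.val) * X =
    X * ι (Z v ^ (γ * γ).val) * A v ^ γ.val * ι (C u v ^ γ.val)

namespace Gates

variable {n : ℕ} {p : Q E 0 n} {u : Fin n} {S : Type*} [CommMonoid S] (g : Gates p u S)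
  {γ : Fin n → ZMod 3}

/-- The star with centre `u` and multiplicities `γ` on the vertices in `s`. -/
def star (γ : Fin n → ZMod 3) (s : Finset (Fin n)) : S := ∏ w ∈ s, g.C u w ^ (γ w).val

/-- The edges among the vertices in `s`, with multiplicities `f`. -/
def edges (f : Fin n → Fin n → ZMod 3) (s : Finset (Fin n)) : S :=
  ∏ v ∈ s, ∏ w ∈ s, if w < v then g.C v w ^ (f v w).val else 1

/-- The correction which arises when `X` passes the star. -/
def corr (γ : Fin n → ZMod 3) (s : Finset (Fin n)) : S :=
  (∏ v ∈ s, g.Z v ^ (γ v * γ v).val) * g.edges (fun v w => -(γ v * γ w)) s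

/-- The adder carries the label of v into u, so passing it through an edge uw creates an edge vw.
Read in the other direction, the multiplicity is −γ w. -/
theorem star_mul_A (hγ : γ u = 0) {v : Fin n} (hv : v ≠ u) {s : Finset (Fin n)} (hs : v ∉ s) :
    g.ι (g.star γ s) * g.A v =
      g.A v * g.ι (g.star γ s * ∏ w ∈ s, g.C v w ^ (-γ w).val) := by
  have key (w : Fin n) (hw : w ≠ v) : g.ι (g.C u w ^ (γ w).val) * g.A v =
      g.A v * g.ι (g.C u w ^ (γ w).val * g.C v w ^ (-γ w).val) := by
    by_cases hwu : w = u
    · simp [hwu, hγ]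
    have h1 (k : ℕ) : g.A v * g.ι (g.C u w) ^ k = g.ι ((g.C u w * g.C v w) ^ k) * g.A v := by
      rw [map_pow]
      exact (SemiconjBy.pow_right (g.A_mul_C v w hv hwu hw) k)
    have h2 : g.C v w ^ (γ w).val * g.C v w ^ (-γ w).val = 1 := by
      rw [← pow_val_add (g.C_pow v w), add_neg_cancel, ZMod.val_zero, pow_zero]
    have h3 : Commute (g.A v) (g.ι (g.C v w ^ (-γ w).val)) := by
      rw [map_pow]; exact (g.A_C v w hv hwu).pow_right _
    rw [map_mul, ← mul_assoc, map_pow, h1, mul_assoc, h3.eq, ← mul_assoc, ← map_mul, mul_pow,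
      mul_assoc, h2, mul_one, map_pow]
  induction s using Finset.induction_on with
  | empty => simp [star]
  | insert w s hw ih =>
    rw [Finset.mem_insert, not_or] at hs
    rw [star, Finset.prod_insert hw, Finset.prod_insert hw, map_mul, mul_assoc]
    rw [show g.ι (∏ w ∈ s, g.C u w ^ (γ w).val) * g.A v = _ from ih hs.2, ← mul_assoc,
      key w (Ne.symm hs.1), mul_assoc, ← map_mul, star]
    congr 2
    simp only [mul_assoc, mul_left_comm]

theorem star_mul_A_pow (hγ : γ u = 0) {v : Fin n} (hv : v ≠ u) {s : Finset (Fin n)} (hs : v ∉ s)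
    (k : ℕ) : g.ι (g.star γ s) * g.A v ^ k =
      g.A v ^ k * g.ι (g.star γ s * (∏ w ∈ s, g.C v w ^ (-γ w).val) ^ k) := by
  have hc : Commute (g.A v) (g.ι (∏ w ∈ s, g.C v w ^ (-γ w).val)) := by
    rw [← mem_commutant]
    refine prod_mem fun w _ => ?_
    by_cases hw : w = u
    · rw [hw, hγ, neg_zero, ZMod.val_zero, pow_zero]; exact one_mem _
    · exact pow_mem (mem_commutant.2 (g.A_C v w hv hw)) _
  induction k with
  | zero => simp
  | succ k ih =>
    rw [pow_succ, ← mul_assoc, ih, mul_assoc, mul_assoc, map_mul, mul_assoc, map_pow,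
      ← (hc.pow_right k).eq, ← mul_assoc (g.ι _) (g.A v), g.star_mul_A hγ hv hs, mul_assoc,
      ← map_pow, ← map_mul, mul_assoc, ← pow_succ']

/-- Every factor that involves u has exponent zero, so commutation with the gates away from u
suffices. -/
theorem corr_mem (hγ : γ u = 0) {x : Q E n n} (hC : ∀ w w', w ≠ u → w' ≠ u → Commute x (g.ι (g.C w w')))
    (hZ : ∀ w, w ≠ u → Commute x (g.ι (g.Z w))) (s : Finset (Fin n)) :
    g.corr γ s ∈ commutant g.ι x := by
  refine mul_mem (prod_mem fun v _ => ?_) (prod_mem fun v _ => prod_mem fun w _ => ?_)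
  · by_cases hv : v = u
    · rw [hv, hγ, mul_zero, ZMod.val_zero, pow_zero]; exact one_mem _
    · exact pow_mem (mem_commutant.2 (hZ v hv)) _
  · dsimp only
    split_ifs
    · by_cases hv : v = u
      · rw [hv, hγ, zero_mul, neg_zero, ZMod.val_zero, pow_zero]; exact one_mem _
      by_cases hw : w = u
      · rw [hw, hγ, mul_zero, neg_zero, ZMod.val_zero, pow_zero]; exact one_mem _
      exact pow_mem (mem_commutant.2 (hC v w hv hw)) _
    · exact one_mem _

theorem edges_insert (f : Fin n → Fin n → ZMod 3) {v : Fin n} {s : Finset (Fin n)}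
    (h : ∀ w ∈ s, w < v) :
    g.edges f (insert v s) = (∏ w ∈ s, g.C v w ^ (f v w).val) * g.edges f s := by
  have hv : v ∉ s := fun hv => lt_irrefl _ (h v hv)
  rw [edges, Finset.prod_insert hv, Finset.prod_insert hv, if_neg (lt_irrefl v), one_mul]
  congr 1
  · exact Finset.prod_congr rfl fun w hw => if_pos (h w hw)
  · refine Finset.prod_congr rfl fun w hw => ?_
    rw [Finset.prod_insert hv, if_neg (h w hw).not_gt, one_mul]

theorem plus_A_pow {v : Fin n} (hv : v ≠ u) (k : ℕ) : p ≫ g.A v ^ k = p := by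
  induction k with
  | zero => exact comp_one p
  | succ k ih => rw [pow_succ, comp_mul, ih, g.plus_A v hv]

/-- Induction over the neighbours in increasing order. The red phase first passes the edge to the
new vertex v, leaving a green phase and an adder. It is then absorbed by the smaller star, and the
adder is pulled up to the plus state, producing the edges from v to the earlier vertices. -/
theorem star_mul_X (hγ : γ u = 0) (s : Finset (Fin n)) :
    p ≫ (g.ι (g.star γ s) * g.X) = p ≫ g.ι (g.star γ s * g.corr γ s) := by
  induction s using Finset.induction_on_max with
  | empty => simp [star, corr, edges, g.plus_X, mul_def, one_def, one_comp, comp_one]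
  | insert v s h ih =>
    have hs : v ∉ s := fun hv => lt_irrefl _ (h v hv)
    have e1 : g.star γ (insert v s) = g.star γ s * g.C u v ^ (γ v).val := by
      rw [star, Finset.prod_insert hs, mul_comm]; rfl
    have e2 : g.corr γ (insert v s) = g.corr γ s * (g.Z v ^ (γ v * γ v).val *
        (∏ w ∈ s, g.C v w ^ (-γ w).val) ^ (γ v).val) := by
      have : ∏ w ∈ s, g.C v w ^ (-(γ v * γ w)).val =
          (∏ w ∈ s, g.C v w ^ (-γ w).val) ^ (γ v).val := by
        rw [← Finset.prod_pow]
        refine Finset.prod_congr rfl fun w _ => ?_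
        rw [← pow_val_mul (g.C_pow v w)]
        congr 2
        ring
      rw [corr, g.edges_insert _ h, Finset.prod_insert hs, this, corr]
      simp only [mul_assoc, mul_left_comm, mul_comm]
    by_cases hv : v = u
    · have h1 : (γ v).val = 0 := by rw [hv, hγ, ZMod.val_zero]
      have h2 : (γ v * γ v).val = 0 := by rw [hv, hγ, mul_zero, ZMod.val_zero]
      rw [e1, e2, h1, h2, pow_zero, pow_zero, pow_zero, mul_one, mul_one, mul_one, ih]
    have hc : Commute (g.A v) (g.ι (g.corr γ s * g.Z v ^ (γ v * γ v).val)) :=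
      mem_commutant.1 (mul_mem (g.corr_mem hγ (fun w x => g.A_comm_C v w x hv)
        (fun w => g.A_comm_Z v w hv) s) (pow_mem (mem_commutant.2 (g.A_comm_Z v v hv hv)) _))
    calc p ≫ (g.ι (g.star γ (insert v s)) * g.X)
        = p ≫ (g.ι (g.star γ s) * g.X * (g.ι (g.Z v ^ (γ v * γ v).val) * g.A v ^ (γ v).val *
            g.ι (g.C u v ^ (γ v).val))) := by
          rw [e1, map_mul, mul_assoc, g.C_X v _ hv]; simp only [mul_assoc]
      _ = p ≫ (g.ι (g.star γ s) * (g.ι (g.corr γ s * g.Z v ^ (γ v * γ v).val) * g.A v ^ (γ v).val) *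
            g.ι (g.C u v ^ (γ v).val)) := by
          rw [comp_mul, ih, ← comp_mul, map_mul, map_mul]; simp only [mul_assoc]
      _ = p ≫ (g.A v ^ (γ v).val * g.ι (g.star γ s * (∏ w ∈ s, g.C v w ^ (-γ w).val) ^ (γ v).val *
            (g.corr γ s * g.Z v ^ (γ v * γ v).val) * g.C u v ^ (γ v).val)) := by
          rw [← (hc.pow_left _).eq, ← mul_assoc, g.star_mul_A_pow hγ hv hs, mul_assoc, mul_assoc,
            ← map_mul, ← map_mul]
          simp only [mul_assoc]
      _ = _ := by
          rw [comp_mul, g.plus_A_pow hv, e1, e2]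
          congr 2
          simp only [mul_assoc, mul_left_comm, mul_comm]

theorem edges_add (f f' : Fin n → Fin n → ZMod 3) (s : Finset (Fin n)) :
    g.edges (fun v w => f v w + f' v w) s = g.edges f s * g.edges f' s := by
  simp only [edges, ← Finset.prod_mul_distrib]
  refine Finset.prod_congr rfl fun v _ => Finset.prod_congr rfl fun w _ => ?_
  split_ifs
  · exact pow_val_add (g.C_pow v w) _ _
  · exact (one_mul 1).symm

theorem edges_pow (f : Fin n → Fin n → ZMod 3) (s : Finset (Fin n)) (k : ZMod 3) :
    g.edges f s ^ k.val = g.edges (fun v w => f v w * k) s := by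
  simp only [edges, ← Finset.prod_pow]
  refine Finset.prod_congr rfl fun v _ => Finset.prod_congr rfl fun w _ => ?_
  split_ifs
  · exact (pow_val_mul (g.C_pow v w) _ _).symm
  · exact one_pow _

/-- The edges at `u` form a star. -/
theorem edges_star {f : Fin n → Fin n → ZMod 3} (hf : ∀ v w, f v w = f w v) (h0 : f u u = 0) :
    g.edges (fun v w => if v = u ∨ w = u then f v w else 0) Finset.univ =
      g.star (f u) Finset.univ := by
  have h (v w : Fin n) : (if w < v then
      g.C v w ^ (if v = u ∨ w = u then f v w else 0 : ZMod 3).val else 1) =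
      (if v = u then if w < u then g.C u w ^ (f u w).val else 1 else 1) *
      (if w = u then if u < v then g.C u v ^ (f u v).val else 1 else 1) := by
    by_cases hv : v = u
    · subst hv
      by_cases hw : w = v
      · simp [hw]
      · simp [hw]
    · by_cases hw : w = u
      · subst hw; simp [hv, g.C_symm v w, hf v w]
      · simp [hv, hw]
  simp only [edges, h, Finset.prod_mul_distrib, Finset.prod_ite_irrel, Finset.prod_ite_eq', Finset.mem_univ, if_true,
    Finset.prod_const_one]
  rw [← Finset.prod_mul_distrib]
  refine Finset.prod_congr rfl fun w _ => ?_
  rcases lt_trichotomy w u with hw | rfl | hw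
  · simp [hw, hw.not_gt]
  · simp [h0]
  · simp [hw, hw.not_gt]

/-- The edges away from u commute with the red phase, so only the star at u matters. The correction
lies away from u as well, hence it accumulates unchanged with each factor. -/
theorem edges_mul_X_pow {f : Fin n → Fin n → ZMod 3} (hf : ∀ v w, f v w = f w v) (h0 : f u u = 0)
    (k : ℕ) : p ≫ (g.ι (g.edges f Finset.univ) * g.X ^ k) =
      p ≫ g.ι (g.edges f Finset.univ * g.corr (f u) Finset.univ ^ k) := by
  obtain ⟨r, hr, hX⟩ : ∃ r, g.edges f Finset.univ = g.star (f u) Finset.univ * r ∧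
      Commute g.X (g.ι r) := by
    refine ⟨g.edges (fun v w => if v = u ∨ w = u then 0 else f v w) Finset.univ, ?_, ?_⟩
    · rw [← g.edges_star hf h0, ← g.edges_add]
      congr 1
      funext v w
      split_ifs <;> simp
    · rw [← mem_commutant]
      refine prod_mem fun v _ => prod_mem fun w _ => ?_
      dsimp only
      split_ifs with h1 h2
      · rw [ZMod.val_zero, pow_zero]; exact one_mem _
      · rw [not_or] at h2
        exact pow_mem (mem_commutant.2 (g.X_comm_C v w h2.1 h2.2)) _
      · exact one_mem _
  have hD := mem_commutant.1 (g.corr_mem h0 g.X_comm_C g.X_comm_Z Finset.univ)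
  induction k with
  | zero => simp
  | succ k ih =>
    have h1 : g.ι (g.edges f Finset.univ) * g.X =
        g.ι (g.star (f u) Finset.univ) * g.X * g.ι r := by
      rw [hr, map_mul, mul_assoc, ← hX.eq, mul_assoc]
    rw [pow_succ, ← mul_assoc, comp_mul, ih, ← comp_mul, map_mul, map_pow, mul_assoc,
      ← (hD.pow_right k).eq, ← mul_assoc, h1, mul_assoc, mul_assoc, ← mul_assoc (g.ι _) g.X,
      comp_mul, g.star_mul_X h0, ← comp_mul, ← map_pow, ← map_mul, ← map_mul, hr, pow_succ]
    congr 2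
    simp only [mul_assoc, mul_left_comm, mul_comm]

/-- Local complementation. -/
theorem edges_localComp {f : Fin n → Fin n → ZMod 3} (hf : ∀ v w, f v w = f w v) (h0 : f u u = 0)
    (l : ZMod 3) :
    p ≫ g.ι (g.edges (fun v w => f v w + l * (f v u * f u w)) Finset.univ) =
      p ≫ (g.ι (g.edges f Finset.univ) *
        (g.X ^ (-l).val * g.ι (∏ v, g.Z v ^ (l * (f u v * f u v)).val))) := by
  rw [← mul_assoc, comp_mul, g.edges_mul_X_pow hf h0, ← comp_mul, ← map_mul, corr, mul_pow,
    g.edges_pow, ← Finset.prod_pow, mul_assoc, mul_right_comm (∏ _, _), ← Finset.prod_mul_distrib]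
  -- The phases produced by the power −l of the red gate are exactly those that the explicit green
  -- phases undo.
  have h1 : ∏ v, (g.Z v ^ (f u v * f u v).val) ^ (-l).val *
      g.Z v ^ (l * (f u v * f u v)).val = 1 := by
    refine Finset.prod_eq_one fun v _ => ?_
    rw [← pow_val_mul (g.Z_pow v), ← pow_val_add (g.Z_pow v)]
    rw [show f u v * f u v * -l + l * (f u v * f u v) = 0 by ring, ZMod.val_zero, pow_zero]
  rw [h1, one_mul, ← g.edges_add]
  congr 3
  funext v w
  rw [hf v u]
  ring

end Gates
end QutritZX

namespace QutritZX
open Diagram Q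

variable {E : Equations} {n : ℕ}

/-! ### The gates around a vertex -/

/-- The controlled-Z gate on the wires `i` and `j`, if these are different. -/
noncomputable def czOn (E : Equations) (i j : Fin n) : Q E n n :=
  if h : i ≠ j then on₂ i j h cz else 1

theorem czOn_of_ne {i j : Fin n} (h : i ≠ j) : czOn E i j = on₂ i j h cz := dif_pos h

theorem czOn_self (i : Fin n) : czOn E i i = 1 := dif_neg (not_not.2 rfl)

theorem czOn_symm (i j : Fin n) : czOn E i j = czOn E j i := by
  by_cases h : i = j
  · rw [h]
  · rw [czOn_of_ne h, czOn_of_ne (Ne.symm h), on₂_swap i j h, cz_swap]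

theorem czOn_pow_three (hE : EulerDecomposition E) (i j : Fin n) : czOn E i j ^ 3 = 1 := by
  by_cases h : i = j
  · rw [h, czOn_self, one_pow]
  · rw [czOn_of_ne h, ← map_pow, cz_pow_three hE, map_one]

theorem czOn_commute_of_common {i j k : Fin n} (hij : i ≠ j) (hik : i ≠ k) (hjk : j ≠ k) :
    Commute (czOn E i j) (czOn E j k) := by
  have h := (cz_cz (E := E)).map (on (emb₃ i j k hij hik hjk))
  rw [on_on₂, on_on₂] at h
  rwa [czOn_of_ne hij, czOn_of_ne hjk]

/-- Pairs with a common wire are brought by symmetry into the chain form of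
`czOn_commute_of_common`; disjoint pairs commute by interchange. -/
theorem czOn_commute (i j k l : Fin n) : Commute (czOn E i j) (czOn E k l) := by
  have key : ∀ i j l : Fin n, Commute (czOn E i j) (czOn E j l) := by
    intro i j l
    by_cases hij : i = j
    · rw [hij, czOn_self]; exact Commute.one_left _
    by_cases hjl : j = l
    · rw [hjl, czOn_self]; exact Commute.one_right _
    by_cases hil : i = l
    · rw [hil, czOn_symm l j]
    · exact czOn_commute_of_common hij hil hjl
  by_cases hij : i = j
  · rw [hij, czOn_self]; exact Commute.one_left _
  by_cases hkl : k = l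
  · rw [hkl, czOn_self]; exact Commute.one_right _
  by_cases hjk : j = k
  · rw [hjk]; exact key _ _ _
  by_cases hjl : j = l
  · rw [hjl, czOn_symm k]; exact key _ _ _
  by_cases hik : i = k
  · rw [hik, czOn_symm k j]; exact key _ _ _
  by_cases hil : i = l
  · rw [hil, czOn_symm l j, czOn_symm k]; exact key _ _ _
  rw [czOn_of_ne hij, czOn_of_ne hkl]
  exact on₂_on₂_commute hij hkl hik hil hjk hjl _ _

theorem zz_czOn (i j k : Fin n) : Commute (on₁ i zz) (czOn E j k) := by
  by_cases hjk : j = k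
  · rw [hjk, czOn_self]; exact Commute.one_right _
  rw [czOn_of_ne hjk]
  by_cases hij : i = j
  · subst hij
    have h := (cz_zz_left (E := E)).map (on₂ i k hjk)
    rwa [on₂, on_on₁] at h
  by_cases hik : i = k
  · subst hik
    have h := (cz_zz_right (E := E)).map (on₂ j i hjk)
    rwa [on₂, on_on₁] at h
  exact on₁_on₂_commute hjk hij hik _ _

/-- The diagonal gates. -/
def diagonal (E : Equations) (n : ℕ) : Set (Q E n n) :=
  {f | (∃ i j, f = czOn E i j) ∨ ∃ i, f = on₁ i zz}

/-- This makes the generated monoid commutative, so that stars, edges and corrections can be handled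
as unordered finite products. -/
theorem diagonal_comm : ∀ f ∈ diagonal E n, ∀ g ∈ diagonal E n, f * g = g * f := by
  rintro _ (⟨i, j, rfl⟩ | ⟨i, rfl⟩) _ (⟨k, l, rfl⟩ | ⟨k, rfl⟩)
  · exact czOn_commute _ _ _ _
  · exact (zz_czOn _ _ _).symm
  · exact zz_czOn _ _ _
  · by_cases h : i = k
    · rw [h]
    · exact on₁_commute h _ _

/-- The monoid of diagonal gates. -/
def Diag (E : Equations) (n : ℕ) : Type := Submonoid.closure (diagonal E n)

instance : CommMonoid (Diag E n) :=
  { (inferInstance : Monoid (Submonoid.closure (diagonal E n))) with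
    mul_comm := (Submonoid.isMulCommutative_closure _ diagonal_comm).is_comm.comm }

/-- The inclusion of the diagonal gates. -/
def Diag.val : Diag E n →* Q E n n where
  toFun := Subtype.val
  map_one' := rfl
  map_mul' _ _ := rfl

theorem Diag.val_injective : Function.Injective (Diag.val (E := E) (n := n)) :=
  Subtype.val_injective

/-- The controlled-Z gate as a diagonal gate. -/
noncomputable def czDiag (E : Equations) (i j : Fin n) : Diag E n :=
  ⟨czOn E i j, Submonoid.subset_closure (Or.inl ⟨i, j, rfl⟩)⟩

/-- The green phase gate as a diagonal gate. -/
noncomputable def zzDiag (E : Equations) (i : Fin n) : Diag E n :=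
  ⟨on₁ i zz, Submonoid.subset_closure (Or.inr ⟨i, rfl⟩)⟩

/-- The adder on the wires `i` and `j`, if these are different. -/
noncomputable def adderOn (E : Equations) (i j : Fin n) : Q E n n :=
  if h : i ≠ j then on₂ i j h adder else 1

theorem adderOn_of_ne {i j : Fin n} (h : i ≠ j) : adderOn E i j = on₂ i j h adder := dif_pos h

theorem adderOn_eq {i j : Fin n} (h : i ≠ j) :
    adderOn E i j = on₁ j hh * czOn E i j * on₁ j kk := by
  rw [adderOn_of_ne h, adder_eq, map_mul, map_mul, czOn_of_ne h, on₂, on_on₁, on_on₁]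
  rfl

/-- A gate which commutes with the controlled-Z gate and does not touch `j` commutes with the
adder. -/
theorem adderOn_commute {i j : Fin n} (h : i ≠ j) {f : Q E n n} (hc : Commute (czOn E i j) f)
    (hj : ∀ g, Commute (on₁ j g) f) : Commute (adderOn E i j) f := by
  rw [adderOn_eq h]
  exact ((hj _).mul_left hc).mul_left (hj _)

theorem on₁_czOn_commute {i j k : Fin n} (hj : j ≠ i) (hk : k ≠ i) (g : Q E 1 1) :
    Commute (on₁ i g) (czOn E j k) := by
  by_cases h : j = k
  · rw [h, czOn_self]; exact Commute.one_right _
  · rw [czOn_of_ne h]; exact on₁_on₂_commute h hj.symm hk.symm _ _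

theorem adderOn_mul_czOn {u v w : Fin n} (hv : v ≠ u) (hw : w ≠ u) (hwv : w ≠ v) :
    adderOn E v u * czOn E u w = czOn E u w * czOn E v w * adderOn E v u := by
  have h := congrArg (on (emb₃ v u w hv hwv.symm hw.symm)) (adder_cz (E := E))
  simp only [map_mul, on_on₂] at h
  rw [adderOn_of_ne hv, czOn_of_ne hw.symm, czOn_of_ne hwv.symm]
  exact h

theorem czOn_pow_mul_xx (hE : EulerDecomposition E) {u v : Fin n} (hv : v ≠ u) (γ : ZMod 3) :
    czOn E u v ^ γ.val * on₁ u xx =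
      on₁ u xx * on₁ v zz ^ (γ * γ).val * adderOn E v u ^ γ.val * czOn E u v ^ γ.val := by
  have h₁ := congrArg (on₂ v u hv) (cz_xx hE)
  have h₂ := congrArg (on₂ v u hv) (cz_sq_xx hE)
  have e0 (g : Q E 1 1) : on₂ v u hv (on₁ 0 g) = on₁ v g := on_on₁ _ _ _
  have e1 (g : Q E 1 1) : on₂ v u hv (on₁ 1 g) = on₁ u g := on_on₁ _ _ _
  simp only [map_mul, map_pow, e0, e1, ← czOn_of_ne, ← adderOn_of_ne] at h₁ h₂
  rw [czOn_symm u v]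
  obtain rfl | rfl | rfl : γ = 0 ∨ γ = 1 ∨ γ = 2 := by revert γ; decide
  · simp
  · change _ ^ 1 * _ = _ * _ ^ 1 * _ ^ 1 * _ ^ 1
    simpa only [pow_one] using h₁
  -- In ℤ/3 one has 2 · 2 = 1, hence the first power of the green phase.
  · change _ ^ 2 * _ = _ * _ ^ 1 * _ ^ 2 * _ ^ 2
    simpa only [pow_one] using h₂

/-- The gates around the vertex `u`. -/
noncomputable def gates (hE : EulerDecomposition E) (u : Fin n) :
    Gates (mk E (plusState n)) u (Diag E n) where
  ι := Diag.val
  C := czDiag E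
  Z := zzDiag E
  A v := adderOn E v u
  X := on₁ u xx
  C_symm v w := Diag.val_injective (czOn_symm v w)
  C_pow v w := Diag.val_injective (czOn_pow_three hE v w)
  Z_pow v := Diag.val_injective (by
    change on₁ v zz ^ 3 = 1
    rw [← map_pow, zz_pow_three, map_one])
  plus_A v hv := by rw [adderOn_of_ne hv]; exact plusState_on _ plus_adder
  plus_X := plusState_on _ plus_xx
  A_C v w hv hw := adderOn_commute hv (czOn_commute _ _ _ _) fun g => on₁_czOn_commute hv hw g
  A_mul_C v w := adderOn_mul_czOn
  A_comm_C v w x hv hw hx :=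
    adderOn_commute hv (czOn_commute _ _ _ _) fun g => on₁_czOn_commute hw hx g
  A_comm_Z v w hv hw :=
    adderOn_commute hv (zz_czOn _ _ _).symm fun g => on₁_commute hw.symm g zz
  X_comm_C w x hw hx := on₁_czOn_commute hw hx _
  X_comm_Z w hw := on₁_commute hw.symm xx zz
  C_X v γ hv := czOn_pow_mul_xx hE hv γ

/-! ### Graph states and local rotations as products of gates -/

theorem mk_foldl {α : Type*} (f : α → Diagram n n) (l : List α) (d : Diagram 0 n) :
    mk E (l.foldl (fun d a => d ⨾ f a) d) = mk E d ≫ (l.map fun a => mk E (f a)).prod := by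
  induction l generalizing d with
  | nil => exact (comp_one _).symm
  | cons a l ih => rw [List.foldl_cons, ih, List.map_cons, List.prod_cons, comp_mul, mk_comp]

theorem mk_graphState (hE : EulerDecomposition E) (G : Multigraph n) (u : Fin n) :
    mk E (graphState G) =
      mk E (plusState n) ≫ Diag.val ((gates hE u).edges G.adj Finset.univ) := by
  have hl : ((pairs n).map fun p => mk E (onWires n (edge (G.adj p.1 p.2)) p.1 p.2)).prod =
      Diag.val ((pairs n).map fun p => czDiag E p.1 p.2 ^ (G.adj p.1 p.2).val).prod := by
    rw [map_list_prod, List.map_map]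
    congr 1
    refine List.map_congr_left fun p hp => ?_
    have h : p.1 ≠ p.2 := ne_of_lt (by simpa [pairs] using (List.mem_filter.1 hp).2)
    rw [mk_onWires h, mk_edge hE, map_pow, ← czOn_of_ne h, Function.comp, map_pow]
    rfl
  have hn : (pairs n).Nodup := ((List.nodup_finRange n).product (List.nodup_finRange n)).filter _
  rw [graphState, mk_foldl, hl, ← List.prod_toFinset _ hn]
  congr 2
  have hs : (pairs n).toFinset = Finset.univ.filter fun p : Fin n × Fin n => p.1 < p.2 := by
    ext ⟨i, j⟩
    simp [pairs, List.pair_mem_product]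
  -- The list has the smaller index first, `edges` the larger one; exchanging the two products and
  -- symmetry of the gates reconcile them.
  rw [hs, Finset.prod_filter, Fintype.prod_prod_type, Finset.prod_comm]
  refine Finset.prod_congr rfl fun v _ => Finset.prod_congr rfl fun w _ => ?_
  refine if_congr Iff.rfl ?_ rfl
  change czDiag E w v ^ (G.adj w v).val = czDiag E v w ^ (G.adj v w).val
  rw [G.symm v w, show czDiag E w v = czDiag E v w from Diag.val_injective (czOn_symm w v)]

/-- Gates on different wires commute, so the red gate can be moved to the front. The auxiliary claim
for duplicate-free lists ensures that it is collected only once. -/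
theorem mk_localRotation (u : Fin n) (a : Fin n → ZMod 3) :
    mk E (localRotation u a a) = on₁ u xx ^ (a u).val *
      Diag.val (∏ v, if v = u then 1 else zzDiag E v ^ (a v).val) := by
  have key : ∀ l : List (Fin n), l.Nodup →
      (l.map fun v => on₁ v (mk E (if v = u then X 1 1 (third (a v)) (third (a v))
        else Z 1 1 (third (a v)) (third (a v))))).prod =
      (if u ∈ l then on₁ u xx ^ (a u).val else 1) *
        Diag.val (l.map fun v => if v = u then 1 else zzDiag E v ^ (a v).val).prod := by
    intro l hl
    induction l with
    | nil => simp
    | cons v l ih =>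
      rw [List.nodup_cons] at hl
      rw [List.map_cons, List.prod_cons, ih hl.2, List.map_cons, List.prod_cons, map_mul]
      by_cases hv : v = u
      · subst hv
        rw [if_pos rfl, if_neg hl.1, if_pos List.mem_cons_self, if_pos rfl, mk_X_third, map_one,
          one_mul, map_pow]
      · rw [if_neg hv, if_neg hv, mk_Z_third, map_pow, map_pow]
        change on₁ v zz ^ _ * _ = _ * (on₁ v zz ^ _ * _)
        have hc : Commute (on₁ v zz ^ (a v).val)
            (if u ∈ l then on₁ u xx ^ (a u).val else 1 : Q E n n) := by
          split_ifs
          · exact (on₁_commute hv _ _).pow_pow _ _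
          · exact Commute.one_right _
        rw [← mul_assoc, hc.eq, mul_assoc]
        simp [List.mem_cons, Ne.symm hv]
  rw [localRotation, mk_tensorAll, key _ (List.nodup_finRange n), if_pos (List.mem_finRange u),
    Fin.prod_univ_def]

theorem localComplementationProperty_of_euler (hE : EulerDecomposition E) :
    LocalComplementationProperty E := by
  intro n G u l _
  -- These are the exponents of `Gates.edges_localComp`: −l for the red gate, and the squared
  -- multiplicity times l for the green gates. Both angles of each gate agree since the phases are
  -- quadratic.
  refine ⟨fun v => if v = u then -l else l * (G.adj u v * G.adj u v),
    fun v => if v = u then -l else l * (G.adj u v * G.adj u v), ?_⟩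
  rw [← mk_eq, mk_comp, mk_localRotation, mk_graphState hE _ u, mk_graphState hE _ u, if_pos rfl]
  have h := (gates hE u).edges_localComp G.symm (G.loopless u) l
  have e1 : (gates hE u).edges (G.localComp l u).adj Finset.univ =
      (gates hE u).edges (fun v w => G.adj v w + l * (G.adj v u * G.adj u w)) Finset.univ := by
    refine Finset.prod_congr rfl fun v _ => Finset.prod_congr rfl fun w _ => ?_
    split_ifs with hw
    · simp [Multigraph.localComp, hw.ne']
    · rfl
  have e2 : (∏ v, if v = u then 1 else
      zzDiag E v ^ (if v = u then -l else l * (G.adj u v * G.adj u v)).val) =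
      ∏ v, (gates hE u).Z v ^ (l * (G.adj u v * G.adj u v)).val := by
    refine Finset.prod_congr rfl fun v _ => ?_
    split_ifs with hv
    · simp [hv, G.loopless]
    · rfl
  rw [e1, e2]
  exact h.trans (comp_mul _ _ _)

end QutritZX

namespace QutritZX
open Diagram Q Layer

variable {E : Equations}

/-! ### Green nodes with arbitrary phases -/

/-- Free boxes which are green nodes with the given phases. -/
noncomputable def phases (E : Equations) (α β : ℕ → Real.Angle) : ℕ → ∀ m n : ℕ, Q E m n :=
  fun i m n => mk E (Z m n (α i) (β i))

variable {α β : ℕ → Real.Angle}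

theorem den_aux (i m n : ℕ) :
    Den (env (phases E α β)) [A i m n 0] (mk E (Z m n (α i) (β i))) := den_A i m n

theorem aux_fuse (i m n a j b : ℕ) (hj : 0 < j := by decide) :
    Valid (env (phases E α β)) (m + b) (a + n) [A i m (a + j) 0, G (j + b) n a]
      [A i (m + b) (a + n) 0] := by
  refine valid_of (.S1 m n a j b hj (α i) (β i) 0 0) ?_ ?_
  · exact (((den_aux i m (a + j)).tensor (den_idn b)).comp_finCongr (Nat.add_assoc a j b)).append
      ((den_idn a).tensor (den_G (j + b) n))
  · rw [add_zero, add_zero]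
    exact den_aux _ _ _

theorem fuse_aux (i m n a j b : ℕ) (hj : 0 < j := by decide) :
    Valid (env (phases E α β)) (m + b) (a + n) [G m (a + j) 0, A i (j + b) n a]
      [A i (m + b) (a + n) 0] := by
  refine valid_of (.S1 m n a j b hj 0 0 (α i) (β i)) ?_ ?_
  · exact (((den_G m (a + j)).tensor (den_idn b)).comp_finCongr (Nat.add_assoc a j b)).append
      ((den_idn a).tensor (den_aux i (j + b) n))
  · rw [zero_add, zero_add]
    exact den_aux _ _ _

theorem aux_fuse' (i m n a j b : ℕ) (hj : 0 < j := by decide) :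
    Valid (env (phases E α β)) (b + m) (n + a) [A i m (j + a) b, G (b + j) n 0]
      [A i (b + m) (n + a) 0] := by
  refine valid_of (.S1' m n a j b hj (α i) (β i) 0 0) ?_ ?_
  · exact (((den_idn b).tensor (den_aux i m (j + a))).comp_finCongr
      (Nat.add_assoc b j a).symm).append ((den_G (b + j) n).tensor (den_idn a))
  · rw [add_zero, add_zero]
    exact den_aux _ _ _

theorem fuse_aux' (i m n a j b : ℕ) (hj : 0 < j := by decide) :
    Valid (env (phases E α β)) (b + m) (n + a) [G m (j + a) b, A i (b + j) n 0]
      [A i (b + m) (n + a) 0] := by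
  refine valid_of (.S1' m n a j b hj 0 0 (α i) (β i)) ?_ ?_
  · exact (((den_idn b).tensor (den_G m (j + a))).comp_finCongr
      (Nat.add_assoc b j a).symm).append ((den_aux i (b + j) n).tensor (den_idn a))
  · rw [zero_add, zero_add]
    exact den_aux _ _ _

theorem red_point_aux_counit (i : ℕ) :
    Valid (env (phases E α β)) 0 0 [R 0 1 0, A i 1 0 0] [] :=
  valid_of (.scalar _ (red_point_green_counit_ne_zero _ _)) ((den_R 0 1).append (den_aux i 1 0))
    (den_idn 0)

/-- The scalar is 1 + 2e^{iθ}, and 2e^{iθ} has modulus 2, so it cannot be −1. -/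
theorem green_point_counit_ne_zero (θ : Real.Angle) :
    interp (Z 0 1 0 0 ⨾ Z 1 0 θ θ) ≠ 0 := by
  intro h
  have h0 := congrFun (congrFun h Fin.elim0) Fin.elim0
  rw [interp, Matrix.mul_apply, sum_one_wire] at h0
  have h1 : (1 : ℂ) + θ.toCircle + θ.toCircle = 0 := by
    simpa [interp, Z, sum_zmod_three, phase, show (1 : ZMod 3) ≠ 2 by decide,
      show (2 : ZMod 3) ≠ 1 by decide, show (2 : ZMod 3) ≠ 0 by decide,
      show (0 : ZMod 3) ≠ 2 by decide] using h0
  have h2 : (2 : ℂ) * θ.toCircle = -1 := by linear_combination h1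
  have h3 := congrArg norm h2
  rw [norm_mul, Circle.norm_coe] at h3
  norm_num at h3

theorem green_point_counit {aux : ℕ → ∀ m n : ℕ, Q E m n} (p : ℕ) :
    Valid (env aux) 0 0 [G 0 1 0, Gp p p 1 0 0] [] :=
  valid_of (.scalar _ (green_point_counit_ne_zero _)) ((den_G 0 1).append (den_green p p 1 0))
    (den_idn 0)

theorem shift_copy {aux : ℕ → ∀ m n : ℕ, Q E m n} :
    Valid (env aux) 1 2 [Rp 2 1 1 1 0, G 1 2 0] [G 1 2 0, Rp 2 1 1 1 0, Rp 2 1 1 1 1] := by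
  have h : Den (env aux) [Rp 2 1 1 1 0] (mk E (X 1 1 (third 2) (third 1))) := by
    simpa using den_red (aux := aux) 2 1 1 1
  exact valid_of .K1' (h.append (den_G 1 2)) ((den_G 1 2).append (h.tensor h))

end QutritZX

/-! ### From the three-vertex path to a normal form of H and the Euler decomposition -/

namespace QutritZX
open Diagram Q Layer

variable {E : Equations} {aux : ℕ → ∀ m n : ℕ, Q E m n} {α β : ℕ → Real.Angle}

theorem red_point_aux_0 : Valid (env (phases E α β)) 0 1 [R 0 1 0, A 0 1 1 0] [R 0 1 0] :=
  run_valid [.rule ((fuse_aux 0 1 0 1 1 0).symm) 1 0, .rule red_copy 0 0, .rule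
    (red_point_aux_counit 0) 1 1] rfl rfl

theorem red_point_aux_1 : Valid (env (phases E α β)) 0 1 [R 0 1 0, A 1 1 1 0] [R 0 1 0] :=
  run_valid [.rule ((fuse_aux 1 1 0 1 1 0).symm) 1 0, .rule red_copy 0 0, .rule
    (red_point_aux_counit 1) 1 1] rfl rfl

theorem green_point_red_counit : Valid (env aux) 0 0 [G 0 1 0, R 1 0 0] [] :=
  run_valid [.rule red_point_cap_right.symm 1 0, .right 0, .rule cap_unit_left 1 0, .rule
    (red_point_counit 0 0) 0 0] rfl rfl

theorem aux_cap_0 : Valid (env (phases E α β)) 2 0 [A 0 1 1 1, G 2 0 0] [A 0 1 1 0, G 2 0 0] :=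
  run_valid [.rule (aux_fuse' 0 1 0 0 1 1) 0 0, .rule ((aux_fuse 0 1 0 0 1 1).symm) 0 0] rfl rfl

theorem aux_cap_1 : Valid (env (phases E α β)) 2 0 [A 1 1 1 1, G 2 0 0] [A 1 1 1 0, G 2 0 0] :=
  run_valid [.rule (aux_fuse' 1 1 0 0 1 1) 0 0, .rule ((aux_fuse 1 1 0 0 1 1).symm) 0 0] rfl rfl

theorem aux_red_counit : Valid (env (phases E α β)) 1 0 [A 1 1 1 0, R 1 0 0] [R 1 0 0] :=
  run_valid [.rule red_point_cap_right.symm 1 0, .right 0, .rule aux_cap_1.symm 1 0, .rule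
    red_point_aux_1 0 1, .rule red_point_cap_right 0 0] rfl rfl

theorem link_red_counit : Valid (env aux) 2 1 [G 1 2 0, H 1, G 2 1 1, R 1 0 1] [R 1 0 1] :=
  run_valid [.rule red_counit_mul 2 1, .rule red_counit_H 1 1, .rule counit_right 0 0] rfl rfl

/-- A red counit on the third vertex deletes it together with its links. The remaining edge between
the other two vertices, with one wire bent up, is H. -/
theorem bend_triangle : Valid (env aux) 1 1 [G 0 1 1, G 0 1 2, G 0 1 3, G 1 2 1, H 2, G 2 1 2, S
    1, G 1 2 2, H 3, G 2 1 3, S 1, G 1 2 2, H 3, G 2 1 3, R 1 0 3, G 2 0 0] [H 0] :=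
  run_valid [.rule link_red_counit 11 2, .right 10, .rule link_red_counit 7 2, .left 2, .left 3,
    .left 4, .left 5, .rule green_point_red_counit 6 3, .rule SS 5 1, .right 0, .rule unit_copy 1
    1, .left 0, .left 1, .rule unit_right 2 2, .left 1, .rule snake_left 0 0] rfl rfl

theorem link_K_conj : Valid (env aux) 2 2 [G 1 2 0, H 1, G 2 1 1, K 1] [K 1, G 1 2 0, R 2 1 1] :=
  run_valid [.rule KH.symm 0 1, .left 1, .left 2, .rule ((red_eq' 2 1 0 0).symm) 2 1] rfl rfl

theorem adder_point : Valid (env aux) 0 2 [G 0 1 0, R 0 1 1, G 1 2 0, R 2 1 1] [G 0 2 0] :=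
  run_valid [.right 0, .rule unit_copy 1 0, .left 0, .rule red_unit_right 1 1] rfl rfl

theorem star_conj : Valid (env aux) 0 3 [G 0 1 0, G 0 1 1, G 0 1 2, S 0, G 1 2 1, H 2, G 2 1 2, S
    0, G 1 2 1, H 2, G 2 1 2, K 2] [G 0 1 0, G 0 1 1, R 0 1 2, S 0, G 1 2 1, R 2 1 2, S 0, G 1 2
    1, R 2 1 2] :=
  run_valid [.rule link_K_conj 8 1, .right 7, .rule link_K_conj 4 1, .left 2, .rule ((red_eq' 0 1
    0 0).symm) 3 2, .right 2] rfl rfl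

/-- After H† on the centre both links become adders into a red point, so the centre holds the sum of
the two outer labels. -/
theorem star_conj_eq : Valid (env aux) 0 3 [G 0 1 0, G 0 1 1, G 0 1 2, S 0, G 1 2 1, H 2, G 2 1 2,
    S 0, G 1 2 1, H 2, G 2 1 2, K 2] [G 0 2 0, G 0 2 1, R 2 1 2] :=
  run_valid [.rule star_conj 0 0, .right 1, .rule (cross_left (.green 0 0) 0 1 (by decide) (by
    decide)) 2 0, .left 1, .left 0, .rule adder_point 1 1, .right 0, .rule (cross_right (.green 0
    0) 0 1 (by decide) (by decide)) 1 0, .rule unit_copy 1 1] rfl rfl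

theorem bend_star : Valid (env aux) 1 2 [G 0 1 1, G 0 1 2, G 0 1 3, S 1, G 1 2 2, H 3, G 2 1 3, S
    1, G 1 2 2, H 3, G 2 1 3, K 3, G 2 0 0] [G 0 2 0, R 2 1 1] :=
  run_valid [.rule star_conj_eq 0 1, .left 2, .left 1, .rule snake_left 0 0] rfl rfl

theorem cup_turn : Valid (env (phases E α β)) 1 1 [G 0 2 0, R 2 1 1, A 2 1 0 1] [G 0 2 1, R 2 1 0,
    A 2 1 0 0] :=
  run_valid [.rule red_comm.symm 1 1, .rule cup_cross.symm 0 0, .rule cup_swap.symm 0 1, .rule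
    ((cross_right (.red 0 0) 2 1 (by decide) (by decide)).symm) 1 0, .rule ((cross_right (.aux 2)
    1 0 (by decide) (by decide)).symm) 2 0] rfl rfl

theorem rotation_tail : Valid (env (phases E α β)) 4 1 [A 0 1 1 1, A 1 1 1 2, K 3, A 2 1 1 3, H 3,
    R 1 0 3, G 2 0 0] [A 0 1 1 0, K 3, G 2 0 0, A 2 1 0 1, A 1 1 1 0] :=
  run_valid [.rule red_counit_H 4 3, .rule (aux_fuse 2 1 0 0 1 0) 3 3, .right 0, .right 1, .right
    2, .rule aux_cap_0 3 0, .right 0, .right 1, .left 2, .left 1, .left 0, .left 3, .left 2] rfl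
    rfl

/-- The bent triangle is H, and the bent path with its local gates is the matrix φ₀(x)φ₂(x+y)φ₁(y).
-/
theorem had_eq_of_state (h : Valid (env (phases E α β)) 0 3 [G 0 1 0, G 0 1 1, G 0 1 2, G 1 2 0, H
    1, G 2 1 1, S 0, G 1 2 1, H 2, G 2 1 2, S 0, G 1 2 1, H 2, G 2 1 2] [G 0 1 0, G 0 1 1, G 0 1
    2, S 0, G 1 2 1, H 2, G 2 1 2, S 0, G 1 2 1, H 2, G 2 1 2, A 0 1 1 0, A 1 1 1 1, K 2, A 2 1 1
    2, H 2]) : Valid (env (phases E α β)) 1 1 [H 0] [A 0 1 1 0, G 0 2 1, R 2 1 0, A 2 1 0 0, A 1 1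
    1 0] :=
  run_valid [.rule bend_triangle.symm 0 0, .rule h 0 1, .rule rotation_tail 11 0, .left 10, .left
    9, .left 8, .left 7, .left 6, .left 5, .left 4, .left 3, .left 2, .left 1, .left 0, .rule
    bend_star 1 0, .rule cup_turn 1 0] rfl rfl

/-- The column of H at basis label 0, where the first phase is absorbed and the sum reduces to y.
The next lemma takes the corresponding row. -/
theorem point_eq_of_had (h : Valid (env (phases E α β)) 1 1 [H 0] [A 0 1 1 0, G 0 2 1, R 2 1 0, A
    2 1 0 0, A 1 1 1 0]) : Valid (env (phases E α β)) 0 1 [G 0 1 0] [A 2 0 1 0, A 1 1 1 0] :=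
  run_valid [.rule red_point_H.symm 0 0, .rule h 1 0, .rule red_point_aux_0 0 0, .right 0, .rule
    red_unit_left 1 0, .rule (fuse_aux' 2 0 0 1 1 0) 0 0] rfl rfl

theorem counit_eq_of_had (h : Valid (env (phases E α β)) 1 1 [H 0] [A 0 1 1 0, G 0 2 1, R 2 1 0, A
    2 1 0 0, A 1 1 1 0]) : Valid (env (phases E α β)) 1 0 [G 1 0 0] [A 0 1 1 0, A 2 1 0 0] :=
  run_valid [.rule red_counit_H.symm 0 0, .rule h 0 0, .rule aux_red_counit 4 0, .right 3, .right
    2, .rule red_counit_cup_right 1 1, .rule red_unit_right 1 0] rfl rfl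

theorem red_point_mul_12 : Valid (env aux) 1 1 [Rp 1 2 0 1 0, R 2 1 0] [Rp 1 2 1 1 0] :=
  run_valid [.rule (red_eq 0 1 1 2) 0 0, .rule (red_eq 2 1 0 0) 2 0, .rule HK 1 0, .right 0, .rule
    (fuse 0 1 0 1 1 1 2 0 0 1 2 (by decide) rfl rfl) 1 0, .rule ((red_eq 1 1 1 2).symm) 0 0] rfl
    rfl

/-- The column at basis label 2, represented by the red point 1/2. Its image under H is the
character 2/1, and box 3 stands for the middle phase after the shift of its argument. -/
theorem phase_eq_of_had (h : Valid (env (phases E α β)) 1 1 [H 0] [A 0 1 1 0, G 0 2 1, R 2 1 0, A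
    2 1 0 0, A 1 1 1 0]) (h₁ : Valid (env (phases E α β)) 0 1 [Rp 1 2 0 1 0, A 0 1 1 0] [Rp 1 2 0
    1 0]) (h₂ : Valid (env (phases E α β)) 1 0 [Rp 1 2 1 1 0, A 2 1 0 0] [A 3 1 0 0]) : Valid (env
    (phases E α β)) 0 1 [Gp 2 1 0 1 0] [A 3 0 1 0, A 1 1 1 0] :=
  run_valid [.rule KH.symm 1 0, .rule ((red_eq' 0 1 1 2).symm) 0 0, .rule h 1 0, .rule h₁ 0 0,
    .right 0, .rule red_point_mul_12 1 0, .rule h₂ 1 0, .rule (fuse_aux' 3 0 0 1 1 0) 0 0] rfl rfl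

/-- Without phases the matrix φ₀(x)φ₂(x+y)φ₁(y) is constant, so H disconnects into a counit and a
point. -/
theorem had_eq_of_trivial (h : Valid (env (phases E α β)) 1 1 [H 0] [A 0 1 1 0, G 0 2 1, R 2 1 0,
    A 2 1 0 0, A 1 1 1 0]) (h₀ : Valid (env (phases E α β)) 1 1 [A 0 1 1 0] []) (h₁ : Valid (env
    (phases E α β)) 1 1 [A 1 1 1 0] []) (h₂ : Valid (env (phases E α β)) 1 1 [A 2 1 1 0] []) :
    Valid (env (phases E α β)) 1 1 [H 0] [G 1 0 0, G 0 1 0] :=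
  run_valid [.rule h 0 0, .rule h₀ 0 0, .rule h₁ 3 0, .rule ((aux_fuse 2 1 0 0 1 0).symm) 2 0,
    .rule h₂ 2 0, .rule red_mul_counit 1 0, .left 0, .rule cup_counit_left 1 0] rfl rfl

theorem id_eq_of_had (h : Valid (env aux) 1 1 [H 0] [G 1 0 0, G 0 1 0]) : Valid (env aux) 1 1 []
    [G 1 0 0, R 0 1 0] :=
  run_valid [.rule HK.symm 0 0, .rule h 0 0, .rule ((red_eq' 0 1 0 0).symm) 1 0] rfl rfl

theorem point_eq_red_point (h : Valid (env aux) 1 1 [H 0] [G 1 0 0, G 0 1 0]) : Valid (env aux) 0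
    1 [G 0 1 0] [R 0 1 0] :=
  run_valid [.rule (id_eq_of_had h) 1 0, .rule (green_point_counit 0) 0 0] rfl rfl

/-- Composing the disconnected H with its inverse disconnects the identity wire. Then the green and
red points coincide, and H is the same disconnected diagram as the identity. -/
theorem had_eq_id (h : Valid (env aux) 1 1 [H 0] [G 1 0 0, G 0 1 0]) : Valid (env aux) 1 1 [H 0]
    [] :=
  run_valid [.rule h 0 0, .rule (point_eq_red_point h) 1 0, .rule ((id_eq_of_had h).symm) 0 0] rfl
    rfl

theorem red_mul_phase_counit : Valid (env aux) 2 0 [R 2 1 0, Rp 1 1 1 0 0] [Rp 1 1 1 1 0, H 0, H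
    0, G 2 0 0] :=
  run_valid [.rule (red_eq 1 0 1 1) 1 0, .rule (red_eq 2 1 0 0) 0 0, .rule HK 3 0, .rule
    ((phase_counit 1 1).symm) 3 0, .rule ((phase_mul_left 1 1).symm) 2 0, .rule HK.symm 3 0, .rule
    HK.symm 6 0, .left 1, .left 2, .left 3, .rule ((red_eq 2 1 0 0).symm) 3 0, .rule ((red_eq 1 1
    1 1).symm) 0 0, .rule ((red_eq 1 0 0 0).symm) 2 0, .rule red_mul_red_counit 1 0] rfl rfl

theorem red_phase_inv : Valid (env aux) 1 1 [Rp 2 2 1 1 0, Rp 1 1 1 1 0] [] :=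
  run_valid [.rule (red_eq 1 1 2 2) 0 0, .rule (red_eq 1 1 1 1) 3 0, .rule HK 2 0, .rule
    (phase_inv 2 2 1 1 rfl rfl) 1 0, .rule KH 0 0] rfl rfl

/-- In the normal form the final phase cancels against the counit 2/2; the plain counit then
disconnects the cup, and a non-zero scalar is left. -/
theorem had_phase_counit (h : Valid (env aux) 1 1 [H 0] [Gp 1 1 1 1 0, G 0 2 1, R 2 1 0, Gp 2 2 1
    0 0, Gp 1 1 1 1 0]) : Valid (env aux) 1 0 [H 0, Gp 2 2 1 0 0] [Gp 1 1 1 0 0] :=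
  run_valid [.rule h 0 0, .rule (fuse 1 0 0 1 0 1 1 2 2 0 0 (by decide) rfl rfl) 4 0, .right 3,
    .right 2, .rule cup_counit_right 1 1, .rule green_point_mul_right 1 0, .rule
    (green_point_counit 2) 2 0, .rule (phase_counit 1 1) 0 0] rfl rfl

theorem phase_counit_eq (h : Valid (env aux) 1 1 [H 0] [Gp 1 1 1 1 0, G 0 2 1, R 2 1 0, Gp 2 2 1 0
    0, Gp 1 1 1 1 0]) : Valid (env aux) 1 0 [Gp 2 2 1 0 0] [Rp 1 1 1 0 0] :=
  run_valid [.rule KH.symm 0 0, .rule (had_phase_counit h) 1 0, .rule ((red_eq 1 0 1 1).symm) 0 0]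
    rfl rfl

theorem had_eq_red_phase (h : Valid (env aux) 1 1 [H 0] [Gp 1 1 1 1 0, G 0 2 1, R 2 1 0, Gp 2 2 1
    0 0, Gp 1 1 1 1 0]) : Valid (env aux) 1 1 [H 0] [Gp 1 1 1 1 0, Rp 1 1 1 1 0, H 0, H 0, Gp 1 1
    1 1 0] :=
  run_valid [.rule h 0 0, .rule (phase_counit_eq h) 3 0, .rule red_mul_phase_counit 2 0, .left 1,
    .left 2, .left 3, .rule snake_left 4 0] rfl rfl

theorem inv_eq_red_phase (h : Valid (env aux) 1 1 [H 0] [Gp 1 1 1 1 0, G 0 2 1, R 2 1 0, Gp 2 2 1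
    0 0, Gp 1 1 1 1 0]) : Valid (env aux) 1 1 [K 0] [Gp 1 1 1 1 0, Rp 1 1 1 1 0, Gp 1 1 1 1 0] :=
  run_valid [.rule HHH.symm 0 0, .rule (had_eq_red_phase h) 0 0, .rule dual_phase.symm 4 0, .rule
    HH_KK 4 0, .rule HK 3 0, .rule HK 2 0] rfl rfl

/-- The normal form first expresses H† by gates with phases 1/1; inverting those gates gives H with
phases 2/2. -/
theorem had_eq_euler (h : Valid (env aux) 1 1 [H 0] [Gp 1 1 1 1 0, G 0 2 1, R 2 1 0, Gp 2 2 1 0 0,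
    Gp 1 1 1 1 0]) : Valid (env aux) 1 1 [H 0] [Gp 2 2 1 1 0, Rp 2 2 1 1 0, Gp 2 2 1 1 0] :=
  run_valid [.rule ((phase_inv 2 2 1 1 rfl rfl).symm) 0 0, .rule red_phase_inv.symm 1 0, .rule
    ((phase_inv 2 2 1 1 rfl rfl).symm) 2 0, .rule ((inv_eq_red_phase h).symm) 3 0, .rule KH 3 0]
    rfl rfl

theorem cap_red_21 : Valid (env aux) 2 0 [Rp 2 1 1 1 1, G 2 0 0] [Rp 1 2 1 1 0, G 2 0 0] :=
  run_valid [.rule (red_eq 1 1 2 1) 0 1, .rule cap_H 2 0, .left 1, .rule ((cap_phase 2 1).symm) 2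
    0, .left 0, .left 1, .rule cap_K 2 0, .rule ((red_eq' 1 1 1 2).symm) 0 0] rfl rfl

theorem red_inv_21 : Valid (env aux) 1 1 [Rp 2 1 1 1 0, Rp 1 2 1 1 0] [] :=
  run_valid [.rule (red_eq 1 1 2 1) 0 0, .rule (red_eq 1 1 1 2) 3 0, .rule HK 2 0, .rule
    (phase_inv 2 1 1 2 rfl rfl) 1 0, .rule KH 0 0] rfl rfl

theorem mul_red_21 : Valid (env aux) 2 1 [Rp 2 1 1 1 0, Rp 2 1 1 1 1, G 2 1 0] [G 2 1 0, Rp 2 1 1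
    1 0] :=
  run_valid [.rule bend_cap_left.symm 2 0, .rule shift_copy 1 1, .right 2, .rule cap_red_21 3 0,
    .right 0, .right 1, .rule red_inv_21 2 0, .left 1, .rule bend_cap_left 0 0] rfl rfl

/-- The phase 1/2 is a character, ω^{x+y} = ω^x ω^y. The proof is the colour change of the
transposed copying rule for the red gate 2/1. -/
theorem red_mul_phase_12 : Valid (env aux) 2 1 [R 2 1 0, Gp 1 2 1 1 0] [Gp 1 2 1 1 0, Gp 1 2 1 1
    1, R 2 1 0] :=
  run_valid [.rule (red_eq 2 1 0 0) 0 0, .rule KH.symm 5 0, .rule ((red_eq' 1 1 2 1).symm) 3 0,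
    .rule mul_red_21.symm 2 0, .rule (red_eq' 1 1 2 1) 2 0, .rule (red_eq' 1 1 2 1) 5 1, .right 0,
    .rule KH 1 0, .left 0, .left 1, .rule KH 2 1, .right 1, .rule ((red_eq 2 1 0 0).symm) 2 0] rfl
    rfl

/-- The middle phase splits as 0/1 = 1/2 + 2/2; the character 1/2 distributes over the sum and
completes both outer phases 0/2 to 1/1. -/
theorem had_normal_01 (h : Valid (env aux) 1 1 [H 0] [Gp 0 2 1 1 0, G 0 2 1, R 2 1 0, Gp 0 1 1 0
    0, Gp 0 2 1 1 0]) : Valid (env aux) 1 1 [H 0] [Gp 1 1 1 1 0, G 0 2 1, R 2 1 0, Gp 2 2 1 0 0,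
    Gp 1 1 1 1 0] :=
  run_valid [.rule h 0 0, .rule ((fuse 1 0 0 1 0 1 2 2 2 0 1 (by decide) rfl rfl).symm) 3 0, .rule
    red_mul_phase_12 2 0, .right 0, .rule (fuse 1 1 0 1 0 0 2 1 2 1 1 (by decide) rfl rfl) 1 0,
    .left 0, .rule (cup_phase 1 2) 1 1, .left 2, .left 3, .rule (fuse 1 1 0 1 0 1 2 0 2 1 1 (by
    decide) rfl rfl) 4 0] rfl rfl

theorem red_mul_phase_21 : Valid (env aux) 2 1 [R 2 1 0, Gp 2 1 1 1 0] [Gp 2 1 1 1 0, Gp 2 1 1 1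
    1, R 2 1 0] :=
  run_valid [.rule ((fuse 1 1 0 1 0 1 2 1 2 2 1 (by decide) rfl rfl).symm) 1 0, .rule
    red_mul_phase_12 0 0, .rule red_mul_phase_12 2 0, .right 0, .rule (fuse 1 1 0 1 0 1 2 1 2 2 1
    (by decide) rfl rfl) 1 0, .left 0, .rule (fuse 1 1 0 1 0 1 2 1 2 2 1 (by decide) rfl rfl) 1 1]
    rfl rfl

theorem had_normal_10 (h : Valid (env aux) 1 1 [H 0] [Gp 2 0 1 1 0, G 0 2 1, R 2 1 0, Gp 1 0 1 0
    0, Gp 2 0 1 1 0]) : Valid (env aux) 1 1 [H 0] [Gp 1 1 1 1 0, G 0 2 1, R 2 1 0, Gp 2 2 1 0 0,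
    Gp 1 1 1 1 0] :=
  run_valid [.rule h 0 0, .rule ((fuse 1 0 0 1 0 2 1 2 2 1 0 (by decide) rfl rfl).symm) 3 0, .rule
    red_mul_phase_21 2 0, .right 0, .rule (fuse 1 1 0 1 0 2 0 2 1 1 1 (by decide) rfl rfl) 1 0,
    .left 0, .rule (cup_phase 2 1) 1 1, .left 2, .left 3, .rule (fuse 1 1 0 1 0 2 1 2 0 1 1 (by
    decide) rfl rfl) 4 0] rfl rfl

end QutritZX

namespace QutritZX
open Diagram Q Layer

variable {E : Equations}

/-! ### Phase gates with arbitrary phases -/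

/-- The green phase gate is trivial. -/
def Triv (E : Equations) (α β : Real.Angle) : Prop := mk E (Z 1 1 α β) = 1

theorem triv_zero : Triv E 0 0 := mk_eq.2 .S2

/-- The values of a function at `0`, `1` and `2`. -/
def three {A : Type*} (x y z : A) : ℕ → A
  | 0 => x
  | 1 => y
  | _ => z

theorem mk_fuse (m n : ℕ) (α β η θ : Real.Angle) :
    (mk E (Z m 1 α β) ≫ mk E (Z 1 n η θ) : Q E m n) = mk E (Z m n (α + η) (β + θ)) := by
  have h : Valid (env (phases E (three α η (α + η)) (three β θ (β + θ)))) (m + 0) (0 + n)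
      [A 0 m 1 0, A 1 1 n 0] [A 2 (m + 0) (0 + n) 0] := by
    refine valid_of (.S1 m n 0 1 0 one_pos α β η θ) ?_ (den_aux 2 (m + 0) (0 + n))
    exact (((den_aux 0 m 1).tensor (den_idn 0)).comp_finCongr (Nat.add_assoc 0 1 0)).append
      ((den_idn 0).tensor (den_aux 1 1 n))
  obtain ⟨q, h₁, h₂⟩ := h
  have h₁' := h₁.cast (v := m) (v' := n) (r := cast (by simp) q) (by simp) (by simp)
    (cast_heq _ _).symm
  have h₂' := h₂.cast (v := m) (v' := n) (r := cast (by simp) q) (by simp) (by simp)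
    (cast_heq _ _).symm
  simp only [Nat.add_zero, Nat.zero_add] at h₂'
  rw [h₂'.unique (den_aux 2 m n)] at h₁'
  exact ((den_aux 0 m 1).append (den_aux 1 1 n)).unique h₁'

theorem mk_Z_mul (α β η θ : Real.Angle) :
    (mk E (Z 1 1 α β) * mk E (Z 1 1 η θ)) = mk E (Z 1 1 (α + η) (β + θ)) := mk_fuse 1 1 α β η θ

theorem Triv.add {α β η θ : Real.Angle} (h : Triv E α β) (h' : Triv E η θ) :
    Triv E (α + η) (β + θ) := by
  rw [Triv, ← mk_Z_mul, h, h', one_mul]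

theorem mk_Z_eq_iff {α β η θ : Real.Angle} :
    mk E (Z 1 1 α β) = mk E (Z 1 1 η θ) ↔ Triv E (η - α) (θ - β) := by
  constructor
  · intro h
    have : mk E (Z 1 1 (-α) (-β)) * mk E (Z 1 1 α β) = 1 := by
      rw [mk_Z_mul, neg_add_cancel, neg_add_cancel]; exact triv_zero
    rw [h, mk_Z_mul, ← sub_eq_neg_add, ← sub_eq_neg_add] at this
    exact this
  · intro h
    rw [← mul_one (mk E (Z 1 1 α β)), ← h, mk_Z_mul, add_sub_cancel, add_sub_cancel]

/-- A phase gate is its phased point multiplied onto the wire, so the point determines the gate;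
counits are treated dually. -/
theorem mk_point_inj {α β η θ : Real.Angle} (h : mk E (Z 0 1 α β) = mk E (Z 0 1 η θ)) :
    mk E (Z 1 1 α β) = mk E (Z 1 1 η θ) := by
  have key (α β : Real.Angle) :
      mk E (Z 1 1 α β) = (mk E (Z 0 1 α β) ⊗ Q.one 1 : Q E 1 2) ≫ mk E (Z 2 1 0 0) :=
    ((aux_fuse (α := fun _ => α) (β := fun _ => β) 0 0 1 0 1 1).eq
      (((den_aux 0 0 1).tensor (.nil 1)).append (den_G 2 1)) (den_aux 0 1 1)).symm
  rw [key, h, ← key]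

theorem mk_counit_inj {α β η θ : Real.Angle} (h : mk E (Z 1 0 α β) = mk E (Z 1 0 η θ)) :
    mk E (Z 1 1 α β) = mk E (Z 1 1 η θ) := by
  have key (α β : Real.Angle) :
      mk E (Z 1 1 α β) = mk E (Z 1 2 0 0) ≫ (Q.one 1 ⊗ mk E (Z 1 0 α β) : Q E 2 1) :=
    ((fuse_aux (α := fun _ => α) (β := fun _ => β) 0 1 0 1 1 0).eq
      ((den_G 1 2).append ((Den.nil 1).tensor (den_aux 0 1 0))) (den_aux 0 1 1)).symm
  rw [key, h, ← key]

theorem mk_X_eq (α β : Real.Angle) : mk E (X 1 1 α β) = kk * mk E (Z 1 1 α β) * hh := by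
  have h (f : Diagram 1 1) : mk E (tensorAll 1 fun _ => f) = mk E f :=
    eq_of_heq (one_zero_tensor (mk E f))
  have := mk_eq.2 (Derivable.H2 (E := E) 1 1 α β)
  rw [mk_comp, mk_comp, h, h] at this
  exact this

theorem mk_X_mul (α β η θ : Real.Angle) :
    (mk E (X 1 1 α β) * mk E (X 1 1 η θ)) = mk E (X 1 1 (α + η) (β + θ)) := by
  calc _ = kk * mk E (Z 1 1 α β) * (hh * kk) * mk E (Z 1 1 η θ) * hh := by
        rw [mk_X_eq, mk_X_eq]; simp only [mul_assoc]
    _ = _ := by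
        rw [hh_mul_kk, mul_one, mk_X_eq, ← mk_Z_mul]; simp only [mul_assoc]

theorem mk_X_of_triv {α β : Real.Angle} (h : Triv E α β) : mk E (X 1 1 α β) = 1 := by
  rw [mk_X_eq, h, mul_one, kk_mul_hh]

theorem mk_X_inv : (mk E (X 1 1 (third 2) (third 1)) * mk E (X 1 1 (third 1) (third 2))) = 1 := by
  rw [mk_X_mul, ← third_add, ← third_add]
  refine mk_X_of_triv ?_
  rw [show (2 + 1 : ZMod 3) = 0 by decide, show (1 + 2 : ZMod 3) = 0 by decide, third_zero]
  exact triv_zero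

theorem mk_K2 (α β : Real.Angle) : mk E (Z 1 1 α β) * mk E (X 1 1 (third 1) (third 2)) =
    mk E (X 1 1 (third 1) (third 2)) * mk E (Z 1 1 (β - α) (-α)) := mk_eq.2 (.K2 α β)

theorem Triv.rotate {α β : Real.Angle} (h : Triv E α β) : Triv E (β - α) (-α) := by
  have := mk_K2 (E := E) α β
  rw [h, one_mul] at this
  rw [Triv, ← one_mul (mk E _), ← mk_X_inv, mul_assoc, ← this]

/-- If the phase `1/2` is trivial, then all phases which are multiples of `2π/3` are. -/
theorem triv_third_of_one_two (h : Triv E (third 1) (third 2)) (p q : ZMod 3) :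
    Triv E (third p) (third q) := by
  -- The red gate 1/2 is trivial by colour change, so (K2) identifies each phase α/β with its
  -- rotated phase.
  have key (α β : Real.Angle) : Triv E (2 • α - β) (α + β) := by
    have e := mk_K2 (E := E) α β
    rw [mk_X_of_triv h, mul_one, one_mul] at e
    have := mk_Z_eq_iff.1 e.symm
    rwa [show α - (β - α) = 2 • α - β by abel, sub_neg_eq_add, add_comm β] at this
  have hk (k : ZMod 3) : (3 : ℕ) • ((2 * Real.pi / 9 * (k.val : ℝ) : ℝ) : Real.Angle) = third k := by
    rw [← Real.Angle.coe_nsmul, third]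
    congr 1
    rw [nsmul_eq_mul]
    push_cast
    ring
  -- With β = −α the trivial phase is 3α/0, and the angle α = 2πp/9 makes it a prescribed multiple
  -- of 2π/3; β = 2α treats the other component.
  have hp : Triv E (third p) 0 := by
    have := key ((2 * Real.pi / 9 * (p.val : ℝ) : ℝ) : Real.Angle)
      (-((2 * Real.pi / 9 * (p.val : ℝ) : ℝ) : Real.Angle))
    rwa [add_neg_cancel, sub_neg_eq_add, ← succ_nsmul, hk] at this
  have hq : Triv E 0 (third q) := by
    have := key ((2 * Real.pi / 9 * (q.val : ℝ) : ℝ) : Real.Angle)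
      (2 • ((2 * Real.pi / 9 * (q.val : ℝ) : ℝ) : Real.Angle))
    rwa [sub_self, ← succ_nsmul', hk] at this
  simpa using hp.add hq

theorem three_eq_zero : (3 : ZMod 3) = 0 := by decide

theorem zmod_three_cases (c : ZMod 3) : c = 0 ∨ c = 1 ∨ c = 2 := by revert c; decide

/-- If some non-zero phase which is a multiple of `2π/3` is trivial, then all of them are. -/
theorem triv_third {c d : ZMod 3} (h : Triv E (third c) (third d)) (hcd : ¬(c = 0 ∧ d = 0))
    (p q : ZMod 3) : Triv E (third p) (third q) := by
  refine triv_third_of_one_two ?_ p q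
  have add {c d c' d' : ZMod 3} (h : Triv E (third c) (third d))
      (h' : Triv E (third c') (third d')) : Triv E (third (c + c')) (third (d + d')) := by
    rw [third_add, third_add]; exact h.add h'
  have h₁ : Triv E (third (d - c)) (third (-c)) := by
    rw [sub_eq_add_neg, third_add, third_neg, ← sub_eq_add_neg]; exact h.rotate
  -- Adding the given phase twice to its rotation produces a multiple of 1/2. It vanishes only for d
  -- = −c, and then the given phase is itself such a multiple.
  have h₂ : Triv E (third (d + c)) (third (-(d + c))) := by
    have := add h₁ (add h h)
    rwa [show d - c + (c + c) = d + c by ring,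
      show -c + (d + d) = -(d + c) by linear_combination d * three_eq_zero]
      at this
  by_cases hs : d + c = 0
  · have hd : d = -c := eq_neg_of_add_eq_zero_left hs
    obtain rfl | rfl | rfl : c = 0 ∨ c = 1 ∨ c = 2 := zmod_three_cases c
    · exact absurd ⟨rfl, by simpa using hd⟩ hcd
    · rwa [hd, show (-1 : ZMod 3) = 2 by decide] at h
    · have h' := add h h
      rwa [hd, show (2 + 2 : ZMod 3) = 1 by decide, show (-2 + -2 : ZMod 3) = 2 by decide] at h'
  · generalize d + c = s at h₂ hs
    obtain rfl | rfl := (zmod_three_cases s).resolve_left hs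
    · rwa [show (-1 : ZMod 3) = 2 by decide] at h₂
    · have h' := add h₂ h₂
      rwa [show (2 + 2 : ZMod 3) = 1 by decide, show (-2 + -2 : ZMod 3) = 2 by decide] at h'

/-! ### The Euler decomposition from local complementation -/

/-- The path on three vertices with centre `2`. -/
def path : Multigraph 3 where
  adj := !![0, 0, 1; 0, 0, 1; 1, 1, 0]
  symm := by intro v w; fin_cases v <;> fin_cases w <;> rfl
  loopless := by intro v; fin_cases v <;> rfl

variable {aux : ℕ → ∀ m n : ℕ, Q E m n}

theorem den_plusState_three :
    Den (env aux) [G 0 1 0, G 0 1 1, G 0 1 2] (mk E (plusState 3)) :=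
  (((den_idn 0).tensor (den_G 0 1)).tensor (den_G 0 1)).tensor (den_G 0 1)

theorem mk_graphState_three (H : Multigraph 3) : mk E (graphState H) =
    mk E (plusState 3) ≫ (on₂ 0 1 (by decide) (mk E (edge (H.adj 0 1))) *
      on₂ 0 2 (by decide) (mk E (edge (H.adj 0 2))) *
      on₂ 1 2 (by decide) (mk E (edge (H.adj 1 2)))) := by
  rw [graphState, mk_foldl, show pairs 3 = [(0, 1), (0, 2), (1, 2)] by decide]
  simp only [List.map_cons, List.map_nil, List.prod_cons, List.prod_nil, mul_one, mul_assoc]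
  rw [mk_onWires (by decide), mk_onWires (by decide), mk_onWires (by decide)]

theorem den_path : Den (env aux) ([G 0 1 0, G 0 1 1, G 0 1 2] ++ ([S 0, G 1 2 1, H 2, G 2 1 2, S 0] ++
    [G 1 2 1, H 2, G 2 1 2])) (mk E (graphState path)) := by
  rw [mk_graphState_three]
  refine den_plusState_three.append ?_
  have h : (on₂ (0 : Fin 3) 1 (by decide) (mk E (edge (path.adj 0 1))) : Q E 3 3) = 1 :=
    map_one (on₂ (0 : Fin 3) 1 (by decide))
  rw [h, one_mul]
  exact den_cz.on₂_zero_two.mul den_cz.on₂_one_two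

theorem den_triangle : Den (env aux) ([G 0 1 0, G 0 1 1, G 0 1 2] ++ (([G 1 2 0, H 1, G 2 1 1] ++
    [S 0, G 1 2 1, H 2, G 2 1 2, S 0]) ++ [G 1 2 1, H 2, G 2 1 2]))
    (mk E (graphState (path.localComp 1 2))) := by
  rw [mk_graphState_three]
  refine den_plusState_three.append ?_
  exact (den_cz.on₂_zero_one.mul den_cz.on₂_zero_two).mul den_cz.on₂_one_two

theorem localRotation_three (a b : Fin 3 → ZMod 3) : localRotation 2 a b =
    idn 0 ⊠ Z 1 1 (third (a 0)) (third (b 0)) ⊠ Z 1 1 (third (a 1)) (third (b 1)) ⊠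
      X 1 1 (third (a 2)) (third (b 2)) := rfl

theorem red_point_comp_12 : Valid (env aux) 0 1 [R 0 1 0, Rp 1 2 1 1 0] [Rp 1 2 0 1 0] :=
  run_valid [.rule (red_eq 0 1 0 0) 0 0, .rule (red_eq 1 1 1 2) 2 0, .rule HK 1 0,
    .rule (fuse 0 1 0 1 0 0 0 1 2 1 2 (by decide) rfl rfl) 0 0, .rule (red_eq 0 1 1 2).symm 0 0]
    rfl rfl

theorem red_phase_counit_12 : Valid (env aux) 1 0 [Rp 1 2 1 1 0, G 1 0 0] [G 1 0 0] :=
  run_valid [.rule (red_eq 1 1 1 2) 0 0, .rule red_counit_K.symm 3 0, .rule HK 2 0,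
    .rule phase_red_counit_12 1 0, .rule red_counit_K 0 0] rfl rfl

theorem mk_red_point_comp (η θ : Real.Angle) :
    (mk E (X 0 1 0 0) ≫ mk E (Z 1 1 η θ) : Q E 0 1) = mk E (X 0 1 0 0) :=
  (red_point_aux_0 (α := fun _ => η) (β := fun _ => θ)).eq ((den_R 0 1).append (den_aux 0 1 1))
    (den_R 0 1)

theorem den_red_12 : Den (env aux) [Rp 1 2 1 1 0] (mk E (X 1 1 (third 1) (third 2))) := by
  simpa using den_red (aux := aux) (E := E) 1 2 1 1

theorem den_red_point_12 : Den (env aux) [Rp 1 2 0 1 0] (mk E (X 0 1 (third 1) (third 2))) := by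
  simpa using den_red (aux := aux) (E := E) 1 2 0 1

theorem mk_red_point_12 : mk E (X 0 1 (third 1) (third 2)) =
    (mk E (X 0 1 0 0) ≫ mk E (X 1 1 (third 1) (third 2)) : Q E 0 1) :=
  ((red_point_comp_12 (aux := fun _ _ _ => mk E (Z _ _ 0 0))).eq
    ((den_R 0 1).append den_red_12) den_red_point_12).symm

theorem mk_red_point_12_comp (η θ : Real.Angle) :
    (mk E (X 0 1 (third 1) (third 2)) ≫ mk E (Z 1 1 η θ) : Q E 0 1) =
      mk E (X 0 1 (third 1) (third 2)) := by
  -- The source angles solve β − α = η and −α = θ, so (K2) carries an arbitrary phase to the side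
  -- where the red point absorbs it.
  have h := mk_K2 (E := E) (-θ) (η - θ)
  rw [sub_neg_eq_add, sub_add_cancel, neg_neg] at h
  have h' := congrArg (fun f : Q E 1 1 => (mk E (X 0 1 0 0) ≫ f : Q E 0 1)) h
  simp only [mul_def, ← Q.assoc] at h'
  rw [mk_red_point_comp, ← mk_red_point_12] at h'
  exact h'.symm

theorem mk_red_12_comp_counit (η θ : Real.Angle) :
    (mk E (X 1 1 (third 1) (third 2)) ≫ mk E (Z 1 0 η θ) : Q E 1 0) = mk E (Z 1 0 (-θ) (η - θ)) := by
  have h := mk_K2 (E := E) (-θ) (η - θ)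
  rw [sub_neg_eq_add, sub_add_cancel, neg_neg] at h
  have hc : (mk E (X 1 1 (third 1) (third 2)) ≫ mk E (Z 1 0 0 0) : Q E 1 0) = mk E (Z 1 0 0 0) :=
    (red_phase_counit_12 (aux := fun _ _ _ => mk E (Z _ _ 0 0))).eq (den_red_12.append (den_G 1 0))
      (den_G 1 0)
  have h' := congrArg (fun f : Q E 1 1 => (f ≫ mk E (Z 1 0 0 0) : Q E 1 0)) h
  simp only [mul_def, Q.assoc] at h'
  rw [hc, mk_fuse, mk_fuse, add_zero, add_zero, add_zero, add_zero] at h'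
  exact h'.symm

theorem euler_of_localComplementationProperty (h : LocalComplementationProperty E) :
    EulerDecomposition E := by
  obtain ⟨a, b, h⟩ := h 3 path 2 1 one_ne_zero
  rw [← mk_eq, mk_comp, localRotation_three] at h
  -- Boxes 0, 1 and 2 carry the phases of the local gates; box 3 carries the middle phase after the
  -- red gate 1/2 has been pushed into the counit.
  obtain ⟨α, hα⟩ : ∃ α : ℕ → Real.Angle, α 0 = third (a 0) ∧ α 1 = third (a 1) ∧
      α 2 = third (a 2) ∧ α 3 = -third (b 2) :=
    ⟨fun | 0 => third (a 0) | 1 => third (a 1) | 2 => third (a 2) | _ => -third (b 2),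
      rfl, rfl, rfl, rfl⟩
  obtain ⟨β, hβ⟩ : ∃ β : ℕ → Real.Angle, β 0 = third (b 0) ∧ β 1 = third (b 1) ∧
      β 2 = third (b 2) ∧ β 3 = third (a 2) - third (b 2) :=
    ⟨fun | 0 => third (b 0) | 1 => third (b 1) | 2 => third (b 2) | _ => third (a 2) - third (b 2),
      rfl, rfl, rfl, rfl⟩
  have hd : Valid (env (phases E α β)) 1 1 [H 0]
      [A 0 1 1 0, G 0 2 1, R 2 1 0, A 2 1 0 0, A 1 1 1 0] := by
    refine had_eq_of_state ⟨_, den_triangle, ?_⟩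
    rw [h]
    have d (i : ℕ) : Den (env (phases E α β)) [A i 1 1 0] (mk E (Z 1 1 (α i) (β i))) :=
      den_aux i 1 1
    have hX : Den (env (phases E α β)) [K 0, A 2 1 1 0, H 0]
        (mk E (X 1 1 (third (a 2)) (third (b 2)))) := by
      rw [mk_X_eq, ← hα.2.2.1, ← hβ.2.2.1]
      exact (den_K.mul (d 2)).mul den_H
    have d0 := d 0
    have d1 := d 1
    rw [hα.1, hβ.1] at d0
    rw [hα.2.1, hβ.2.1] at d1
    exact den_path.append ((((den_idn 0).tensor d0).tensor d1).tensor hX)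
  have t₁ : Triv E (third (a 2 + a 1)) (third (b 2 + b 1)) := by
    have := (point_eq_of_had hd).eq (den_G 0 1) ((den_aux 2 0 1).append (den_aux 1 1 1))
    rw [mk_fuse, hα.2.1, hα.2.2.1, hβ.2.1, hβ.2.2.1, ← third_add, ← third_add] at this
    simpa using mk_Z_eq_iff.1 (mk_point_inj this)
  have t₂ : Triv E (third (a 0 + a 2)) (third (b 0 + b 2)) := by
    have := (counit_eq_of_had hd).eq (den_G 1 0) ((den_aux 0 1 1).append (den_aux 2 1 0))
    rw [mk_fuse, hα.1, hα.2.2.1, hβ.1, hβ.2.2.1, ← third_add, ← third_add] at this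
    simpa using mk_Z_eq_iff.1 (mk_counit_inj this)
  have t₃ : Triv E (third (-b 2 + a 1 - 2)) (third (a 2 - b 2 + b 1 - 1)) := by
    have h₁ : Valid (env (phases E α β)) 0 1 [Rp 1 2 0 1 0, A 0 1 1 0] [Rp 1 2 0 1 0] :=
      ⟨_, den_red_point_12.append (den_aux 0 1 1), by
        rw [mk_red_point_12_comp]; exact den_red_point_12⟩
    have h₂ : Valid (env (phases E α β)) 1 0 [Rp 1 2 1 1 0, A 2 1 0 0] [A 3 1 0 0] :=
      ⟨_, den_red_12.append (den_aux 2 1 0), by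
        rw [mk_red_12_comp_counit, hα.2.2.1, hβ.2.2.1, ← hα.2.2.2, ← hβ.2.2.2]
        exact den_aux 3 1 0⟩
    have := (phase_eq_of_had hd h₁ h₂).eq (den_green 2 1 0 1)
      ((den_aux 3 0 1).append (den_aux 1 1 1))
    rw [mk_fuse, hα.2.1, hα.2.2.2, hβ.2.1, hβ.2.2.2] at this
    have := mk_Z_eq_iff.1 (mk_point_inj this)
    rw [sub_eq_add_neg (-b 2 + a 1), sub_eq_add_neg (a 2 - b 2 + b 1), sub_eq_add_neg (a 2),
      third_add, third_add, third_add, third_add, third_add, third_neg, third_neg, third_neg]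
    simpa [sub_eq_add_neg] using this
  -- The set `E` may itself force phases to be trivial, so the three relations cannot be read as
  -- equations in ℤ/3 without this dichotomy.
  by_cases ht : ∀ p q, Triv E (third p) (third q)
  · have htriv (i : ℕ) (hi : i < 3) : Valid (env (phases E α β)) 1 1 [A i 1 1 0] [] := by
      refine ⟨_, den_aux i 1 1, ?_⟩
      have : Triv E (α i) (β i) := by
        interval_cases i
        · rw [hα.1, hβ.1]; exact ht _ _
        · rw [hα.2.1, hβ.2.1]; exact ht _ _
        · rw [hα.2.2.1, hβ.2.2.1]; exact ht _ _
      rw [this]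
      exact .nil 1
    have hid : mk E had = 1 := (had_eq_id (had_eq_of_trivial hd (htriv 0 (by decide))
      (htriv 1 (by decide)) (htriv 2 (by decide)))).eq den_H (.nil 1)
    refine mk_eq.1 ?_
    have hZ : mk E (Z 1 1 (third 2) (third 2)) = 1 := ht 2 2
    rw [hid, mk_comp, mk_comp, hZ, mk_X_of_triv (ht 2 2)]
    exact (comp_one _).symm ▸ (comp_one _).symm
  · have key {c d : ZMod 3} (h : Triv E (third c) (third d)) : c = 0 ∧ d = 0 := by
      by_contra hcd
      exact ht (triv_third h hcd)
    obtain ⟨e₁, f₁⟩ := key t₁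
    obtain ⟨e₂, f₂⟩ := key t₂
    obtain ⟨e₃, f₃⟩ := key t₃
    have finish {aux : ℕ → ∀ m n : ℕ, Q E m n} (hn : Valid (env aux) 1 1 [H 0]
        [Gp 1 1 1 1 0, G 0 2 1, R 2 1 0, Gp 2 2 1 0 0, Gp 1 1 1 1 0]) : EulerDecomposition E :=
      mk_eq.1 ((had_eq_euler hn).eq den_H
        (((den_green 2 2 1 1).append (den_red 2 2 1 1)).append (den_green 2 2 1 1)))
    have ha0 : a 0 = -a 2 := eq_neg_of_add_eq_zero_left e₂
    have hb0 : b 0 = -b 2 := eq_neg_of_add_eq_zero_left f₂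
    have ha1 : a 1 = -a 2 := eq_neg_of_add_eq_zero_right e₁
    have hb1 : b 1 = -b 2 := eq_neg_of_add_eq_zero_right f₁
    -- Since −2 = 1, the second angle of the third relation reads a 2 + b 2 = 1, which leaves one
    -- free parameter.
    have hb2 : b 2 = 1 - a 2 := by
      rw [hb1] at f₃
      linear_combination f₃ + b 2 * three_eq_zero
    have had {p q r s : ℕ} (hp : -a 2 = p) (hq : -b 2 = q) (hr : a 2 = r) (hs : b 2 = s) :
        Valid (env (phases E α β)) 1 1 [H 0]
          [Gp p q 1 1 0, G 0 2 1, R 2 1 0, Gp r s 1 0 0, Gp p q 1 1 0] := by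
      have e := hd.eq den_H <| (den_aux 0 1 1).append <| ((Den.nil 1).tensor (den_G 0 2)).append <|
        ((den_R 2 1).tensor (.nil 1)).append <| ((den_aux 2 1 0).tensor (.nil 1)).append <|
        den_aux 1 1 1
      rw [hα.1, ha0, hp, hβ.1, hb0, hq, hα.2.1, ha1, hp, hβ.2.1, hb1, hq, hα.2.2.1, hr,
        hβ.2.2.1, hs] at e
      refine ⟨_, den_H, ?_⟩
      rw [e]
      exact (den_green p q 1 1).append <| ((Den.nil 1).tensor (den_G 0 2)).append <|
        ((den_R 2 1).tensor (.nil 1)).append <| ((den_green r s 1 0).tensor (.nil 1)).append <|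
        den_green p q 1 1
    -- The middle phases 0/1, 1/0 and 2/2 differ by characters; the last one is the normal form
    -- itself.
    rcases zmod_three_cases (a 2) with ha2 | ha2 | ha2 <;> rw [ha2] at hb2
    · exact finish (had_normal_01 (had (by rw [ha2]; decide) (by rw [hb2]; decide)
        (by rw [ha2]; decide) (by rw [hb2]; decide)))
    · exact finish (had_normal_10 (had (by rw [ha2]; decide) (by rw [hb2]; decide)
        (by rw [ha2]; decide) (by rw [hb2]; decide)))
    · exact finish (had (by rw [ha2]; decide) (by rw [hb2]; decide)
        (by rw [ha2]; decide) (by rw [hb2]; decide))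

end QutritZX

theorem mainTheorem1 (E : QutritZX.Equations) :
    QutritZX.LocalComplementationProperty E ↔ QutritZX.EulerDecomposition E :=
  ⟨QutritZX.euler_of_localComplementationProperty, QutritZX.localComplementationProperty_of_euler⟩
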